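/- Let $U\subseteq\mathbb R^2$ be open and let $E_0,E_1,E_2,E_3:U\to\mathbb R$ be smooth ($C^\infty$). Consider the scalar equation $$y''+E_3(x,y)\,y'^3+E_2(x,y)\,y'^2+E_1(x,y)\,y'+E_0(x,y)=0.\qquad(\ast)$$ A system of two geodesic equations on an open set $V\subseteq\mathbb R^2$ is $\ddot x^i+\Gamma^i_{jk}(x^1,x^2)\dot x^j\dot x^k=0$ ($i=1,2$) with smooth coefficients $\Gamma^i_{jk}=\Gamma^i_{kj}$ on $V$, where the dot is $d/ds$. It *projects* to $(\ast)$ on $V\subseteq U$ if eliminating $s$ (with $x=x^1$, $y=x^2$, $y'=\dot y/\dot x$, $y''=(\dot x\ddot y-\dot y\ddot x)/\dot x^3$) gives $(\ast)$, that is $E_3=-\Gamma^1_{22}$, $E_2=\Gamma^2_{22}-2\Gamma^1_{12}$, $E_1=2\Gamma^2_{12}-\Gamma^1_{11}$, $E_0=\Gamma^2_{11}$. Its Riemann tensor is $R^i_{jkl}=\Gamma^i_{jl,k}-\Gamma^i_{jk,l}+\Gamma^i_{mk}\Gamma^m_{jl}-\Gamma^i_{ml}\Gamma^m_{jk}$.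 The *symmetry algebra* at a point of an ODE or system is the Lie algebra of germs at that point of smooth infinitesimal point symmetries, i.e. of vector fields in the independent and dependent variables whose second prolongation annihilates the equations on their solutions. A *point transformation* is a smooth $(x,y)\mapsto(u,v)$ with non-vanishing Jacobian. **(A)** For every $z\in U$ the following are equivalent. 1. The symmetry algebra of $(\ast)$ at $z$ is isomorphic to $sl(3,\mathbb R)$. 2. Near $z$, $(\ast)$ is linearizable: some injective point transformation turns it into $v''+\alpha(u)v'+\beta(u)v+\gamma(u)=0$ with smooth $\alpha,\beta,\gamma$. 3. Near $z$, some injective point transformation turns $(\ast)$ into $v''=0$. 4. On a neighbourhood of $z$, $(\ast)$ is the projection of a system of two geodesic equations whose symmetry algebra at $(s,z)$ is isomorphic to $sl(4,\mathbb R)$ for all $s$. 5. On a neighbourhood of $z$, $(\ast)$ is the projection of a system of two geodesic equations with vanishing Riemann tensor. 6. and 7. The same as 4 and as 5, with $\Gamma^i_{jk}$ the Christoffel symbols of a smooth positive definite metric. 8. On a neighbourhood of $z$ there are smooth $b,e$ satisfying the Lie conditions $$\begin{aligned}b_x&=-\tfrac13E_{1y}+\tfrac23E_{2x}+be-E_0E_3,&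 b_y&=E_{3x}-b^2+bE_2-E_1E_3+eE_3,\\ e_x&=E_{0y}+e^2-eE_1-bE_0+E_0E_2,& e_y&=\tfrac23E_{1y}-\tfrac13E_{2x}-be+E_0E_3.\end{aligned}$$ **(B)** A system of two geodesic equations on an open set $V$ has, at $(s,z)$ with $z\in V$, symmetry algebra isomorphic to $sl(4,\mathbb R)$ if and only if its Riemann tensor vanishes near $z$. **(C)** Let a system of two geodesic equations project to $(\ast)$ on the open set $V\subseteq U$, and put $a=-\Gamma^1_{11}$, $b=-\Gamma^1_{12}$, $c=-\Gamma^1_{22}$, $d=-\Gamma^2_{11}$, $e=-\Gamma^2_{12}$, $f=-\Gamma^2_{22}$. At each point of $V$, the Riemann tensor vanishes if and only if $$\begin{aligned}&a_y-b_x+be-cd=0,\qquad b_y-c_x+(ac-b^2)+(bf-ce)=0,\\&d_y-e_x-(ae-bd)-(df-e^2)=0,\qquad (b+f)_x=(a+e)_y,\end{aligned}$$ and these hold if and only if the Lie conditions hold with $b$ and with $-e$ in place of $e$. Conversely, for all smooth $b,e$ on an open $V\subseteq U$, the system with $a=E_1+2e$, $c=E_3$, $d=-E_0$, $f=2b-E_2$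 projects to $(\ast)$ on $V$. **(D)** Suppose in (C) that the Riemann tensor vanishes on $V$. Then near every point of $V$ there is a smooth positive definite metric $p\,dx^2+2q\,dx\,dy+r\,dy^2$ with $$\begin{aligned}p_x&=-2(ap+dq),& q_x&=-bp-(a+e)q-dr,& r_x&=-2(bq+er),\\ p_y&=-2(bp+eq),& q_y&=-cp-(b+f)q-er,& r_y&=-2(cq+fr).\end{aligned}$$ For every such metric on an open set $W\subseteq V$, the equations $u_x^2+v_x^2=p$, $u_xu_y+v_xv_y=q$, $u_y^2+v_y^2=r$ have smooth solutions near every point of $W$, and every smooth solution $(u,v)$ on an open subset of $W$ is a point transformation that turns $(\ast)$ into $v''=0$, with $u$ as independent variable. -/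

import Mathlib

open scoped ContDiff Topology

noncomputable section

/-! ## The Lie algebra of germs of smooth vector fields -/

section Germs

variable {W : Type*} [NormedAddCommGroup W] [NormedSpace ℝ W]

/-- Germs at `z` of vector fields on `W` that are smooth on a neighbourhood of `z`.
(`∀ᶠ q in 𝓝 z, ContDiffAt ℝ ∞ X q` means smoothness on one common neighbourhood.) -/
def smoothFieldGerms (z : W) : Submodule ℝ (Filter.Germ (𝓝 z) W) where
  carrier := {φ | ∃ X : W → W, (∀ᶠ q in 𝓝 z, ContDiffAt ℝ ∞ X q) ∧
    (X : Filter.Germ (𝓝 z) W) = φ}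
  zero_mem' := ⟨0, Filter.Eventually.of_forall fun _ => contDiffAt_const, rfl⟩
  add_mem' := by
    rintro _ _ ⟨X, hX, rfl⟩ ⟨Y, hY, rfl⟩
    exact ⟨X + Y, hX.mp (hY.mono fun q hq hq' => hq'.add hq), rfl⟩
  smul_mem' := by
    rintro c _ ⟨X, hX, rfl⟩
    exact ⟨c • X, hX.mono fun q hq => contDiffAt_const.smul hq, rfl⟩

/-- The bracket of germs, induced by the Lie bracket of vector fields. -/
def germBracket (z : W) : Filter.Germ (𝓝 z) W → Filter.Germ (𝓝 z) W → Filter.Germ (𝓝 z) W :=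
  Quotient.map₂ (fun X Y => VectorField.lieBracket ℝ X Y)
    fun _ _ hX _ _ hY => Filter.EventuallyEq.lieBracket_vectorField hX hY

theorem germBracket_coe (z : W) (X Y : W → W) :
    germBracket z (X : Filter.Germ (𝓝 z) W) (Y : Filter.Germ (𝓝 z) W)
      = (VectorField.lieBracket ℝ X Y : W → W) := rfl

theorem germBracket_mem (z : W) {φ ψ : Filter.Germ (𝓝 z) W}
    (hφ : φ ∈ smoothFieldGerms z) (hψ : ψ ∈ smoothFieldGerms z) :
    germBracket z φ ψ ∈ smoothFieldGerms z := by
  obtain ⟨X, hX, rfl⟩ := hφ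
  obtain ⟨Y, hY, rfl⟩ := hψ
  exact ⟨_, hX.mp (hY.mono fun q hq hq' => hq'.lieBracket_vectorField hq (by simp)), rfl⟩

/-- The type of germs at `z` of smooth vector fields. -/
abbrev FieldGerm (z : W) : Type _ := smoothFieldGerms z

theorem FieldGerm.exists_rep {z : W} (φ : FieldGerm z) :
    ∃ X : W → W, (∀ᶠ q in 𝓝 z, ContDiffAt ℝ ∞ X q) ∧ (X : Filter.Germ (𝓝 z) W) = φ.1 := φ.2

instance (z : W) : Bracket (FieldGerm z) (FieldGerm z) where
  bracket φ ψ := ⟨germBracket z φ.1 ψ.1, germBracket_mem z φ.2 ψ.2⟩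

theorem FieldGerm.val_bracket {z : W} (φ ψ : FieldGerm z) :
    (⁅φ, ψ⁆ : FieldGerm z).1 = germBracket z φ.1 ψ.1 := rfl

theorem ContDiffAt.differentiableAt_of_smooth {X : W → W} {q : W} (h : ContDiffAt ℝ ∞ X q) :
    DifferentiableAt ℝ X q := h.differentiableAt (by simp)

theorem two_le_smooth : minSmoothness ℝ 2 ≤ (∞ : WithTop ℕ∞) := by
  rw [minSmoothness_of_isRCLikeNormedField]
  exact WithTop.coe_le_coe.2 (le_top : (2 : ℕ∞) ≤ ⊤)

/-- Germs of smooth vector fields form a Lie ring under the Lie bracket of vector fields. -/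
instance [CompleteSpace W] (z : W) : LieRing (FieldGerm z) where
  add_lie φ ψ χ := by
    obtain ⟨X, hX, hφ⟩ := φ.exists_rep
    obtain ⟨Y, hY, hψ⟩ := ψ.exists_rep
    obtain ⟨Z, hZ, hχ⟩ := χ.exists_rep
    apply Subtype.ext
    change germBracket z (φ.1 + ψ.1) χ.1 = germBracket z φ.1 χ.1 + germBracket z ψ.1 χ.1
    rw [← hφ, ← hψ, ← hχ]
    refine Filter.Germ.coe_eq.2 ?_
    filter_upwards [hX, hY] with q h1 h2
    exact VectorField.lieBracket_add_left h1.differentiableAt_of_smooth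
      h2.differentiableAt_of_smooth
  lie_add φ ψ χ := by
    obtain ⟨X, hX, hφ⟩ := φ.exists_rep
    obtain ⟨Y, hY, hψ⟩ := ψ.exists_rep
    obtain ⟨Z, hZ, hχ⟩ := χ.exists_rep
    apply Subtype.ext
    change germBracket z φ.1 (ψ.1 + χ.1) = germBracket z φ.1 ψ.1 + germBracket z φ.1 χ.1
    rw [← hφ, ← hψ, ← hχ]
    refine Filter.Germ.coe_eq.2 ?_
    filter_upwards [hY, hZ] with q h1 h2
    exact VectorField.lieBracket_add_right h1.differentiableAt_of_smooth
      h2.differentiableAt_of_smooth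
  lie_self φ := by
    obtain ⟨X, hX, hφ⟩ := φ.exists_rep
    apply Subtype.ext
    change germBracket z φ.1 φ.1 = 0
    rw [← hφ, germBracket_coe, VectorField.lieBracket_self]
    rfl
  leibniz_lie φ ψ χ := by
    obtain ⟨X, hX, hφ⟩ := φ.exists_rep
    obtain ⟨Y, hY, hψ⟩ := ψ.exists_rep
    obtain ⟨Z, hZ, hχ⟩ := χ.exists_rep
    apply Subtype.ext
    change germBracket z φ.1 (germBracket z ψ.1 χ.1)
      = germBracket z (germBracket z φ.1 ψ.1) χ.1 + germBracket z ψ.1 (germBracket z φ.1 χ.1)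
    rw [← hφ, ← hψ, ← hχ]
    refine Filter.Germ.coe_eq.2 ?_
    filter_upwards [hX, hY, hZ] with q h1 h2 h3
    exact VectorField.leibniz_identity_lieBracket (n := ∞) two_le_smooth h1 h2 h3

/-- Germs of smooth vector fields form a real Lie algebra. -/
instance [CompleteSpace W] (z : W) : LieAlgebra ℝ (FieldGerm z) where
  lie_smul c φ ψ := by
    obtain ⟨X, hX, hφ⟩ := φ.exists_rep
    obtain ⟨Y, hY, hψ⟩ := ψ.exists_rep
    apply Subtype.ext
    change germBracket z φ.1 (c • ψ.1) = c • germBracket z φ.1 ψ.1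
    rw [← hφ, ← hψ]
    refine Filter.Germ.coe_eq.2 ?_
    filter_upwards [hY] with q h1
    exact VectorField.lieBracket_const_smul_right h1.differentiableAt_of_smooth

end Germs

/-! ## Point symmetries of second-order systems

A system `y'' = Ω (x, y, y')` with `y` in a normed space `F`; a jet is `j = (x, y, p)` with `p`
in the place of `y'`. A scalar equation has `F = ℝ`, a system of two equations `F = ℝ × ℝ`. -/

section Symmetries

variable {F G : Type*} [NormedAddCommGroup F] [NormedSpace ℝ F]
  [NormedAddCommGroup G] [NormedSpace ℝ G]

/-- The total derivative `D f = ∂f/∂x + p ∂f/∂y + Ω ∂f/∂p` of a function of `(x, y, p)` along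
`y'' = Ω (x, y, y')`. -/
def totalDeriv (Ω : ℝ × F × F → F) (f : ℝ × F × F → G) (j : ℝ × F × F) : G :=
  fderiv ℝ f j (1, j.2.2, Ω j)

/-- A function of `(x, y)` viewed as a function of `(x, y, p)`. -/
def onJets (f : ℝ × F → G) (j : ℝ × F × F) : G := f (j.1, j.2.1)

/-- First prolongation coefficient `η₁ = D η - p D ξ` of `ξ ∂/∂x + η ∂/∂y`, `X = (ξ, η)`. -/
def prolongOne (Ω : ℝ × F × F → F) (X : ℝ × F → ℝ × F) (j : ℝ × F × F) : F :=
  totalDeriv Ω (onJets fun q => (X q).2) j - totalDeriv Ω (onJets fun q => (X q).1) j • j.2.2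

/-- Second prolongation coefficient `η₂ = D η₁ - y'' D ξ`, with `y''` replaced by `Ω`. -/
def prolongTwo (Ω : ℝ × F × F → F) (X : ℝ × F → ℝ × F) (j : ℝ × F × F) : F :=
  totalDeriv Ω (prolongOne Ω X) j - totalDeriv Ω (onJets fun q => (X q).1) j • Ω j

/-- The vector field `X = (ξ, η)` is an infinitesimal point symmetry of `y'' = Ω (x, y, y')` near
`z`: its second prolongation annihilates `y'' - Ω` on the solutions, that is
`η₂ = ξ ∂Ω/∂x + η ∂Ω/∂y + η₁ ∂Ω/∂p` at all jets over a neighbourhood of `z`. -/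
def IsPointSymmetryNear (Ω : ℝ × F × F → F) (z : ℝ × F) (X : ℝ × F → ℝ × F) : Prop :=
  ∀ᶠ q in 𝓝 z, ∀ p : F, prolongTwo Ω X (q.1, q.2, p) =
    fderiv ℝ Ω (q.1, q.2, p) ((X q).1, (X q).2, prolongOne Ω X (q.1, q.2, p))

/-- Near `z`, the Lie algebra of all (germs of smooth) infinitesimal point symmetries of
`y'' = Ω (x, y, y')` is isomorphic to the Lie algebra `L`. -/
def HasSymmetryAlgebra [CompleteSpace F] (Ω : ℝ × F × F → F) (z : ℝ × F)
    (L : Type*) [LieRing L] [LieAlgebra ℝ L] : Prop :=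
  ∃ S : LieSubalgebra ℝ (FieldGerm z),
    (∀ φ : FieldGerm z, φ ∈ S ↔ ∃ X : ℝ × F → ℝ × F,
      (X : Filter.Germ (𝓝 z) (ℝ × F)) = φ.1 ∧ IsPointSymmetryNear Ω z X) ∧
    Nonempty (S ≃ₗ⁅ℝ⁆ L)

end Symmetries

/-- The Lie algebra `sl(n, ℝ)`. -/
abbrev slAlg (n : ℕ) :=
  LieAlgebra.SpecialLinear.sl (Fin n) ℝ

/-! ## The cubic scalar equation and its linearization -/

/-- Right-hand side of `y'' = -(E₃ y'³ + E₂ y'² + E₁ y' + E₀)`, the `Eᵢ` being functions of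
`(x, y)`. -/
def cubicRHS (E : Fin 4 → ℝ × ℝ → ℝ) (j : ℝ × ℝ × ℝ) : ℝ :=
  -(E 3 (j.1, j.2.1) * j.2.2 ^ 3 + E 2 (j.1, j.2.1) * j.2.2 ^ 2
    + E 1 (j.1, j.2.1) * j.2.2 + E 0 (j.1, j.2.1))

/-- Partial derivative with respect to `x`. -/
def dx (f : ℝ × ℝ → ℝ) (q : ℝ × ℝ) : ℝ := fderiv ℝ f q (1, 0)

/-- Partial derivative with respect to `y`. -/
def dy (f : ℝ × ℝ → ℝ) (q : ℝ × ℝ) : ℝ := fderiv ℝ f q (0, 1)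

/-- `(u, v)` is a point transformation on `W` (smooth with non-vanishing Jacobian) that turns the
cubic equation into the linear equation `v'' + α(u) v' + β(u) v + γ(u) = 0`, where
`v' = dv/du = Dv / Du` and `v'' = d²v/du² = D(Dv / Du) / Du` (total derivatives along the
equation) at all jets `(x, y, p)` over `W` with `Du ≠ 0`. -/
def Linearizes (E : Fin 4 → ℝ × ℝ → ℝ) (W : Set (ℝ × ℝ)) (u v : ℝ × ℝ → ℝ)
    (α β γ : ℝ → ℝ) : Prop :=
  ContDiffOn ℝ ∞ u W ∧ ContDiffOn ℝ ∞ v W ∧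
  (∀ q ∈ W, dx u q * dy v q - dy u q * dx v q ≠ 0) ∧
  (∀ q ∈ W, ContDiffAt ℝ ∞ α (u q) ∧ ContDiffAt ℝ ∞ β (u q) ∧ ContDiffAt ℝ ∞ γ (u q)) ∧
  ∀ q ∈ W, ∀ p : ℝ,
    let D : (ℝ × ℝ × ℝ → ℝ) → ℝ × ℝ × ℝ → ℝ := totalDeriv (cubicRHS E)
    let v₁ : ℝ × ℝ × ℝ → ℝ := fun j => D (onJets v) j / D (onJets u) j
    let j : ℝ × ℝ × ℝ := (q.1, q.2, p)
    D (onJets u) j ≠ 0 →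
      D v₁ j / D (onJets u) j + α (u q) * v₁ j + β (u q) * v q + γ (u q) = 0

/-- The Lie conditions on the coefficients of the cubic equation, with auxiliary functions
`b` and `e`, at the point `q`. -/
def LieConditions (E : Fin 4 → ℝ × ℝ → ℝ) (b e : ℝ × ℝ → ℝ) (q : ℝ × ℝ) : Prop :=
  dx b q = -(1 / 3) * dy (E 1) q + 2 / 3 * dx (E 2) q + b q * e q - E 0 q * E 3 q ∧
  dy b q = dx (E 3) q - b q ^ 2 + b q * E 2 q - E 1 q * E 3 q + e q * E 3 q ∧
  dx e q = dy (E 0) q + e q ^ 2 - e q * E 1 q - b q * E 0 q + E 0 q * E 2 q ∧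
  dy e q = 2 / 3 * dy (E 1) q - 1 / 3 * dx (E 2) q - b q * e q + E 0 q * E 3 q

/-! ## Systems of two geodesic equations

Indices `0, 1 : Fin 2` stand for the coordinates `x¹ = x`, `x² = y`; `Γ i j k` is `Γⁱⱼₖ`. -/

/-- Connection coefficients: symmetric in the lower indices and smooth on `V`. -/
def IsConnectionOn (Γ : Fin 2 → Fin 2 → Fin 2 → ℝ × ℝ → ℝ) (V : Set (ℝ × ℝ)) : Prop :=
  (∀ i j k, ContDiffOn ℝ ∞ (Γ i j k) V) ∧ ∀ i j k, ∀ q ∈ V, Γ i j k q = Γ i k j q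

/-- Right-hand side of the geodesic equations `ẍⁱ = -Γⁱⱼₖ ẋʲ ẋᵏ`; a jet is `(s, x, ẋ)`. -/
def geodesicRHS (Γ : Fin 2 → Fin 2 → Fin 2 → ℝ × ℝ → ℝ) (J : ℝ × (ℝ × ℝ) × (ℝ × ℝ)) : ℝ × ℝ :=
  let w : Fin 2 → ℝ := ![J.2.2.1, J.2.2.2]
  (-∑ j, ∑ k, Γ 0 j k J.2.1 * w j * w k, -∑ j, ∑ k, Γ 1 j k J.2.1 * w j * w k)

/-- The geodesic equations of `Γ` project to the cubic equation on `V`: eliminating the parameter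
`s` by `y' = ẏ / ẋ`, `y'' = (ẋ ÿ - ẏ ẍ) / ẋ³` gives the cubic equation. -/
def ProjectsTo (Γ : Fin 2 → Fin 2 → Fin 2 → ℝ × ℝ → ℝ) (E : Fin 4 → ℝ × ℝ → ℝ)
    (V : Set (ℝ × ℝ)) : Prop :=
  ∀ q ∈ V, ∀ s : ℝ, ∀ w : ℝ × ℝ, w.1 ≠ 0 →
    (w.1 * (geodesicRHS Γ (s, q, w)).2 - w.2 * (geodesicRHS Γ (s, q, w)).1) / w.1 ^ 3
      = cubicRHS E (q.1, q.2, w.2 / w.1)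

/-- `i`-th partial derivative. -/
def pd (i : Fin 2) (f : ℝ × ℝ → ℝ) (q : ℝ × ℝ) : ℝ :=
  fderiv ℝ f q ((![(1, 0), (0, 1)] : Fin 2 → ℝ × ℝ) i)

/-- The Riemann curvature tensor `Rⁱⱼₖₗ` of `Γ`. -/
def riemann (Γ : Fin 2 → Fin 2 → Fin 2 → ℝ × ℝ → ℝ) (i j k l : Fin 2) (q : ℝ × ℝ) : ℝ :=
  pd k (Γ i j l) q - pd l (Γ i j k) q
    + ∑ m, Γ i m k q * Γ m j l q - ∑ m, Γ i m l q * Γ m j k q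

/-- The Riemann tensor vanishes at `q`. -/
def RiemannZero (Γ : Fin 2 → Fin 2 → Fin 2 → ℝ × ℝ → ℝ) (q : ℝ × ℝ) : Prop :=
  ∀ i j k l, riemann Γ i j k l q = 0

/-- The flatness conditions on `a = -Γ¹₁₁`, `b = -Γ¹₁₂`, `c = -Γ¹₂₂`, `d = -Γ²₁₁`, `e = -Γ²₁₂`,
`f = -Γ²₂₂` at the point `q`. -/
def FlatnessConditions (a b c d e f : ℝ × ℝ → ℝ) (q : ℝ × ℝ) : Prop :=
  dy a q - dx b q + b q * e q - c q * d q = 0 ∧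
  dy b q - dx c q + (a q * c q - b q ^ 2) + (b q * f q - c q * e q) = 0 ∧
  dy d q - dx e q - (a q * e q - b q * d q) - (d q * f q - e q ^ 2) = 0 ∧
  dx (b + f) q = dy (a + e) q

/-! ## Metrics -/

/-- A smooth (positive definite) metric on `V`. -/
def IsMetricOn (g : Fin 2 → Fin 2 → ℝ × ℝ → ℝ) (V : Set (ℝ × ℝ)) : Prop :=
  (∀ i j, ContDiffOn ℝ ∞ (g i j) V) ∧ ∀ q ∈ V, (Matrix.of fun i j => g i j q).PosDef

/-- The Christoffel symbols `Γⁱⱼₖ = ½ gⁱᵐ (gⱼₘ,ₖ + gₖₘ,ⱼ - gⱼₖ,ₘ)`. -/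
def christoffel (g : Fin 2 → Fin 2 → ℝ × ℝ → ℝ) (i j k : Fin 2) (q : ℝ × ℝ) : ℝ :=
  1 / 2 * ∑ m, (Matrix.of fun i j => g i j q)⁻¹ i m *
    (pd k (g j m) q + pd j (g k m) q - pd m (g j k) q)

/-- The linear equations for the components `p`, `q`, `r` of a metric with given Christoffel
symbols, in terms of `a, …, f`, at the point `z`. -/
def MetricEquations (a b c d e f p q r : ℝ × ℝ → ℝ) (z : ℝ × ℝ) : Prop :=
  dx p z = -2 * (a z * p z + d z * q z) ∧
  dx q z = -(b z * p z) - (a z + e z) * q z - d z * r z ∧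
  dx r z = -2 * (b z * q z + e z * r z) ∧
  dy p z = -2 * (b z * p z + e z * q z) ∧
  dy q z = -(c z * p z) - (b z + f z) * q z - e z * r z ∧
  dy r z = -2 * (c z * q z + f z * r z)

/-- `u_x² + v_x² = p`, `u_x u_y + v_x v_y = q`, `u_y² + v_y² = r` at the point `z`. -/
def IsometryEquations (u v p q r : ℝ × ℝ → ℝ) (z : ℝ × ℝ) : Prop :=
  dx u z ^ 2 + dx v z ^ 2 = p z ∧
  dx u z * dy u z + dx v z * dy v z = q z ∧
  dy u z ^ 2 + dy v z ^ 2 = r z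

end

/-!
# Linearizable cubic equations and flat geodesic systems

The integral curves of the cubic equation are the unparametrized geodesics of every connection
that projects to it, and a system of two geodesic equations describes the unparametrized geodesics
of the product connection on `ℝ × ℝ²` (`suspendConn`). Both symmetry algebras are therefore treated
at once, for a connection `Γ` on `ℝ × F`: a vector field is a point symmetry exactly when the Lie
derivative of `Γ` along it has the form `(v, w) ↦ ψ(v) w + ψ(w) v`, that is, when it is projective
(`isPointSymmetryNear_projRHS_iff`). The first jet of a projective field and its form `ψ` satisfy a
closed linear total differential equation, so that a projective field is determined by this jet at
one point (`exists_eq_zero_of_projJet_eq_zero`). The jets have the dimension of `sl(n + 1, ℝ)`,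
`n = dim (ℝ × F)`, which has two consequences. If `Γ` is flat, the projective algebra of an affine
chart already realizes all jets, so the symmetry algebra is `sl(n + 1, ℝ)`
(`IsAffineChartNear.hasSymmetryAlgebra`). Conversely, if the symmetry algebra is isomorphic to
`sl(n + 1, ℝ)`, then all jets at all nearby points are realized (`eventually_exists_projective`); in
particular, there is a projective field with the first jet of the homothety `q ↦ q` at each nearby
point, and tensors of nonzero weight that are invariant under this field vanish at the point.

For geodesic systems this is applied to the curvature of the product connection
(`two_smul_curvature_eq`): it is given by the derivative of the form `ψ`, the flat factor forces this
derivative to vanish on the other factor, and so the Riemann tensor vanishes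
(`hasSymmetryAlgebra_geodesicRHS_iff`). For the cubic
equation it is applied to the relative invariants of Liouville, Lie and Tresse (`cotton`), the
antisymmetrized covariant derivative of the Ricci tensor of the trace-free projecting connection.
Their invariance is a polynomial identity in a differential ring (`cottonDeriv_coeffVariation`),
applied in the ring of germs of smooth functions. The two invariants are the integrability
conditions of the linear system for `τ` to which the substitution `b = E₂/3 + τ_y/τ`,
`e = E₁/3 - τ_x/τ` reduces the Lie conditions, so that `sl(3, ℝ)` symmetry makes the Lie conditions
solvable (`exists_lieConditions_of_hasSymmetryAlgebra`).

The Lie conditions say that the projecting connection determined by `b` and `e` is flat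
(`riemannZero_iff_flatness`, `flatness_iff_lieConditions`). A flat torsion-free connection has
affine charts, by the Frobenius theorem for linear total differential equations
(`exists_total_solution`); an affine chart straightens the solutions of the cubic equation
(`linearizes_of_affine`) and pulls back the Euclidean metric to a metric with the given Christoffel
symbols (`IsConnectionOn.exists_metric`). Conversely, a transformation to `v'' = 0` exhibits the
cubic equation as the projection of a flat connection (`Linearizes.cubicRHS_eq`), and linear
equations are reducible to `v'' = 0` by means of their solutions
(`Linearizes.exists_linearizes_zero`).
-/

set_option maxSynthPendingDepth 3

noncomputable section

/-! ### Linear total differential equations -/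

section TotalDifferential

theorem ContinuousAt.eventually_norm_lt {T H : Type*} [TopologicalSpace T]
    [NormedAddCommGroup H] {f : T → H} {z : T}
    (hf : ContinuousAt f z) {C : ℝ} (hC : ‖f z‖ < C) : ∀ᶠ q in 𝓝 z, ‖f q‖ < C :=
  hf.norm.eventually_lt_const hC

variable {W G : Type*} [NormedAddCommGroup W] [NormedSpace ℝ W]
  [NormedAddCommGroup G] [NormedSpace ℝ G]

theorem ball_add_smul_mem {z k : W} {r t : ℝ} (hk : ‖k‖ < r) (ht : t ∈ Set.Icc (0 : ℝ) 1) :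
    z + t • k ∈ Metric.ball z r := by
  rw [mem_ball_iff_norm, add_sub_cancel_left, norm_smul, Real.norm_of_nonneg ht.1]
  nlinarith [norm_nonneg k, ht.1, ht.2]

/-- Grönwall along segments: a map controlled by its own size vanishes on a ball as soon as it
vanishes at one point. -/
theorem eq_zero_of_norm_fderiv_le {P : W → G} {z q₀ : W} {r C : ℝ}
    (hP : ∀ q ∈ Metric.ball z r, DifferentiableAt ℝ P q)
    (hC : ∀ q ∈ Metric.ball z r, ‖fderiv ℝ P q‖ ≤ C * ‖P q‖)
    (hq₀ : q₀ ∈ Metric.ball z r) (h₀ : P q₀ = 0) : ∀ q ∈ Metric.ball z r, P q = 0 := by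
  intro q hq
  have hseg : ∀ t ∈ Set.Icc (0 : ℝ) 1, q₀ + t • (q - q₀) ∈ Metric.ball z r := fun t ht =>
    (convex_ball z r).add_smul_sub_mem hq₀ hq ht
  have hd : ∀ t ∈ Set.Icc (0 : ℝ) 1, HasDerivAt (fun t : ℝ => P (q₀ + t • (q - q₀)))
      (fderiv ℝ P (q₀ + t • (q - q₀)) (q - q₀)) t := fun t ht => by
    have h1 : HasDerivAt (fun t : ℝ => q₀ + t • (q - q₀)) (q - q₀) t := by
      simpa using ((hasDerivAt_id t).smul_const (q - q₀)).const_add q₀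
    exact (hP _ (hseg t ht)).hasFDerivAt.comp_hasDerivAt t h1
  have := eq_zero_of_abs_deriv_le_mul_abs_self_of_eq_zero_right (K := C * ‖q - q₀‖)
    (f := fun t : ℝ => P (q₀ + t • (q - q₀))) (a := 0) (b := 1)
    (fun t ht => (hd t ht).continuousAt.continuousWithinAt)
    (fun t ht => (hd t (Set.Ico_subset_Icc_self ht)).hasDerivWithinAt) (by simpa using h₀)
    (fun t ht => by
      refine (ContinuousLinearMap.le_opNorm _ _).trans ?_
      have := mul_le_mul_of_nonneg_right (hC _ (hseg t (Set.Ico_subset_Icc_self ht)))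
        (norm_nonneg (q - q₀))
      linarith) 1 (by simp)
  simpa using this

/-- A solution of a total differential equation `Du = A · u` is as smooth as its coefficients. -/
theorem contDiffOn_of_hasFDerivAt_flip {A : W → W →L[ℝ] G →L[ℝ] G} {u : W → G} {B : Set W}
    (hB : IsOpen B) (hA : ContDiffOn ℝ ∞ A B)
    (hu : ∀ q ∈ B, HasFDerivAt u ((A q).flip (u q)) q) : ContDiffOn ℝ ∞ u B := by
  rw [contDiffOn_infty]
  intro n
  induction n with
  | zero => exact contDiffOn_zero.2 fun q hq => (hu q hq).continuousAt.continuousWithinAt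
  | succ n ih =>
    push_cast
    rw [contDiffOn_succ_iff_fderiv_of_isOpen hB]
    refine ⟨fun q hq => (hu q hq).differentiableAt.differentiableWithinAt, by simp, ?_⟩
    have hA' : ContDiffOn ℝ n (fun q => (A q).flip) B :=
      (ContinuousLinearMap.flipₗᵢ ℝ W G G).toContinuousLinearEquiv.contDiff.comp_contDiffOn
        (hA.of_le (WithTop.coe_le_coe.2 le_top))
    exact (hA'.clm_apply ih).congr fun q hq => (hu q hq).fderiv

/-- The linear ordinary differential equation satisfied along the ray `t ↦ z + t k` has a solution
on the whole of `[0, 1]` when `k` is small. -/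
theorem exists_radial_solution [CompleteSpace G] {A : W → W →L[ℝ] G →L[ℝ] G} {z k : W} {r C : ℝ}
    (hA : ContinuousOn A (Metric.ball z r)) (hC : ∀ q ∈ Metric.ball z r, ‖A q‖ ≤ C)
    (hk : ‖k‖ < r) (g : G) (hkC : C * ‖k‖ * (‖g‖ + 1) ≤ 1) :
    ∃ w : ℝ → G, w 0 = g ∧ ∀ t ∈ Set.Icc (0 : ℝ) 1,
      HasDerivWithinAt w (A (z + t • k) k (w t)) (Set.Icc 0 1) t := by
  have hmem := fun t (ht : t ∈ Set.Icc (0 : ℝ) 1) => ball_add_smul_mem (z := z) hk ht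
  have hC0 : 0 ≤ C := (norm_nonneg _).trans
    (hC z (Metric.mem_ball_self ((norm_nonneg k).trans_lt hk)))
  have hbd : ∀ t ∈ Set.Icc (0 : ℝ) 1, ‖A (z + t • k) k‖ ≤ C * ‖k‖ := fun t ht =>
    ((A _).le_opNorm k).trans (mul_le_mul_of_nonneg_right (hC _ (hmem t ht)) (norm_nonneg k))
  have hPL : IsPicardLindelof (fun t (x : G) => A (z + t • k) k x) (tmin := 0) (tmax := 1)
      ⟨0, by simp⟩ g 1 0 1 ⟨C * ‖k‖, by positivity⟩ := by
    refine ⟨fun t ht => ?_, fun x _ => ?_, fun t ht x hx => ?_, by simp⟩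
    · refine LipschitzOnWith.of_dist_le_mul fun x _ y _ => ?_
      rw [dist_eq_norm, dist_eq_norm, ← map_sub]
      exact ((A (z + t • k) k).le_opNorm _).trans
        (mul_le_mul_of_nonneg_right (hbd t ht) (norm_nonneg _))
    · have : ContinuousOn (fun t : ℝ => A (z + t • k)) (Set.Icc 0 1) :=
        hA.comp (by fun_prop) hmem
      exact (this.clm_apply continuousOn_const).clm_apply continuousOn_const
    · have hx' : ‖x‖ ≤ ‖g‖ + 1 := by
        have := mem_closedBall_iff_norm.1 hx
        have h2 := norm_sub_norm_le x g
        push_cast at this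
        linarith
      calc ‖A (z + t • k) k x‖ ≤ ‖A (z + t • k) k‖ * ‖x‖ := ContinuousLinearMap.le_opNorm _ _
        _ ≤ (C * ‖k‖) * (‖g‖ + 1) := mul_le_mul (hbd t ht) hx' (norm_nonneg _) (by positivity)
        _ ≤ ((1 : NNReal) : ℝ) := by simpa using hkC
  exact hPL.exists_eq_forall_mem_Icc_hasDerivWithinAt₀

/-- The error made at time `1` when the radial solution towards `z + k + h` is predicted from the
one towards `z + k` by the total differential equation is quadratic in `h`. Integrability makes the
terms of first order in the evolution of this error cancel. -/
theorem norm_radial_error_le {A : W → W →L[ℝ] G →L[ℝ] G} {z : W} {r C : ℝ}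
    (hr : r ≤ 1)
    (hA : ∀ q ∈ Metric.ball z r, DifferentiableAt ℝ A q)
    (hA' : ∀ q ∈ Metric.ball z r, DifferentiableAt ℝ (fderiv ℝ A) q)
    (hC : ∀ q ∈ Metric.ball z r, ‖A q‖ ≤ C) (hC1 : ∀ q ∈ Metric.ball z r, ‖fderiv ℝ A q‖ ≤ C)
    (hC2 : ∀ q ∈ Metric.ball z r, ‖fderiv ℝ (fderiv ℝ A) q‖ ≤ C)
    (hflat : ∀ q ∈ Metric.ball z r, ∀ h k, fderiv ℝ A q k h + A q h ∘L A q k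
      = fderiv ℝ A q h k + A q k ∘L A q h) {g : G} {k h : W} (hk : ‖k‖ < r) (hkh : ‖k + h‖ < r)
    {w w' : ℝ → G} (hw0 : w 0 = g) (hw0' : w' 0 = g)
    (hw : ∀ t ∈ Set.Icc (0 : ℝ) 1, HasDerivWithinAt w (A (z + t • k) k (w t)) (Set.Icc 0 1) t)
    (hw' : ∀ t ∈ Set.Icc (0 : ℝ) 1,
      HasDerivWithinAt w' (A (z + t • (k + h)) (k + h) (w' t)) (Set.Icc 0 1) t) :
    ‖w' 1 - w 1 - A (z + k) h (w 1)‖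
      ≤ gronwallBound 0 (C + 1) ((2 * C + 2 * C ^ 2) * (‖g‖ * Real.exp (C + 1)) * ‖h‖ ^ 2) 1 := by
  have hr0 : 0 < r := (norm_nonneg k).trans_lt hk
  have hC0 : 0 ≤ C := (norm_nonneg _).trans (hC z (Metric.mem_ball_self hr0))
  have hmem := fun t (ht : t ∈ Set.Icc (0 : ℝ) 1) => ball_add_smul_mem (z := z) hk ht
  have hmem' := fun t (ht : t ∈ Set.Icc (0 : ℝ) 1) => ball_add_smul_mem (z := z) hkh ht
  have hright : ∀ {f : ℝ → G} {f' : G} {t : ℝ}, t ∈ Set.Ico (0 : ℝ) 1 →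
      HasDerivWithinAt f f' (Set.Icc 0 1) t → HasDerivWithinAt f f' (Set.Ici t) t :=
    fun {f f' t} ht hf => hf.mono_of_mem_nhdsWithin
      (Filter.mem_of_superset (Icc_mem_nhdsGE ht.2) (Set.Icc_subset_Icc_left ht.1))
  have hA1 : ∀ t ∈ Set.Icc (0 : ℝ) 1, ∀ v, ‖A (z + t • k) v‖ ≤ C * ‖v‖ := fun t ht v =>
    ((A _).le_opNorm v).trans (mul_le_mul_of_nonneg_right (hC _ (hmem t ht)) (norm_nonneg v))
  have hA2 : ∀ t ∈ Set.Icc (0 : ℝ) 1, ∀ v, ‖A (z + t • (k + h)) v‖ ≤ C * ‖v‖ := fun t ht v =>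
    ((A _).le_opNorm v).trans (mul_le_mul_of_nonneg_right (hC _ (hmem' t ht)) (norm_nonneg v))
  -- the radial solution is bounded
  have hwb : ∀ t ∈ Set.Icc (0 : ℝ) 1, ‖w t‖ ≤ ‖g‖ * Real.exp (C + 1) := by
    intro t ht
    have := norm_le_gronwallBound_of_norm_deriv_right_le (f := w) (δ := ‖g‖) (K := C + 1) (ε := 0)
      (a := 0) (b := 1) (fun t ht => (hw t ht).continuousWithinAt)
      (fun t ht => hright ht (hw t (Set.Ico_subset_Icc_self ht))) (by rw [hw0])
      (fun t ht => by
        refine (ContinuousLinearMap.le_opNorm _ _).trans ?_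
        have h1 := hA1 t (Set.Ico_subset_Icc_self ht) k
        have h2 : ‖A (z + t • k) k‖ ≤ C + 1 := by nlinarith
        have := mul_le_mul_of_nonneg_right h2 (norm_nonneg (w t))
        linarith) t ht
    rw [gronwallBound_ε0] at this
    refine this.trans (mul_le_mul_of_nonneg_left (Real.exp_le_exp.2 ?_) (norm_nonneg g))
    nlinarith [ht.1, ht.2]
  have hlip : ∀ t ∈ Set.Icc (0 : ℝ) 1, ‖A (z + t • (k + h)) - A (z + t • k)‖ ≤ C * ‖h‖ := by
    intro t ht
    refine ((convex_ball z r).norm_image_sub_le_of_norm_fderiv_le hA hC1 (hmem t ht)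
      (hmem' t ht)).trans (mul_le_mul_of_nonneg_left ?_ hC0)
    rw [show z + t • (k + h) - (z + t • k) = t • h by module, norm_smul, Real.norm_of_nonneg ht.1]
    nlinarith [norm_nonneg h, ht.1, ht.2]
  have htay : ∀ t ∈ Set.Icc (0 : ℝ) 1,
      ‖A (z + t • (k + h)) - A (z + t • k) - t • fderiv ℝ A (z + t • k) h‖ ≤ C * ‖h‖ ^ 2 := by
    intro t ht
    have hsub : segment ℝ (z + t • k) (z + t • (k + h)) ⊆ Metric.ball z r :=
      (convex_ball z r).segment_subset (hmem t ht) (hmem' t ht)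
    have hth : ‖z + t • (k + h) - (z + t • k)‖ ≤ ‖h‖ := by
      rw [show z + t • (k + h) - (z + t • k) = t • h by module, norm_smul,
        Real.norm_of_nonneg ht.1]
      nlinarith [norm_nonneg h, ht.1, ht.2]
    have := (convex_segment (z + t • k) (z + t • (k + h))).norm_image_sub_le_of_norm_fderiv_le'
      (f := A) (φ := fderiv ℝ A (z + t • k)) (C := C * ‖h‖) (fun q hq => hA q (hsub hq))
      (fun q hq => by
        refine ((convex_ball z r).norm_image_sub_le_of_norm_fderiv_le hA' hC2 (hmem t ht)
          (hsub hq)).trans (mul_le_mul_of_nonneg_left ?_ hC0)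
        exact (norm_sub_le_of_mem_segment hq).trans hth)
      (left_mem_segment ℝ _ _) (right_mem_segment ℝ _ _)
    rw [show z + t • (k + h) - (z + t • k) = t • h by module] at this hth
    rw [map_smul] at this
    refine this.trans ?_
    nlinarith [mul_nonneg hC0 (norm_nonneg h)]
  set ρ : ℝ → G := fun t => w' t - w t - t • A (z + t • k) h (w t) with hρ
  have hρ' : ∀ t ∈ Set.Icc (0 : ℝ) 1, HasDerivWithinAt ρ
      (A (z + t • (k + h)) (k + h) (ρ t)
        + ((A (z + t • (k + h)) - A (z + t • k) - t • fderiv ℝ A (z + t • k) h) k (w t)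
        + (A (z + t • (k + h)) - A (z + t • k)) h (w t)
        + t • ((A (z + t • (k + h)) - A (z + t • k)) k + A (z + t • (k + h)) h)
            (A (z + t • k) h (w t)))) (Set.Icc 0 1) t := by
    intro t ht
    have hline : HasDerivAt (fun t : ℝ => z + t • k) k t := by
      simpa using ((hasDerivAt_id t).smul_const k).const_add z
    have h1 : HasDerivWithinAt (fun t : ℝ => A (z + t • k) h)
        (fderiv ℝ A (z + t • k) k h) (Set.Icc 0 1) t := by
      have := ((hA _ (hmem t ht)).hasFDerivAt.comp_hasDerivAt t hline).hasDerivWithinAt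
        (s := Set.Icc 0 1)
      simpa using this.clm_apply (hasDerivWithinAt_const t _ h)
    have h2 := ((hw' t ht).sub (hw t ht)).sub
      ((hasDerivWithinAt_id t (Set.Icc 0 1)).smul (h1.clm_apply (hw t ht)))
    refine h2.congr_deriv ?_
    have hf := congrArg (fun L : G →L[ℝ] G => t • L (w t)) (hflat _ (hmem t ht) h k)
    simp only [add_apply, ContinuousLinearMap.comp_apply, smul_add] at hf
    simp only [hρ, map_add, map_sub, map_smul, add_apply,
      sub_apply, smul_apply, smul_add, smul_sub, id, one_smul]
    rw [hf]
    abel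
  have := norm_le_gronwallBound_of_norm_deriv_right_le (f := ρ) (δ := 0) (K := C + 1)
      (ε := (2 * C + 2 * C ^ 2) * (‖g‖ * Real.exp (C + 1)) * ‖h‖ ^ 2)
      (a := 0) (b := 1) (fun t ht => (hρ' t ht).continuousWithinAt)
      (fun t ht => hright ht (hρ' t (Set.Ico_subset_Icc_self ht))) (by simp [hρ, hw0, hw0'])
      (fun t ht => by
        have ht' := Set.Ico_subset_Icc_self ht
        have hk1 : ‖k‖ ≤ 1 := hk.le.trans hr
        have hh := norm_nonneg h
        have e1 : ‖A (z + t • (k + h)) (k + h) (ρ t)‖ ≤ (C + 1) * ‖ρ t‖ := by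
          refine (ContinuousLinearMap.le_opNorm _ _).trans
            (mul_le_mul_of_nonneg_right ?_ (norm_nonneg _))
          refine (hA2 t ht' _).trans ?_
          nlinarith [norm_nonneg (k + h)]
        have e2 : ‖(A (z + t • (k + h)) - A (z + t • k) - t • fderiv ℝ A (z + t • k) h) k (w t)‖
            ≤ C * ‖h‖ ^ 2 * ‖w t‖ := by
          refine (ContinuousLinearMap.le_opNorm _ _).trans
            (mul_le_mul_of_nonneg_right ?_ (norm_nonneg _))
          refine (ContinuousLinearMap.le_opNorm _ _).trans ?_
          have := htay t ht'
          have h0 := norm_nonneg k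
          calc _ ≤ (C * ‖h‖ ^ 2) * 1 := mul_le_mul this hk1 h0 (by positivity)
            _ = _ := mul_one _
        have e3 : ‖(A (z + t • (k + h)) - A (z + t • k)) h (w t)‖ ≤ C * ‖h‖ ^ 2 * ‖w t‖ := by
          refine (ContinuousLinearMap.le_opNorm _ _).trans
            (mul_le_mul_of_nonneg_right ?_ (norm_nonneg _))
          refine (ContinuousLinearMap.le_opNorm _ _).trans ?_
          have := mul_le_mul_of_nonneg_right (hlip t ht') hh
          linarith
        have e4 : ‖((A (z + t • (k + h)) - A (z + t • k)) k + A (z + t • (k + h)) h)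
            (A (z + t • k) h (w t))‖ ≤ (2 * C * ‖h‖) * (C * ‖h‖ * ‖w t‖) := by
          refine (ContinuousLinearMap.le_opNorm _ _).trans (mul_le_mul ?_ ?_ (norm_nonneg _) ?_)
          · refine (norm_add_le _ _).trans ?_
            have i1 : ‖(A (z + t • (k + h)) - A (z + t • k)) k‖ ≤ C * ‖h‖ := by
              refine (ContinuousLinearMap.le_opNorm _ _).trans ?_
              calc _ ≤ (C * ‖h‖) * 1 := mul_le_mul (hlip t ht') hk1 (norm_nonneg _) (by positivity)
                _ = _ := mul_one _
            linarith [hA2 t ht' h]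
          · exact (ContinuousLinearMap.le_opNorm _ _).trans
              (mul_le_mul_of_nonneg_right (hA1 t ht' h) (norm_nonneg _))
          · positivity
        have e5 : ‖t • ((A (z + t • (k + h)) - A (z + t • k)) k + A (z + t • (k + h)) h)
            (A (z + t • k) h (w t))‖ ≤ (2 * C * ‖h‖) * (C * ‖h‖ * ‖w t‖) := by
          rw [norm_smul, Real.norm_of_nonneg ht'.1]
          calc _ ≤ 1 * _ := mul_le_mul ht'.2 e4 (norm_nonneg _) zero_le_one
            _ = _ := one_mul _
        refine (norm_add_le _ _).trans (add_le_add e1 ?_)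
        refine (norm_add_le _ _).trans ((add_le_add ((norm_add_le _ _).trans (add_le_add e2 e3))
          e5).trans ?_)
        have hb := hwb t ht'
        calc _ = (2 * C + 2 * C ^ 2) * ‖h‖ ^ 2 * ‖w t‖ := by ring
          _ ≤ (2 * C + 2 * C ^ 2) * ‖h‖ ^ 2 * (‖g‖ * Real.exp (C + 1)) := by gcongr
          _ = _ := by ring) 1 (by simp)
  simpa [hρ] using this

/-- **Frobenius theorem for linear total differential equations.** If `A` satisfies the
integrability condition `dA + A ∧ A = 0` near `z`, then `Du = A · u`, `u z = g` has a smooth solution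
near `z`. -/
theorem exists_total_solution [CompleteSpace G] {A : W → W →L[ℝ] G →L[ℝ] G} {z : W}
    (hA : ∀ᶠ q in 𝓝 z, ContDiffAt ℝ ∞ A q)
    (hflat : ∀ᶠ q in 𝓝 z, ∀ h k, fderiv ℝ A q k h + A q h ∘L A q k
      = fderiv ℝ A q h k + A q k ∘L A q h) (g : G) :
    ∃ u : W → G, u z = g ∧
      ∀ᶠ q in 𝓝 z, ContDiffAt ℝ ∞ u q ∧ HasFDerivAt u ((A q).flip (u q)) q := by
  have hAz := hA.self_of_nhds
  have hA1 : ContDiffAt ℝ ∞ (fderiv ℝ A) z := hAz.fderiv_right (by simp)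
  have hA2 : ContDiffAt ℝ ∞ (fderiv ℝ (fderiv ℝ A)) z := hA1.fderiv_right (by simp)
  set C : ℝ := ‖A z‖ + ‖fderiv ℝ A z‖ + ‖fderiv ℝ (fderiv ℝ A) z‖ + 1 with hCdef
  have n0 := norm_nonneg (A z)
  have n1 := norm_nonneg (fderiv ℝ A z)
  have n2 := norm_nonneg (fderiv ℝ (fderiv ℝ A) z)
  have b0 : ∀ᶠ q in 𝓝 z, ‖A q‖ < C :=
    hAz.continuousAt.eventually_norm_lt (by linarith)
  have b1 : ∀ᶠ q in 𝓝 z, ‖fderiv ℝ A q‖ < C :=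
    hA1.continuousAt.eventually_norm_lt (by linarith)
  have b2 : ∀ᶠ q in 𝓝 z, ‖fderiv ℝ (fderiv ℝ A) q‖ < C :=
    hA2.continuousAt.eventually_norm_lt (by linarith)
  obtain ⟨r₀, hr₀, hball⟩ := Metric.eventually_nhds_iff_ball.1
    (hA.and (hflat.and (b0.and (b1.and b2))))
  have hC0 : 0 < C := by linarith
  obtain ⟨r, hr, hrr, hr1, hrC⟩ : ∃ r : ℝ, 0 < r ∧ r ≤ r₀ ∧ r ≤ 1 ∧ C * r * (‖g‖ + 1) ≤ 1 := by
    have hpos : 0 < C * (‖g‖ + 1) := by positivity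
    refine ⟨min r₀ (min 1 (1 / (C * (‖g‖ + 1)))), by positivity, min_le_left _ _,
      (min_le_right _ _).trans (min_le_left _ _), ?_⟩
    have : min r₀ (min 1 (1 / (C * (‖g‖ + 1)))) ≤ 1 / (C * (‖g‖ + 1)) :=
      (min_le_right _ _).trans (min_le_right _ _)
    calc _ = min r₀ (min 1 (1 / (C * (‖g‖ + 1)))) * (C * (‖g‖ + 1)) := by ring
      _ ≤ 1 / (C * (‖g‖ + 1)) * (C * (‖g‖ + 1)) := by gcongr
      _ = 1 := by field_simp
  replace hball := fun q (hq : q ∈ Metric.ball z r) => hball q (Metric.ball_subset_ball hrr hq)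
  have hsm : ContDiffOn ℝ ∞ A (Metric.ball z r) :=
    fun q hq => (hball q hq).1.contDiffWithinAt
  have hex : ∀ k : W, ‖k‖ < r → ∃ w : ℝ → G, w 0 = g ∧ ∀ t ∈ Set.Icc (0 : ℝ) 1,
      HasDerivWithinAt w (A (z + t • k) k (w t)) (Set.Icc 0 1) t := fun k hk =>
    exists_radial_solution hsm.continuousOn (fun q hq => (hball q hq).2.2.1.le) hk g (by
      refine le_trans ?_ hrC
      gcongr)
  choose! w hw0 hw using hex
  have herr : ∀ k h : W, ‖k‖ < r → ‖k + h‖ < r → _ := fun k h hk hkh =>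
    norm_radial_error_le (g := g) hr1 (fun q hq => (hball q hq).1.differentiableAt (by simp))
      (fun q hq => ((hball q hq).1.fderiv_right (m := ∞) (by simp)).differentiableAt (by simp))
      (fun q hq => (hball q hq).2.2.1.le) (fun q hq => (hball q hq).2.2.2.1.le)
      (fun q hq => (hball q hq).2.2.2.2.le) (fun q hq => (hball q hq).2.1) hk hkh
      (hw0 k hk) (hw0 _ hkh) (hw k hk) (hw _ hkh)
  have hder : ∀ q ∈ Metric.ball z r,
      HasFDerivAt (fun q => w (q - z) 1) ((A q).flip (w (q - z) 1)) q := by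
    intro q hq
    have hq' : ‖q - z‖ < r := mem_ball_iff_norm.1 hq
    rw [hasFDerivAt_iff_isLittleO_nhds_zero]
    refine Asymptotics.IsBigO.trans_isLittleO ?_ (Asymptotics.isLittleO_norm_pow_id one_lt_two)
    refine Asymptotics.IsBigO.of_bound ((2 * C + 2 * C ^ 2) * (‖g‖ * Real.exp (C + 1)) / (C + 1)
      * (Real.exp (C + 1) - 1)) ?_
    have hnear : ∀ᶠ h : W in 𝓝 0, ‖q - z + h‖ < r := by
      have : ContinuousAt (fun h : W => ‖q - z + h‖) 0 := by fun_prop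
      exact this.eventually_lt_const (by simpa using hq')
    filter_upwards [hnear] with h hh
    have := herr (q - z) h hq' hh
    rw [gronwallBound_of_K_ne_0 (by positivity)] at this
    simp only [add_sub_cancel, zero_mul, zero_add, mul_one] at this
    rw [show q + h - z = q - z + h by abel, ContinuousLinearMap.flip_apply, norm_pow, norm_norm]
    refine this.trans (le_of_eq (by ring))
  have hreg := contDiffOn_of_hasFDerivAt_flip Metric.isOpen_ball hsm hder
  refine ⟨fun q => w (q - z) 1, ?_, ?_⟩
  · have h0 : ‖(0 : W)‖ < r := by simpa using hr
    have hc := constant_of_derivWithin_zero (f := w 0) (a := 0) (b := 1)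
      (fun t ht => (hw 0 h0 t ht).differentiableWithinAt)
      (fun t ht => by
        have h1 := hw 0 h0 t (Set.Ico_subset_Icc_self ht)
        rw [h1.derivWithin (uniqueDiffOn_Icc zero_lt_one t (Set.Ico_subset_Icc_self ht))]
        simp) 1 (by simp)
    simpa [hw0 0 h0] using hc
  · filter_upwards [Metric.ball_mem_nhds z hr] with q hq
    exact ⟨hreg.contDiffAt (Metric.isOpen_ball.mem_nhds hq), hder q hq⟩

end TotalDifferential

/-! ### Point symmetries as projective vector fields -/

theorem one_le_smooth : (1 : WithTop ℕ∞) ≤ ∞ := WithTop.coe_le_coe.2 (le_top : (1 : ℕ∞) ≤ ⊤)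

theorem one_ne_smooth : (1 : WithTop ℕ∞) ≠ ∞ := fun h =>
  ENat.one_ne_top (WithTop.coe_injective h)

section LieDerivative

variable {W : Type*} [NormedAddCommGroup W] [NormedSpace ℝ W]

/-- The Lie derivative along `X` of the connection with coefficients `Γ`, a bilinear map at each
point: `D²X(v, w) + (D_X Γ)(v, w) + Γ(DX v, w) + Γ(v, DX w) - DX (Γ(v, w))`. -/
def lieConn (Γ : W → W →L[ℝ] W →L[ℝ] W) (X : W → W) (q : W) : W →L[ℝ] W →L[ℝ] W :=
  fderiv ℝ (fderiv ℝ X) q + fderiv ℝ Γ q (X q) + Γ q ∘L fderiv ℝ X q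
    + ((Γ q).flip ∘L fderiv ℝ X q).flip
    - ContinuousLinearMap.compL ℝ W W W (fderiv ℝ X q) ∘L Γ q

theorem lieConn_apply (Γ : W → W →L[ℝ] W →L[ℝ] W) (X : W → W) (q v w : W) :
    lieConn Γ X q v w = fderiv ℝ (fderiv ℝ X) q v w + fderiv ℝ Γ q (X q) v w
      + Γ q (fderiv ℝ X q v) w + Γ q v (fderiv ℝ X q w) - fderiv ℝ X q (Γ q v w) := rfl

theorem fderiv_symm_of_eventually {Γ : W → W →L[ℝ] W →L[ℝ] W} {q : W} (hΓ : DifferentiableAt ℝ Γ q)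
    (hs : ∀ᶠ q' in 𝓝 q, ∀ v w, Γ q' v w = Γ q' w v) (u v w : W) :
    fderiv ℝ Γ q u v w = fderiv ℝ Γ q u w v := by
  have h1 : ∀ a b : W, HasFDerivAt (fun q' => Γ q' a b)
      (((fderiv ℝ Γ q).flip a).flip b) q := fun a b => by
    have := (hΓ.hasFDerivAt.clm_apply (hasFDerivAt_const a q)).clm_apply (hasFDerivAt_const b q)
    refine this.congr_fderiv ?_
    ext x
    simp
  have h2 := (h1 v w).unique ((h1 w v).congr_of_eventuallyEq (hs.mono fun q' h => h v w))
  simpa using congrArg (fun L : W →L[ℝ] W => L u) h2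

theorem lieConn_symm {Γ : W → W →L[ℝ] W →L[ℝ] W} {X : W → W} {q : W}
    (hΓ : ContDiffAt ℝ ∞ Γ q) (hs : ∀ᶠ q' in 𝓝 q, ∀ v w, Γ q' v w = Γ q' w v)
    (hX : ContDiffAt ℝ ∞ X q) (v w : W) : lieConn Γ X q v w = lieConn Γ X q w v := by
  have h1 : fderiv ℝ (fderiv ℝ X) q v w = fderiv ℝ (fderiv ℝ X) q w v :=
    (hX.isSymmSndFDerivAt two_le_smooth).eq v w
  have h2 := hs.self_of_nhds
  rw [lieConn_apply, lieConn_apply, h1,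
    fderiv_symm_of_eventually (hΓ.differentiableAt (by simp)) hs, h2 v w,
    h2 (fderiv ℝ X q v) w, h2 v (fderiv ℝ X q w)]
  abel

end LieDerivative

section Projective

variable {F : Type*} [NormedAddCommGroup F] [NormedSpace ℝ F]

/-- The second-order system `y'' = Γ⁰(w, w) y' - Γ'(w, w)`, `w = (1, y')`, of the unparametrized
geodesics of the connection `Γ = (Γ⁰, Γ')` on `ℝ × F`. -/
def projRHS (Γ : ℝ × F → (ℝ × F) →L[ℝ] (ℝ × F) →L[ℝ] (ℝ × F)) (j : ℝ × F × F) : F :=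
  (Γ (j.1, j.2.1) (1, j.2.2) (1, j.2.2)).1 • j.2.2 - (Γ (j.1, j.2.1) (1, j.2.2) (1, j.2.2)).2

/-- The only candidate for a linear form `ψ` with `B(v, w) = ψ(v) w + ψ(w) v`. -/
def pureTraceForm (B : (ℝ × F) →L[ℝ] (ℝ × F) →L[ℝ] (ℝ × F)) : (ℝ × F) →L[ℝ] ℝ :=
  ContinuousLinearMap.fst ℝ ℝ F ∘L B (1, 0)
    - (1 / 2 * (B (1, 0) (1, 0)).1) • ContinuousLinearMap.fst ℝ ℝ F

theorem pureTraceForm_apply (B : (ℝ × F) →L[ℝ] (ℝ × F) →L[ℝ] (ℝ × F)) (w : ℝ × F) :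
    pureTraceForm B w = (B (1, 0) w).1 - 1 / 2 * (B (1, 0) (1, 0)).1 * w.1 := rfl

theorem pureTraceForm_eq {B : (ℝ × F) →L[ℝ] (ℝ × F) →L[ℝ] (ℝ × F)} {ψ : (ℝ × F) →L[ℝ] ℝ}
    (h : ∀ v w, B v w = ψ v • w + ψ w • v) : pureTraceForm B = ψ := by
  ext w
  · simp [pureTraceForm_apply, h]; ring
  · simp [pureTraceForm_apply, h]

/-- `X` is an infinitesimal projective transformation of `Γ` at `q`: the Lie derivative of `Γ` is
pure trace. -/
def IsProjectiveAt (Γ : ℝ × F → (ℝ × F) →L[ℝ] (ℝ × F) →L[ℝ] (ℝ × F)) (X : ℝ × F → ℝ × F)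
    (q : ℝ × F) : Prop :=
  ∀ v w, lieConn Γ X q v w
    = pureTraceForm (lieConn Γ X q) v • w + pureTraceForm (lieConn Γ X q) w • v

/-- A symmetric bilinear map whose quadratic form sends each `w = (1, p)` to a multiple of `w` is
pure trace, by comparing the coefficients of the powers of `t` for `w = (1, t p)`. -/
theorem pure_trace_iff [Nontrivial F] {B : (ℝ × F) →L[ℝ] (ℝ × F) →L[ℝ] (ℝ × F)}
    (hB : ∀ v w, B v w = B w v) :
    (∀ p : F, (B (1, p) (1, p)).2 - (B (1, p) (1, p)).1 • p = 0) ↔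
      ∀ v w, B v w = pureTraceForm B v • w + pureTraceForm B w • v := by
  constructor
  · intro h
    have expand : ∀ (t : ℝ) (p : F), B (1, t • p) (1, t • p)
        = B (1, 0) (1, 0) + (2 * t) • B (1, 0) (0, p) + t ^ 2 • B (0, p) (0, p) := by
      intro t p
      have : ((1 : ℝ), t • p) = (1, 0) + t • ((0 : ℝ), p) := by simp
      rw [this]
      simp only [map_add, map_smul, add_apply, smul_apply, hB (0, p) (1, 0)]
      module
    have hpoly : ∀ (t : ℝ) (p : F), (B (1, 0) (1, 0)).2
        + t • ((2 : ℝ) • (B (1, 0) (0, p)).2 - (B (1, 0) (1, 0)).1 • p)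
        + t ^ 2 • ((B (0, p) (0, p)).2 - (2 * (B (1, 0) (0, p)).1) • p)
        - t ^ 3 • ((B (0, p) (0, p)).1 • p) = 0 := by
      intro t p
      have := h (t • p)
      rw [expand] at this
      simp only [Prod.fst_add, Prod.snd_add, Prod.smul_fst, Prod.smul_snd, smul_eq_mul] at this
      refine Eq.trans ?_ this
      module
    have h0 : (B (1, 0) (1, 0)).2 = 0 := by simpa using h 0
    have h3 : ∀ p, (B (0, p) (0, p)).1 • p = 0 := by
      intro p
      have a1 := hpoly 1 p
      have a2 := hpoly (-1) p
      have a3 := hpoly 2 p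
      rw [h0] at a1 a2 a3
      have : (6 : ℝ) • ((B (0, p) (0, p)).1 • p) = 0 := by
        linear_combination (norm := module) (3 : ℝ) • a1 + a2 - a3
      simpa using this
    have h2 : ∀ p, (B (0, p) (0, p)).2 = (2 * (B (1, 0) (0, p)).1) • p := by
      intro p
      have a1 := hpoly 1 p
      have a2 := hpoly (-1) p
      rw [h0, h3] at a1 a2
      have : (2 : ℝ) • ((B (0, p) (0, p)).2 - (2 * (B (1, 0) (0, p)).1) • p) = 0 := by
        linear_combination (norm := module) a1 + a2
      rw [smul_eq_zero_iff_right two_ne_zero] at this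
      exact sub_eq_zero.1 this
    have h1 : ∀ p, (B (1, 0) (0, p)).2 = (1 / 2 * (B (1, 0) (1, 0)).1) • p := by
      intro p
      have a1 := hpoly 1 p
      have a2 := hpoly (-1) p
      rw [h0, h3] at a1 a2
      have : (2 : ℝ) • ((B (1, 0) (0, p)).2 - (1 / 2 * (B (1, 0) (1, 0)).1) • p) = 0 := by
        linear_combination (norm := module) (1 / 2 : ℝ) • a1 - (1 / 2 : ℝ) • a2
      rw [smul_eq_zero_iff_right two_ne_zero] at this
      exact sub_eq_zero.1 this
    have h3' : ∀ p, (B (0, p) (0, p)).1 = 0 := by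
      intro p
      by_cases hp : p = 0
      · rw [show ((0 : ℝ), p) = 0 by simp [hp]]; simp
      · simpa [hp] using h3 p
    -- polarization
    have hFF : ∀ p p', B (0, p) (0, p')
        = (0, (B (1, 0) (0, p)).1 • p' + (B (1, 0) (0, p')).1 • p) := by
      intro p p'
      have e : ∀ x, B (0, x) (0, x) = (0, (2 * (B (1, 0) (0, x)).1) • x) := fun x =>
        Prod.ext (h3' x) (h2 x)
      have e1 := e (p + p')
      have e2 : ((0 : ℝ), p + p') = (0, p) + (0, p') := by simp
      have e3 : (2 : ℝ) • B (0, p) (0, p')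
          = (2 : ℝ) • ((0 : ℝ), (B (1, 0) (0, p)).1 • p' + (B (1, 0) (0, p')).1 • p) := by
        have : (2 : ℝ) • B (0, p) (0, p') = B (0, p + p') (0, p + p') - B (0, p) (0, p)
            - B (0, p') (0, p') := by
          rw [e2]
          simp only [map_add, add_apply, hB (0, p') (0, p)]
          module
        rw [this, e1, e p, e p', e2]
        simp only [map_add, Prod.fst_add]
        ext
        · simp
        · simp only [Prod.snd_sub, Prod.smul_snd]
          module
      exact smul_right_injective _ (two_ne_zero (α := ℝ)) e3
    have hEF : ∀ p, B (1, 0) (0, p)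
        = ((B (1, 0) (0, p)).1, (1 / 2 * (B (1, 0) (1, 0)).1) • p) := fun p => Prod.ext rfl (h1 p)
    have hEE : B (1, 0) (1, 0) = ((B (1, 0) (1, 0)).1, 0) := Prod.ext rfl h0
    intro v w
    have hv : v = v.1 • ((1 : ℝ), (0 : F)) + (0, v.2) := by ext <;> simp
    have hw : w = w.1 • ((1 : ℝ), (0 : F)) + (0, w.2) := by ext <;> simp
    have key : B v w = (v.1 * w.1) • B (1, 0) (1, 0) + v.1 • B (1, 0) (0, w.2)
        + w.1 • B (1, 0) (0, v.2) + B (0, v.2) (0, w.2) := by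
      conv_lhs => rw [hv, hw]
      simp only [map_add, map_smul, add_apply, smul_apply, hB (0, v.2) (1, 0)]
      module
    have key1 : ∀ x : ℝ × F, (B (1, 0) x).1 = x.1 * (B (1, 0) (1, 0)).1 + (B (1, 0) (0, x.2)).1 := by
      intro x
      have hx : x = x.1 • ((1 : ℝ), (0 : F)) + (0, x.2) := by ext <;> simp
      have := congrArg (fun y => (B (1, 0) y).1) hx
      simpa only [map_add, map_smul, Prod.fst_add, Prod.smul_fst, smul_eq_mul] using this
    rw [key, pureTraceForm_apply, pureTraceForm_apply, key1 v, key1 w, hFF, hEF v.2, hEF w.2]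
    ext
    · simp only [Prod.fst_add, Prod.smul_fst, smul_eq_mul]; ring
    · simp only [Prod.snd_add, Prod.smul_snd, h0]; module
  · intro h p
    rw [h (1, p) (1, p)]
    simp only [Prod.snd_add, Prod.smul_snd, Prod.fst_add, Prod.smul_fst, smul_eq_mul]
    module

theorem hasFDerivAt_jet (j : ℝ × F × F) : HasFDerivAt (fun j : ℝ × F × F => (j.1, j.2.1))
      ((ContinuousLinearMap.fst ℝ ℝ (F × F)).prod
        (ContinuousLinearMap.fst ℝ F F ∘L ContinuousLinearMap.snd ℝ ℝ (F × F))) j :=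
  ((ContinuousLinearMap.fst ℝ ℝ (F × F)).prod
    (ContinuousLinearMap.fst ℝ F F ∘L ContinuousLinearMap.snd ℝ ℝ (F × F))).hasFDerivAt

theorem hasFDerivAt_jet_dir (j : ℝ × F × F) : HasFDerivAt (fun j : ℝ × F × F => ((1 : ℝ), j.2.2))
      ((0 : ℝ × F × F →L[ℝ] ℝ).prod
        (ContinuousLinearMap.snd ℝ F F ∘L ContinuousLinearMap.snd ℝ ℝ (F × F))) j :=
  (hasFDerivAt_const (1 : ℝ) j).prodMk
    (ContinuousLinearMap.snd ℝ F F ∘L ContinuousLinearMap.snd ℝ ℝ (F × F)).hasFDerivAt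

theorem totalDeriv_onJets {G : Type*} [NormedAddCommGroup G] [NormedSpace ℝ G]
    {Ω : ℝ × F × F → F} {f : ℝ × F → G} {j : ℝ × F × F}
    (hf : DifferentiableAt ℝ f (j.1, j.2.1)) :
    totalDeriv Ω (onJets f) j = fderiv ℝ f (j.1, j.2.1) (1, j.2.2) := by
  have := (hf.hasFDerivAt.comp j (hasFDerivAt_jet j)).fderiv
  rw [totalDeriv, show onJets f = f ∘ fun j : ℝ × F × F => (j.1, j.2.1) from rfl, this]
  simp

theorem prolongOne_eq {Ω : ℝ × F × F → F} {X : ℝ × F → ℝ × F} {j : ℝ × F × F}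
    (hX : DifferentiableAt ℝ X (j.1, j.2.1)) :
    prolongOne Ω X j = (fderiv ℝ X (j.1, j.2.1) (1, j.2.2)).2
      - (fderiv ℝ X (j.1, j.2.1) (1, j.2.2)).1 • j.2.2 := by
  rw [prolongOne, totalDeriv_onJets hX.snd, totalDeriv_onJets hX.fst, hX.hasFDerivAt.fst.fderiv,
    hX.hasFDerivAt.snd.fderiv]
  rfl

theorem fderiv_projRHS {Γ : ℝ × F → (ℝ × F) →L[ℝ] (ℝ × F) →L[ℝ] (ℝ × F)} {j : ℝ × F × F}
    (hΓ : DifferentiableAt ℝ Γ (j.1, j.2.1)) (a : ℝ × F) (η : F) :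
    fderiv ℝ (projRHS Γ) j (a.1, a.2, η) =
      ((fderiv ℝ Γ (j.1, j.2.1) a (1, j.2.2) (1, j.2.2)).1
        + (Γ (j.1, j.2.1) (0, η) (1, j.2.2)).1 + (Γ (j.1, j.2.1) (1, j.2.2) (0, η)).1) • j.2.2
      + (Γ (j.1, j.2.1) (1, j.2.2) (1, j.2.2)).1 • η
      - ((fderiv ℝ Γ (j.1, j.2.1) a (1, j.2.2) (1, j.2.2)).2
        + (Γ (j.1, j.2.1) (0, η) (1, j.2.2)).2 + (Γ (j.1, j.2.1) (1, j.2.2) (0, η)).2) := by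
  have h1 := ((hΓ.hasFDerivAt.comp j (hasFDerivAt_jet j)).clm_apply
    (hasFDerivAt_jet_dir j)).clm_apply (hasFDerivAt_jet_dir j)
  have h2 := (h1.fst.smul (ContinuousLinearMap.snd ℝ F F ∘L
    ContinuousLinearMap.snd ℝ ℝ (F × F)).hasFDerivAt).sub h1.snd
  have h3 : fderiv ℝ (projRHS Γ) j = _ := h2.fderiv
  rw [h3]
  simp [ContinuousLinearMap.comp_apply]
  module

theorem totalDeriv_prolongOne {Ω : ℝ × F × F → F} {X : ℝ × F → ℝ × F} {j : ℝ × F × F}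
    (hX : ContDiffAt ℝ ∞ X (j.1, j.2.1)) :
    totalDeriv Ω (prolongOne Ω X) j =
      (fderiv ℝ (fderiv ℝ X) (j.1, j.2.1) (1, j.2.2) (1, j.2.2)
        + fderiv ℝ X (j.1, j.2.1) (0, Ω j)).2
      - ((fderiv ℝ (fderiv ℝ X) (j.1, j.2.1) (1, j.2.2) (1, j.2.2)
        + fderiv ℝ X (j.1, j.2.1) (0, Ω j)).1 • j.2.2
        + (fderiv ℝ X (j.1, j.2.1) (1, j.2.2)).1 • Ω j) := by
  have hev : ∀ᶠ q in 𝓝 (j.1, j.2.1), DifferentiableAt ℝ X q :=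
    ((hX.of_le one_le_smooth).eventually one_ne_smooth).mono
      fun q hq => hq.differentiableAt one_ne_zero
  have heq : prolongOne Ω X =ᶠ[𝓝 j] fun j => (fderiv ℝ X (j.1, j.2.1) (1, j.2.2)).2
      - (fderiv ℝ X (j.1, j.2.1) (1, j.2.2)).1 • j.2.2 :=
    ((hasFDerivAt_jet j).continuousAt.eventually hev).mono fun j' h => prolongOne_eq h
  have hDX : DifferentiableAt ℝ (fderiv ℝ X) (j.1, j.2.1) :=
    (hX.fderiv_right (m := ∞) (by simp)).differentiableAt (by simp)
  have h1 := (hDX.hasFDerivAt.comp j (hasFDerivAt_jet j)).clm_apply (hasFDerivAt_jet_dir j)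
  have h2 := h1.snd.sub (h1.fst.smul (ContinuousLinearMap.snd ℝ F F ∘L
    ContinuousLinearMap.snd ℝ ℝ (F × F)).hasFDerivAt)
  have h3 : fderiv ℝ (prolongOne Ω X) j = _ := heq.fderiv_eq.trans h2.fderiv
  rw [totalDeriv, h3]
  simp [ContinuousLinearMap.comp_apply]
  module

/-- The symmetry condition at a jet `(q, p)` says that the Lie derivative of the connection sends
`(w, w)`, `w = (1, p)`, to a multiple of `w`. -/
theorem prolongTwo_sub_eq {Γ : ℝ × F → (ℝ × F) →L[ℝ] (ℝ × F) →L[ℝ] (ℝ × F)}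
    {X : ℝ × F → ℝ × F} {q : ℝ × F} (hΓ : DifferentiableAt ℝ Γ q)
    (hs : ∀ v w, Γ q v w = Γ q w v) (hX : ContDiffAt ℝ ∞ X q) (p : F) :
    prolongTwo (projRHS Γ) X (q.1, q.2, p) - fderiv ℝ (projRHS Γ) (q.1, q.2, p)
        ((X q).1, (X q).2, prolongOne (projRHS Γ) X (q.1, q.2, p))
      = (lieConn Γ X q (1, p) (1, p)).2 - (lieConn Γ X q (1, p) (1, p)).1 • p := by
  have hXd : DifferentiableAt ℝ X q := hX.differentiableAt (by simp)
  rw [prolongTwo, totalDeriv_prolongOne (j := (q.1, q.2, p)) hX,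
    totalDeriv_onJets (j := (q.1, q.2, p)) hXd.fst, hXd.hasFDerivAt.fst.fderiv,
    fderiv_projRHS (j := (q.1, q.2, p)) hΓ, prolongOne_eq (j := (q.1, q.2, p)) hXd]
  simp only [ContinuousLinearMap.comp_apply, ContinuousLinearMap.coe_fst']
  have e1 : ((0 : ℝ), projRHS Γ (q.1, q.2, p))
      = (Γ q (1, p) (1, p)).1 • ((1 : ℝ), p) - Γ q (1, p) (1, p) := by
    ext <;> simp [projRHS]
  have e2 : ((0 : ℝ), (fderiv ℝ X q (1, p)).2 - (fderiv ℝ X q (1, p)).1 • p)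
      = fderiv ℝ X q (1, p) - (fderiv ℝ X q (1, p)).1 • ((1 : ℝ), p) := by
    ext <;> simp
  rw [e1, e2, hs (_ - _) (1, p), lieConn_apply, hs (fderiv ℝ X q (1, p)) (1, p)]
  simp only [projRHS, map_sub, map_smul, Prod.fst_add, Prod.snd_add, Prod.fst_sub, Prod.snd_sub,
    Prod.smul_fst, Prod.smul_snd, smul_eq_mul]
  module

theorem isPointSymmetryNear_projRHS_iff [Nontrivial F]
    {Γ : ℝ × F → (ℝ × F) →L[ℝ] (ℝ × F) →L[ℝ] (ℝ × F)} {X : ℝ × F → ℝ × F} {z : ℝ × F}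
    (hΓ : ∀ᶠ q in 𝓝 z, ContDiffAt ℝ ∞ Γ q) (hs : ∀ᶠ q in 𝓝 z, ∀ v w, Γ q v w = Γ q w v)
    (hX : ∀ᶠ q in 𝓝 z, ContDiffAt ℝ ∞ X q) :
    IsPointSymmetryNear (projRHS Γ) z X ↔ ∀ᶠ q in 𝓝 z, IsProjectiveAt Γ X q := by
  refine Filter.eventually_congr ?_
  filter_upwards [hΓ, hs.eventually_nhds, hX] with q h1 h2 h3
  rw [IsProjectiveAt, ← pure_trace_iff (lieConn_symm h1 h2 h3)]
  refine forall_congr' fun p => ?_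
  rw [← prolongTwo_sub_eq (h1.differentiableAt (by simp)) h2.self_of_nhds h3, sub_eq_zero]

/-- Point symmetries near `z` depend only on the equation over a neighbourhood of `z`. -/
theorem IsPointSymmetryNear.congr {Ω Ω' : ℝ × F × F → F} {z : ℝ × F} {X : ℝ × F → ℝ × F}
    (h : ∀ᶠ q in 𝓝 z, ∀ p, Ω (q.1, q.2, p) = Ω' (q.1, q.2, p))
    (hX : IsPointSymmetryNear Ω z X) : IsPointSymmetryNear Ω' z X := by
  unfold IsPointSymmetryNear at hX ⊢
  filter_upwards [hX, h.eventually_nhds.eventually_nhds] with q h1 h2 p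
  have key : ∀ j : ℝ × F × F, (∀ᶠ q in 𝓝 (j.1, j.2.1), ∀ p, Ω (q.1, q.2, p) = Ω' (q.1, q.2, p)) →
      Ω =ᶠ[𝓝 j] Ω' := fun j hj =>
    ((hasFDerivAt_jet j).continuousAt.eventually hj).mono fun j' hj' => hj' j'.2.2
  have hone : prolongOne Ω X =ᶠ[𝓝 (q.1, q.2, p)] prolongOne Ω' X := by
    filter_upwards [(hasFDerivAt_jet (q.1, q.2, p)).continuousAt.eventually h2] with j hj
    rw [prolongOne, prolongOne, totalDeriv, totalDeriv, totalDeriv, totalDeriv,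
      (key j hj).self_of_nhds]
  have h0 := key (q.1, q.2, p) h2.self_of_nhds
  have := h1 p
  rw [h0.fderiv_eq, hone.self_of_nhds] at this
  rw [← this, prolongTwo, prolongTwo, totalDeriv, totalDeriv, totalDeriv, totalDeriv,
    h0.self_of_nhds, hone.fderiv_eq]

theorem hasSymmetryAlgebra_congr [CompleteSpace F] {Ω Ω' : ℝ × F × F → F} {z : ℝ × F}
    (h : ∀ᶠ q in 𝓝 z, ∀ p, Ω (q.1, q.2, p) = Ω' (q.1, q.2, p))
    (L : Type*) [LieRing L] [LieAlgebra ℝ L] :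
    HasSymmetryAlgebra Ω z L ↔ HasSymmetryAlgebra Ω' z L := by
  have h' : ∀ᶠ q in 𝓝 z, ∀ p, Ω' (q.1, q.2, p) = Ω (q.1, q.2, p) :=
    h.mono fun q hq p => (hq p).symm
  unfold HasSymmetryAlgebra
  simp only [show ∀ X, IsPointSymmetryNear Ω z X ↔ IsPointSymmetryNear Ω' z X from
    fun X => ⟨fun hX => hX.congr h, fun hX => hX.congr h'⟩]

end Projective

/-! ### Projective vector fields are determined by their jet at a point -/

theorem ContDiffAt.eventually_differentiableAt {V H : Type*} [NormedAddCommGroup V]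
    [NormedSpace ℝ V] [NormedAddCommGroup H] [NormedSpace ℝ H] {X : V → H} {q : V}
    (hX : ContDiffAt ℝ ∞ X q) : ∀ᶠ q' in 𝓝 q, DifferentiableAt ℝ X q' :=
  ((hX.of_le one_le_smooth).eventually one_ne_smooth).mono
    fun _ h => h.differentiableAt one_ne_zero

theorem ContDiffAt.fderiv_smooth {V H : Type*} [NormedAddCommGroup V]
    [NormedSpace ℝ V] [NormedAddCommGroup H] [NormedSpace ℝ H] {X : V → H} {q : V}
    (hX : ContDiffAt ℝ ∞ X q) : ContDiffAt ℝ ∞ (fderiv ℝ X) q := hX.fderiv_right (by simp)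

section Jets

variable {W : Type*} [NormedAddCommGroup W] [NormedSpace ℝ W]

theorem lieConn_add {Γ : W → W →L[ℝ] W →L[ℝ] W} {X Y : W → W} {q : W}
    (hX : ContDiffAt ℝ ∞ X q) (hY : ContDiffAt ℝ ∞ Y q) :
    lieConn Γ (X + Y) q = lieConn Γ X q + lieConn Γ Y q := by
  have h1 : fderiv ℝ (X + Y) =ᶠ[𝓝 q] fderiv ℝ X + fderiv ℝ Y := by
    filter_upwards [hX.eventually_differentiableAt, hY.eventually_differentiableAt] with q' h1 h2
    exact fderiv_add h1 h2
  ext v w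
  simp only [lieConn_apply, add_apply, h1.fderiv_eq, h1.self_of_nhds, Pi.add_apply, map_add,
    fderiv_add (hX.fderiv_smooth.differentiableAt (by simp))
      (hY.fderiv_smooth.differentiableAt (by simp))]
  abel

theorem lieConn_smul {Γ : W → W →L[ℝ] W →L[ℝ] W} {X : W → W} {q : W} (c : ℝ)
    (hX : ContDiffAt ℝ ∞ X q) : lieConn Γ (c • X) q = c • lieConn Γ X q := by
  have h1 : fderiv ℝ (c • X) =ᶠ[𝓝 q] c • fderiv ℝ X := by
    filter_upwards [hX.eventually_differentiableAt] with q' h1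
    exact fderiv_const_smul h1 c
  ext v w
  simp only [lieConn_apply, smul_apply, h1.fderiv_eq, h1.self_of_nhds, Pi.smul_apply, map_smul,
    fderiv_const_smul (hX.fderiv_smooth.differentiableAt (by simp))]
  module

/-- The part of `-lieConn Γ X` that involves only `X` and `DX`, as a linear function of the pair
`(X, DX)`. -/
def lowerOrderPart (Γ : W → W →L[ℝ] W →L[ℝ] W) (q : W) :
    (W × (W →L[ℝ] W)) →L[ℝ] (W →L[ℝ] W →L[ℝ] W) :=
  ((ContinuousLinearMap.compL ℝ W (W →L[ℝ] W) (W →L[ℝ] W)).flip (Γ q)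
      ∘L ContinuousLinearMap.compL ℝ W W W) ∘L ContinuousLinearMap.snd ℝ W (W →L[ℝ] W)
    - fderiv ℝ Γ q ∘L ContinuousLinearMap.fst ℝ W (W →L[ℝ] W)
    - ContinuousLinearMap.compL ℝ W W (W →L[ℝ] W) (Γ q)
      ∘L ContinuousLinearMap.snd ℝ W (W →L[ℝ] W)
    - ((ContinuousLinearMap.flipₗᵢ ℝ W W W).toContinuousLinearEquiv.toContinuousLinearMap
      ∘L ContinuousLinearMap.compL ℝ W W (W →L[ℝ] W)
        ((ContinuousLinearMap.flipₗᵢ ℝ W W W).toContinuousLinearEquiv (Γ q)))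
      ∘L ContinuousLinearMap.snd ℝ W (W →L[ℝ] W)

theorem lowerOrderPart_apply (Γ : W → W →L[ℝ] W →L[ℝ] W) (q x : W) (L : W →L[ℝ] W) (v w : W) :
    lowerOrderPart Γ q (x, L) v w
      = L (Γ q v w) - fderiv ℝ Γ q x v w - Γ q (L v) w - Γ q v (L w) := rfl

theorem lieConn_eq_sub (Γ : W → W →L[ℝ] W →L[ℝ] W) (X : W → W) (q : W) :
    lieConn Γ X q = fderiv ℝ (fderiv ℝ X) q - lowerOrderPart Γ q (X q, fderiv ℝ X q) := by
  ext v w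
  simp only [lieConn_apply, sub_apply, lowerOrderPart_apply]
  abel

theorem contDiffAt_lowerOrderPart {Γ : W → W →L[ℝ] W →L[ℝ] W} {q : W}
    (hΓ : ContDiffAt ℝ ∞ Γ q) : ContDiffAt ℝ ∞ (lowerOrderPart Γ) q := by
  unfold lowerOrderPart
  refine ((ContDiffAt.sub ?_ ?_).sub ?_).sub ?_
  · exact ((((ContinuousLinearMap.compL ℝ W (W →L[ℝ] W)
      (W →L[ℝ] W)).flip.contDiff.contDiffAt).comp q hΓ).clm_comp contDiffAt_const).clm_comp
      contDiffAt_const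
  · exact hΓ.fderiv_smooth.clm_comp contDiffAt_const
  · exact ((ContinuousLinearMap.compL ℝ W W (W →L[ℝ] W)).contDiff.contDiffAt.comp q hΓ).clm_comp
      contDiffAt_const
  · exact (contDiffAt_const.clm_comp ((ContinuousLinearMap.compL ℝ W W
      (W →L[ℝ] W)).contDiff.contDiffAt.comp q ((ContinuousLinearMap.flipₗᵢ ℝ W W
      W).toContinuousLinearEquiv.contDiff.contDiffAt.comp q hΓ))).clm_comp contDiffAt_const

theorem contDiffAt_lieConn {Γ : W → W →L[ℝ] W →L[ℝ] W} {X : W → W} {q : W}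
    (hΓ : ContDiffAt ℝ ∞ Γ q) (hX : ContDiffAt ℝ ∞ X q) : ContDiffAt ℝ ∞ (lieConn Γ X) q := by
  rw [funext (lieConn_eq_sub Γ X)]
  exact hX.fderiv_smooth.fderiv_smooth.sub
    ((contDiffAt_lowerOrderPart hΓ).clm_apply (hX.prodMk hX.fderiv_smooth))

end Jets

section ProjectiveJets

variable {F : Type*} [NormedAddCommGroup F] [NormedSpace ℝ F]

/-- The symmetric bilinear map `(v, w) ↦ ψ(v) w + ψ(w) v` attached to a linear form `ψ`. -/
def pureTrace (W : Type*) [NormedAddCommGroup W] [NormedSpace ℝ W] :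
    (W →L[ℝ] ℝ) →L[ℝ] (W →L[ℝ] W →L[ℝ] W) :=
  ContinuousLinearMap.smulRightL ℝ W (W →L[ℝ] W) |>.flip (ContinuousLinearMap.id ℝ W)
    |> fun T => T + (ContinuousLinearMap.flipₗᵢ ℝ W W W).toContinuousLinearEquiv.toContinuousLinearMap ∘L T

theorem pureTrace_apply {W : Type*} [NormedAddCommGroup W] [NormedSpace ℝ W] (ψ : W →L[ℝ] ℝ)
    (v w : W) : pureTrace W ψ v w = ψ v • w + ψ w • v := rfl

theorem pureTraceForm_add (B C : (ℝ × F) →L[ℝ] (ℝ × F) →L[ℝ] (ℝ × F)) :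
    pureTraceForm (B + C) = pureTraceForm B + pureTraceForm C := by
  refine ContinuousLinearMap.ext fun w => ?_
  simp only [pureTraceForm_apply, add_apply, Prod.fst_add]
  ring

theorem pureTraceForm_smul (c : ℝ) (B : (ℝ × F) →L[ℝ] (ℝ × F) →L[ℝ] (ℝ × F)) :
    pureTraceForm (c • B) = c • pureTraceForm B := by
  refine ContinuousLinearMap.ext fun w => ?_
  simp only [pureTraceForm_apply, smul_apply, Prod.smul_fst, smul_eq_mul]
  ring

theorem ContDiffAt.pureTraceForm {V : Type*} [NormedAddCommGroup V] [NormedSpace ℝ V]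
    {B : V → (ℝ × F) →L[ℝ] (ℝ × F) →L[ℝ] (ℝ × F)} {q : V} (hB : ContDiffAt ℝ ∞ B q) :
    ContDiffAt ℝ ∞ (fun q => pureTraceForm (B q)) q := by
  have h1 : ContDiffAt ℝ ∞ (fun q => B q (1, 0)) q := hB.clm_apply contDiffAt_const
  have h2 : ContDiffAt ℝ ∞ (fun q => B q (1, 0) (1, 0)) q := h1.clm_apply contDiffAt_const
  exact (contDiffAt_const.clm_comp h1).sub ((contDiffAt_const.mul h2.fst).smul contDiffAt_const)

theorem IsProjectiveAt.add {Γ : ℝ × F → (ℝ × F) →L[ℝ] (ℝ × F) →L[ℝ] (ℝ × F)}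
    {X Y : ℝ × F → ℝ × F} {q : ℝ × F} (hX : ContDiffAt ℝ ∞ X q) (hY : ContDiffAt ℝ ∞ Y q)
    (h : IsProjectiveAt Γ X q) (h' : IsProjectiveAt Γ Y q) : IsProjectiveAt Γ (X + Y) q := by
  intro v w
  rw [lieConn_add hX hY, pureTraceForm_add]
  simp only [add_apply]
  rw [h v w, h' v w]
  module

theorem IsProjectiveAt.smul {Γ : ℝ × F → (ℝ × F) →L[ℝ] (ℝ × F) →L[ℝ] (ℝ × F)}
    {X : ℝ × F → ℝ × F} {q : ℝ × F} (c : ℝ) (hX : ContDiffAt ℝ ∞ X q)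
    (h : IsProjectiveAt Γ X q) : IsProjectiveAt Γ (c • X) q := by
  intro v w
  rw [lieConn_smul c hX, pureTraceForm_smul]
  simp only [smul_apply]
  rw [h v w]
  module

/-- The vector fields that are smooth and infinitesimally projective at all points of `B`. -/
def projectiveFields (Γ : ℝ × F → (ℝ × F) →L[ℝ] (ℝ × F) →L[ℝ] (ℝ × F)) (B : Set (ℝ × F)) :
    Submodule ℝ (ℝ × F → ℝ × F) where
  carrier := {X | ∀ q ∈ B, ContDiffAt ℝ ∞ X q ∧ IsProjectiveAt Γ X q}
  zero_mem' := fun q _ => ⟨contDiffAt_const, by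
    have : IsProjectiveAt Γ ((0 : ℝ) • (0 : ℝ × F → ℝ × F)) q := by
      intro v w
      have h0 : ContDiffAt ℝ ∞ (0 : ℝ × F → ℝ × F) q := contDiffAt_const
      rw [lieConn_smul 0 h0, pureTraceForm_smul]
      simp
    simpa using this⟩
  add_mem' := fun hX hY q hq => ⟨(hX q hq).1.add (hY q hq).1,
    (hX q hq).2.add (hX q hq).1 (hY q hq).1 (hY q hq).2⟩
  smul_mem' := fun c _ hX q hq => ⟨contDiffAt_const.smul (hX q hq).1,
    (hX q hq).2.smul c (hX q hq).1⟩

/-- The jets of projective vector fields: the value, the derivative, and the trace part of the second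
derivative. -/
abbrev ProjJet (F : Type*) [NormedAddCommGroup F] [NormedSpace ℝ F] : Type _ :=
  (ℝ × F) × ((ℝ × F) →L[ℝ] (ℝ × F)) × ((ℝ × F) →L[ℝ] ℝ)

/-- The jet of `X` at `q`; the second-order part is the form `ψ` of the Lie derivative of `Γ`. -/
def projJet (Γ : ℝ × F → (ℝ × F) →L[ℝ] (ℝ × F) →L[ℝ] (ℝ × F)) (X : ℝ × F → ℝ × F) (q : ℝ × F) :
    ProjJet F := (X q, fderiv ℝ X q, pureTraceForm (lieConn Γ X q))

/-- `projJet` at a point of `B` as a linear map on `projectiveFields Γ B`. -/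
def projJetₗ (Γ : ℝ × F → (ℝ × F) →L[ℝ] (ℝ × F) →L[ℝ] (ℝ × F)) {B : Set (ℝ × F)} {q : ℝ × F}
    (hq : q ∈ B) : projectiveFields Γ B →ₗ[ℝ] ProjJet F where
  toFun X := projJet Γ X q
  map_add' X Y := by
    have hX := (X.2 q hq).1
    have hY := (Y.2 q hq).1
    simp only [projJet, Submodule.coe_add, lieConn_add hX hY, pureTraceForm_add,
      fderiv_add (hX.differentiableAt (by simp)) (hY.differentiableAt (by simp))]
    rfl
  map_smul' c X := by
    have hX := (X.2 q hq).1
    simp only [projJet, Submodule.coe_smul, lieConn_smul c hX, pureTraceForm_smul,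
      fderiv_const_smul (hX.differentiableAt (by simp))]
    rfl

theorem finrank_projJet [FiniteDimensional ℝ F] :
    Module.finrank ℝ (ProjJet F) = (Module.finrank ℝ F + 2) ^ 2 - 1 := by
  have h1 : Module.finrank ℝ ((ℝ × F) →L[ℝ] (ℝ × F)) = (Module.finrank ℝ F + 1) ^ 2 := by
    rw [← (LinearMap.toContinuousLinearMap (𝕜 := ℝ) (E := ℝ × F) (F' := ℝ × F)).finrank_eq,
      Module.finrank_linearMap, Module.finrank_prod, Module.finrank_self]
    ring
  have h2 : Module.finrank ℝ ((ℝ × F) →L[ℝ] ℝ) = Module.finrank ℝ F + 1 := by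
    rw [← (LinearMap.toContinuousLinearMap (𝕜 := ℝ) (E := ℝ × F) (F' := ℝ)).finrank_eq,
      Module.finrank_linearMap, Module.finrank_prod, Module.finrank_self]
    ring
  have h3 : Module.finrank ℝ (ProjJet F) = Module.finrank ℝ (ℝ × F)
      + (Module.finrank ℝ ((ℝ × F) →L[ℝ] (ℝ × F)) + Module.finrank ℝ ((ℝ × F) →L[ℝ] ℝ)) :=
    Module.finrank_prod.trans (congrArg (Module.finrank ℝ (ℝ × F) + ·) Module.finrank_prod)
  rw [h3, h1, h2, Module.finrank_prod, Module.finrank_self]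
  refine (Nat.sub_eq_of_eq_add ?_).symm
  ring

/-- The part of a covariant derivative `a = Dψ` visible in the symmetry of third derivatives. -/
def pureTraceAlt (W : Type*) [NormedAddCommGroup W] [NormedSpace ℝ W] :
    (W →L[ℝ] W →L[ℝ] ℝ) →ₗ[ℝ] (W →L[ℝ] W →L[ℝ] W →L[ℝ] W) where
  toFun a := pureTrace W ∘L a - (pureTrace W ∘L a).flip
  map_add' a b := by
    ext u v w
    simp [ContinuousLinearMap.comp_apply]
    abel
  map_smul' c a := by
    ext u v w
    simp [ContinuousLinearMap.comp_apply, smul_sub]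

theorem pureTraceAlt_apply {W : Type*} [NormedAddCommGroup W] [NormedSpace ℝ W]
    (a : W →L[ℝ] W →L[ℝ] ℝ) (u v w : W) : pureTraceAlt W a u v w
      = a u v • w + a u w • v - (a v u • w + a v w • u) := rfl

theorem pureTraceAlt_injective [Nontrivial F] :
    Function.Injective (pureTraceAlt (ℝ × F)) := by
  rw [← LinearMap.ker_eq_bot, LinearMap.ker_eq_bot']
  intro a ha
  have h : ∀ u v w : ℝ × F, a u v • w + a u w • v - (a v u • w + a v w • u) = 0 := fun u v w => by
    rw [← pureTraceAlt_apply, ha]; rfl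
  obtain ⟨f, hf⟩ := exists_ne (0 : F)
  -- the coefficients on independent vectors vanish
  have hE0 : a (1, 0) (1, 0) = 0 := by
    have := congrArg Prod.snd (h (0, f) (1, 0) (1, 0))
    simpa [hf] using this
  have hFF : ∀ x, a (0, x) (0, x) = 0 := fun x => by
    have := congrArg Prod.fst (h (1, 0) (0, x) (0, x))
    simpa using this
  have hanti : ∀ x y, a (0, x) (0, y) = a (0, y) (0, x) := fun x y => by
    have := congrArg Prod.fst (h (0, x) (0, y) (1, 0))
    simp at this
    linarith
  have hFF' : ∀ x y, a (0, x) (0, y) = 0 := fun x y => by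
    have h1 := hFF (x + y)
    rw [show ((0 : ℝ), x + y) = (0, x) + (0, y) by simp] at h1
    simp only [map_add, add_apply, hFF, hanti y x] at h1
    linarith
  have hEF : ∀ x, a (1, 0) (0, x) = 0 ∧ a (0, x) (1, 0) = 0 := fun x => by
    by_cases hx : x = 0
    · rw [show ((0 : ℝ), x) = 0 by simp [hx]]; simp
    have h1 := congrArg Prod.fst (h (0, x) (1, 0) (1, 0))
    have h2 := congrArg Prod.snd (h (1, 0) (0, x) (0, x))
    simp [hE0] at h1
    simp [hFF'] at h2
    have h3 : (2 * a (1, 0) (0, x) - a (0, x) (1, 0)) • x = 0 := by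
      refine Eq.trans ?_ h2
      module
    have h4 : 2 * a (1, 0) (0, x) - a (0, x) (1, 0) = 0 := by simpa [hx] using h3
    constructor <;> linarith
  ext u
  · simp [hE0]
  · simp [(hEF u).1]
  · simp [(hEF _).2]
  · simp [hFF']

/-- If `X₁` plays the role of `DX` and `DX₁ = Φ(X, X₁) + T ψ`, where `Dψ` can be recovered from the
antisymmetrization of `T ∘ Dψ`, then the symmetry of the second derivative of `X₁` bounds the
derivative of `(X, X₁, ψ)` by its value. -/
theorem norm_fderiv_prolongation_le {W V D : Type*} [NormedAddCommGroup W] [NormedSpace ℝ W]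
    [NormedAddCommGroup V] [NormedSpace ℝ V] [NormedAddCommGroup D] [NormedSpace ℝ D]
    {Φ : W → (W × V) →L[ℝ] (W →L[ℝ] V)} {T : D →L[ℝ] (W →L[ℝ] V)} {A κ : ℝ} (hκ0 : 0 ≤ κ)
    {q : W} {X : W → W} {X₁ : W → V} {ψ : W → D} (hΦ : DifferentiableAt ℝ Φ q)
    (hΦ0 : ‖Φ q‖ ≤ A) (hΦ1 : ‖fderiv ℝ Φ q‖ ≤ A)
    (hκ : ∀ a : W →L[ℝ] D, ‖a‖ ≤ κ * ‖T ∘L a - (T ∘L a).flip‖)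
    (hX : DifferentiableAt ℝ X q) (hX' : ‖fderiv ℝ X q‖ ≤ ‖X₁ q‖)
    (hX₁ : DifferentiableAt ℝ X₁ q) (hψ : DifferentiableAt ℝ ψ q)
    (heq : fderiv ℝ X₁ =ᶠ[𝓝 q] fun q => Φ q (X q, X₁ q) + T (ψ q))
    (hsymm : ∀ u v, fderiv ℝ (fderiv ℝ X₁) q u v = fderiv ℝ (fderiv ℝ X₁) q v u) :
    ‖fderiv ℝ (fun q => (X q, X₁ q, ψ q)) q‖
      ≤ (1 + (A + ‖T‖) + κ * (2 * (A + A * (1 + (A + ‖T‖))))) * ‖(X q, X₁ q, ψ q)‖ := by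
  set τ := ‖T‖ with hτ
  have nτ : 0 ≤ τ := norm_nonneg _
  set P := (X q, X₁ q, ψ q) with hP
  have hA0 : 0 ≤ A := (norm_nonneg _).trans hΦ0
  have p0 : ‖X q‖ ≤ ‖P‖ := norm_fst_le P
  have p12 : ‖P.2‖ ≤ ‖P‖ := norm_snd_le P
  have p1 : ‖X₁ q‖ ≤ ‖P‖ := (norm_fst_le P.2).trans p12
  have p2 : ‖ψ q‖ ≤ ‖P‖ := (norm_snd_le P.2).trans p12
  have p01 : ‖(X q, X₁ q)‖ ≤ ‖P‖ := max_le p0 p1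
  have p1' := hX'.trans p1
  have nP := norm_nonneg P
  have hjet : HasFDerivAt (fun q => (X q, X₁ q, ψ q))
      ((fderiv ℝ X q).prod ((fderiv ℝ X₁ q).prod (fderiv ℝ ψ q))) q :=
    hX.hasFDerivAt.prodMk (hX₁.hasFDerivAt.prodMk hψ.hasFDerivAt)
  have p3 : ‖fderiv ℝ X₁ q‖ ≤ (A + τ) * ‖P‖ := by
    rw [heq.self_of_nhds]
    calc _ ≤ ‖Φ q‖ * ‖(X q, X₁ q)‖ + τ * ‖ψ q‖ := (norm_add_le _ _).trans
          (add_le_add (ContinuousLinearMap.le_opNorm _ _) (ContinuousLinearMap.le_opNorm _ _))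
      _ ≤ A * ‖P‖ + τ * ‖P‖ := by gcongr
      _ = _ := by ring
  set K : W →L[ℝ] W →L[ℝ] V :=
    (fderiv ℝ Φ q).flip (X q, X₁ q) + Φ q ∘L ((fderiv ℝ X q).prod (fderiv ℝ X₁ q)) with hK
  have hD3 : HasFDerivAt (fderiv ℝ X₁) (K + T ∘L fderiv ℝ ψ q) q := by
    have h1 := hΦ.hasFDerivAt.clm_apply (hX.hasFDerivAt.prodMk hX₁.hasFDerivAt)
    have h2 := T.hasFDerivAt.comp q hψ.hasFDerivAt
    refine ((h1.add h2).congr_of_eventuallyEq heq).congr_fderiv ?_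
    rw [hK, add_comm (Φ q ∘L _)]
  have hAlt : T ∘L fderiv ℝ ψ q - (T ∘L fderiv ℝ ψ q).flip = K.flip - K := by
    refine ContinuousLinearMap.ext fun u => ContinuousLinearMap.ext fun v => ?_
    have := hsymm u v
    rw [hD3.fderiv] at this
    simp only [add_apply] at this
    simp only [sub_apply, ContinuousLinearMap.flip_apply]
    rw [sub_eq_sub_iff_add_eq_add, add_comm, this, add_comm]
  have hKn : ‖K‖ ≤ (A + A * (1 + (A + τ))) * ‖P‖ := by
    have k1 : ‖(fderiv ℝ Φ q).flip (X q, X₁ q)‖ ≤ A * ‖P‖ := by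
      refine (ContinuousLinearMap.le_opNorm _ _).trans ?_
      rw [ContinuousLinearMap.opNorm_flip]
      gcongr
    have k2 : ‖(fderiv ℝ X q).prod (fderiv ℝ X₁ q)‖ ≤ (1 + (A + τ)) * ‖P‖ := by
      rw [ContinuousLinearMap.opNorm_prod]
      refine max_le (p1'.trans ?_) (p3.trans ?_) <;> nlinarith
    calc ‖K‖ ≤ A * ‖P‖ + A * ((1 + (A + τ)) * ‖P‖) := by
          refine (norm_add_le _ _).trans (add_le_add k1 ?_)
          refine (ContinuousLinearMap.opNorm_comp_le _ _).trans ?_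
          gcongr
      _ = _ := by ring
  have p4 : ‖fderiv ℝ ψ q‖ ≤ κ * (2 * (A + A * (1 + (A + τ)))) * ‖P‖ := by
    refine (hκ _).trans ?_
    rw [hAlt, mul_assoc]
    refine mul_le_mul_of_nonneg_left ?_ hκ0
    refine (norm_sub_le _ _).trans ?_
    rw [ContinuousLinearMap.opNorm_flip]
    linarith
  rw [hjet.fderiv, ContinuousLinearMap.opNorm_prod]
  have c1 : 0 ≤ A + τ := by positivity
  have c2 : 0 ≤ κ * (2 * (A + A * (1 + (A + τ)))) := by positivity
  have c3 := mul_nonneg c1 nP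
  have c4 := mul_nonneg c2 nP
  refine max_le (p1'.trans (by linarith)) ?_
  rw [ContinuousLinearMap.opNorm_prod]
  exact max_le (p3.trans (by linarith)) (p4.trans (by linarith))

/-- The jet of a projective vector field satisfies a closed system of linear total differential
equations: the trace part of `D²X` is the only part not given by `X` and `DX`, and the symmetry of
third derivatives determines its derivative. -/
theorem exists_projJet_bound [FiniteDimensional ℝ F] [Nontrivial F]
    {Γ : ℝ × F → (ℝ × F) →L[ℝ] (ℝ × F) →L[ℝ] (ℝ × F)} {z : ℝ × F}
    (hΓ : ∀ᶠ q in 𝓝 z, ContDiffAt ℝ ∞ Γ q) :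
    ∃ r > 0, ∃ C : ℝ, ∀ q ∈ Metric.ball z r, ∀ X : ℝ × F → ℝ × F,
      (∀ᶠ q' in 𝓝 q, ContDiffAt ℝ ∞ X q' ∧ IsProjectiveAt Γ X q') →
      DifferentiableAt ℝ (projJet Γ X) q ∧
        ‖fderiv ℝ (projJet Γ X) q‖ ≤ C * ‖projJet Γ X q‖ := by
  have hΦ : ContDiffAt ℝ ∞ (lowerOrderPart Γ) z := contDiffAt_lowerOrderPart hΓ.self_of_nhds
  set A := ‖lowerOrderPart Γ z‖ + ‖fderiv ℝ (lowerOrderPart Γ) z‖ + 1 with hA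
  have b0 : ∀ᶠ q in 𝓝 z, ‖lowerOrderPart Γ q‖ < A := hΦ.continuousAt.eventually_norm_lt
    (by linarith [norm_nonneg (fderiv ℝ (lowerOrderPart Γ) z)])
  have b1 : ∀ᶠ q in 𝓝 z, ‖fderiv ℝ (lowerOrderPart Γ) q‖ < A :=
    hΦ.fderiv_smooth.continuousAt.eventually_norm_lt
      (by linarith [norm_nonneg (lowerOrderPart Γ z)])
  obtain ⟨r, hr, hball⟩ := Metric.eventually_nhds_iff_ball.1 (hΓ.and (b0.and b1))
  obtain ⟨κ, -, hκ⟩ := (pureTraceAlt (ℝ × F)).exists_antilipschitzWith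
    (LinearMap.ker_eq_bot.2 pureTraceAlt_injective)
  have hκ' : ∀ a, ‖a‖ ≤ κ * ‖pureTraceAlt (ℝ × F) a‖ := fun a => by
    simpa [dist_eq_norm] using hκ.le_mul_dist a 0
  refine ⟨r, hr, 1 + (A + ‖pureTrace (ℝ × F)‖)
    + κ * (2 * (A + A * (1 + (A + ‖pureTrace (ℝ × F)‖)))), fun q hq X hX => ?_⟩
  obtain ⟨hΓq, hΦ0, hΦ1⟩ := hball q hq
  have hXq := hX.self_of_nhds.1
  have hψq : DifferentiableAt ℝ (fun q => pureTraceForm (lieConn Γ X q)) q :=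
    ((contDiffAt_lieConn hΓq hXq).pureTraceForm).differentiableAt (by simp)
  have hXd : DifferentiableAt ℝ X q := hXq.differentiableAt (by simp)
  have hXd1 : DifferentiableAt ℝ (fderiv ℝ X) q := hXq.fderiv_smooth.differentiableAt (by simp)
  refine ⟨hXd.prodMk (hXd1.prodMk hψq), norm_fderiv_prolongation_le (T := pureTrace (ℝ × F)) κ.2
    ((contDiffAt_lowerOrderPart hΓq).differentiableAt (by simp)) hΦ0.le hΦ1.le
    hκ' hXd le_rfl hXd1 hψq ?_
    (hXq.fderiv_smooth.isSymmSndFDerivAt two_le_smooth).eq⟩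
  filter_upwards [hX] with q' h'
  refine ContinuousLinearMap.ext fun v => ContinuousLinearMap.ext fun w => ?_
  rw [add_apply, add_apply, pureTrace_apply, ← h'.2 v w, lieConn_eq_sub Γ X q', sub_apply,
    sub_apply, add_sub_cancel]

/-- A projective vector field on a small ball vanishes as soon as its jet vanishes at one point. -/
theorem exists_eq_zero_of_projJet_eq_zero [FiniteDimensional ℝ F] [Nontrivial F]
    {Γ : ℝ × F → (ℝ × F) →L[ℝ] (ℝ × F) →L[ℝ] (ℝ × F)} {z : ℝ × F}
    (hΓ : ∀ᶠ q in 𝓝 z, ContDiffAt ℝ ∞ Γ q) :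
    ∃ r > 0, ∀ r' ≤ r, ∀ X ∈ projectiveFields Γ (Metric.ball z r'), ∀ q₀ ∈ Metric.ball z r',
      projJet Γ X q₀ = 0 → ∀ q ∈ Metric.ball z r', X q = 0 := by
  obtain ⟨r, hr, C, hC⟩ := exists_projJet_bound hΓ
  refine ⟨r, hr, fun r' hr' X hX q₀ hq₀ h₀ q hq => ?_⟩
  have hev : ∀ q ∈ Metric.ball z r', ∀ᶠ q' in 𝓝 q, ContDiffAt ℝ ∞ X q' ∧ IsProjectiveAt Γ X q' :=
    fun q hq => Filter.eventually_of_mem (Metric.isOpen_ball.mem_nhds hq) hX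
  have := eq_zero_of_norm_fderiv_le (P := projJet Γ X)
    (fun q hq => (hC q (Metric.ball_subset_ball hr' hq) X (hev q hq)).1)
    (fun q hq => (hC q (Metric.ball_subset_ball hr' hq) X (hev q hq)).2) hq₀ h₀ q hq
  exact congrArg Prod.fst this

end ProjectiveJets

/-! ### The projective algebra in a flat chart -/

section HomField

variable {W : Type*} [NormedAddCommGroup W] [NormedSpace ℝ W]

/-- The projective vector field on `W` induced by a linear vector field on `ℝ × W`, in the affine
chart `q ↦ [1 : q]`. -/
def homField (L : (ℝ × W) →L[ℝ] (ℝ × W)) (q : W) : W := (L (1, q)).2 - (L (1, q)).1 • q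

theorem contDiff_homField (L : (ℝ × W) →L[ℝ] (ℝ × W)) : ContDiff ℝ ∞ (homField L) := by
  have h : ContDiff ℝ ∞ fun q : W => L (1, q) := L.contDiff.comp (contDiff_const.prodMk contDiff_id)
  exact h.snd.sub (h.fst.smul contDiff_id)

theorem hasFDerivAt_apply_one (L : (ℝ × W) →L[ℝ] (ℝ × W)) (q : W) :
    HasFDerivAt (fun q : W => L (1, q)) (L ∘L ContinuousLinearMap.inr ℝ ℝ W) q := by
  refine (L.hasFDerivAt.comp q ((hasFDerivAt_const (1 : ℝ) q).prodMk
    (hasFDerivAt_id q))).congr_fderiv ?_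
  ext <;> simp

theorem fderiv_homField (L : (ℝ × W) →L[ℝ] (ℝ × W)) (q h : W) :
    fderiv ℝ (homField L) q h = (L (0, h)).2 - (L (0, h)).1 • q - (L (1, q)).1 • h := by
  have h1 := hasFDerivAt_apply_one L q
  have h2 : HasFDerivAt (homField L) _ q := h1.snd.sub (h1.fst.smul (hasFDerivAt_id q))
  rw [h2.fderiv]
  simp [ContinuousLinearMap.comp_apply]
  abel

theorem fderiv_fderiv_apply {V H : Type*} [NormedAddCommGroup V] [NormedSpace ℝ V]
    [NormedAddCommGroup H] [NormedSpace ℝ H] {Y : V → H} {q : V} (hY : ContDiffAt ℝ ∞ Y q)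
    (h k : V) : fderiv ℝ (fderiv ℝ Y) q h k = fderiv ℝ (fun q' => fderiv ℝ Y q' k) q h := by
  have h1 : HasFDerivAt (fderiv ℝ Y) (fderiv ℝ (fderiv ℝ Y) q) q :=
    (hY.fderiv_smooth.differentiableAt (by simp)).hasFDerivAt
  rw [(h1.clm_apply (hasFDerivAt_const k q)).fderiv]
  simp

theorem fderiv_fderiv_homField (L : (ℝ × W) →L[ℝ] (ℝ × W)) (q h k : W) :
    fderiv ℝ (fderiv ℝ (homField L)) q h k = -((L (0, h)).1 • k + (L (0, k)).1 • h) := by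
  rw [fderiv_fderiv_apply (contDiff_homField L).contDiffAt]
  simp only [fderiv_homField]
  have h1 := hasFDerivAt_apply_one L q
  have h2 := (((hasFDerivAt_id q).const_smul (L (0, k)).1).const_sub (L (0, k)).2).sub
    (h1.fst.smul (hasFDerivAt_const k q))
  have h3 : fderiv ℝ (fun q' => (L (0, k)).2 - (L (0, k)).1 • q' - (L (1, q')).1 • k) q = _ :=
    h2.fderiv
  rw [h3]
  simp [ContinuousLinearMap.comp_apply]
  abel

theorem lieBracket_homField (L M : (ℝ × W) →L[ℝ] (ℝ × W)) (q : W) :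
    VectorField.lieBracket ℝ (homField L) (homField M) q = homField (M ∘L L - L ∘L M) q := by
  rw [VectorField.lieBracket, fderiv_homField, fderiv_homField]
  have key : ∀ N : (ℝ × W) →L[ℝ] (ℝ × W),
      ((0 : ℝ), homField N q) = N (1, q) - (N (1, q)).1 • (1, q) := fun N => by
    ext <;> simp [homField]
  rw [key, key]
  simp only [homField, map_sub, map_smul, Prod.fst_sub, Prod.snd_sub, Prod.smul_fst, Prod.smul_snd,
    smul_eq_mul, sub_apply, ContinuousLinearMap.comp_apply]
  module

/-- A projective field with vanishing second jet at one point comes from a homothety. -/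
theorem exists_eq_smul_of_homField_jet_eq_zero {F : Type*} [NormedAddCommGroup F]
    [NormedSpace ℝ F] {L : (ℝ × ℝ × F) →L[ℝ] (ℝ × ℝ × F)} {q : ℝ × F} (h0 : homField L q = 0)
    (h1 : fderiv ℝ (homField L) q = 0) (h2 : fderiv ℝ (fderiv ℝ (homField L)) q = 0) :
    ∃ c : ℝ, ∀ x, L x = c • x := by
  have k1 : ∀ h, (L (0, h)).1 = 0 := fun h => by
    have e : ∀ h : ℝ × F, (L (0, h)).1 • h = 0 := fun h => by
      have := fderiv_fderiv_homField L q h h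
      rw [h2] at this
      have h3 : (-2 : ℝ) • ((L (0, h)).1 • h) = 0 := by
        refine Eq.trans ?_ this.symm
        module
      simpa using h3
    rcases smul_eq_zero.1 (e h) with h' | h'
    · exact h'
    · rw [h', show ((0 : ℝ), (0 : ℝ × F)) = 0 from rfl]; simp
  have k2 : ∀ h, (L (0, h)).2 = (L (1, q)).1 • h := fun h => by
    have := fderiv_homField L q h
    rw [h1, k1] at this
    rw [zero_smul, sub_zero] at this
    exact sub_eq_zero.1 this.symm
  have k3 : L (1, 0) = L (1, q) - L (0, q) := by
    rw [← map_sub]; simp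
  have k4 : (L (1, q)).2 = (L (1, q)).1 • q := sub_eq_zero.1 h0
  refine ⟨(L (1, q)).1, fun x => ?_⟩
  have hx : x = x.1 • ((1 : ℝ), (0 : ℝ × F)) + (0, x.2) := by ext <;> simp
  conv_lhs => rw [hx]
  rw [map_add, map_smul, k3]
  refine Prod.ext ?_ ?_
  · simp [k1, mul_comm]
  · simp [k2, k4]

end HomField

section Chart

variable {W : Type*} [NormedAddCommGroup W] [NormedSpace ℝ W]

/-- The curvature `R(u, v) w` of the connection with coefficients `Γ`. -/
def curvature (Γ : W → W →L[ℝ] W →L[ℝ] W) (q u v w : W) : W :=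
  fderiv ℝ Γ q u v w - fderiv ℝ Γ q v u w + Γ q u (Γ q v w) - Γ q v (Γ q u w)

/-- `φ` is an affine chart of `Γ` near `q`: in terms of `φ` the connection `Γ` is the standard
flat one. -/
def IsAffineChartNear (Γ : W → W →L[ℝ] W →L[ℝ] W) (φ : W → W) (q : W) : Prop :=
  ∀ᶠ q' in 𝓝 q, ContDiffAt ℝ ∞ φ q' ∧ ContDiffAt ℝ ∞ Γ q' ∧ (∀ v w, Γ q' v w = Γ q' w v) ∧
    (fderiv ℝ φ q').IsInvertible ∧
    ∀ v w, fderiv ℝ (fderiv ℝ φ) q' v w = fderiv ℝ φ q' (Γ q' v w)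

theorem IsAffineChartNear.eventually {Γ : W → W →L[ℝ] W →L[ℝ] W} {φ : W → W} {q : W}
    (h : IsAffineChartNear Γ φ q) : ∀ᶠ q' in 𝓝 q, IsAffineChartNear Γ φ q' := h.eventually_nhds

theorem IsAffineChartNear.curvature_eq_zero {Γ : W → W →L[ℝ] W →L[ℝ] W} {φ : W → W} {q : W}
    (h : IsAffineChartNear Γ φ q) (u v w : W) : curvature Γ q u v w = 0 := by
  obtain ⟨hφ, hΓ, hs, hinv, heq⟩ := h.self_of_nhds
  have hΓd : HasFDerivAt Γ (fderiv ℝ Γ q) q := (hΓ.differentiableAt (by simp)).hasFDerivAt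
  have hφ1 : HasFDerivAt (fderiv ℝ φ) (fderiv ℝ (fderiv ℝ φ) q) q :=
    (hφ.fderiv_smooth.differentiableAt (by simp)).hasFDerivAt
  -- the third derivative of `φ`, computed from `D²φ = Dφ ∘ Γ`
  have h3 : ∀ a b c, fderiv ℝ (fderiv ℝ (fun q' => fderiv ℝ φ q' c)) q a b
      = fderiv ℝ φ q (Γ q a (Γ q b c) + fderiv ℝ Γ q a b c) := fun a b c => by
    have hc : ContDiffAt ℝ ∞ (fun q' => fderiv ℝ φ q' c) q :=
      hφ.fderiv_smooth.clm_apply contDiffAt_const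
    have e1 : (fun q' => fderiv ℝ (fun q' => fderiv ℝ φ q' c) q' b)
        =ᶠ[𝓝 q] fun q' => fderiv ℝ φ q' (Γ q' b c) := by
      filter_upwards [h] with q' h'
      rw [← fderiv_fderiv_apply h'.1, h'.2.2.2.2]
    rw [fderiv_fderiv_apply hc, e1.fderiv_eq, (hφ1.clm_apply
      ((hΓd.clm_apply (hasFDerivAt_const b q)).clm_apply (hasFDerivAt_const c q))).fderiv]
    simp [heq, add_comm]
  have hsym : fderiv ℝ (fderiv ℝ (fun q' => fderiv ℝ φ q' w)) q u v
      = fderiv ℝ (fderiv ℝ (fun q' => fderiv ℝ φ q' w)) q v u :=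
    ((hφ.fderiv_smooth.clm_apply contDiffAt_const).isSymmSndFDerivAt two_le_smooth).eq u v
  rw [h3, h3] at hsym
  have := hinv.injective hsym
  rw [curvature, sub_add_eq_add_sub, sub_sub, sub_eq_zero, add_comm, this, add_comm]

theorem IsAffineChartNear.fderiv_pullback_eq [CompleteSpace W] {Γ : W → W →L[ℝ] W →L[ℝ] W}
    {φ Y : W → W} {q : W} (h : IsAffineChartNear Γ φ q) (hY : ContDiff ℝ ∞ Y)
    (hX : ContDiffAt ℝ ∞ (VectorField.pullback ℝ φ Y) q) (v : W) :
    fderiv ℝ Y (φ q) (fderiv ℝ φ q v)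
      = fderiv ℝ φ q (Γ q v (VectorField.pullback ℝ φ Y q)
        + fderiv ℝ (VectorField.pullback ℝ φ Y) q v) := by
  obtain ⟨hφ, hΓ, hs, hinv, heq⟩ := h.self_of_nhds
  have e : (fun q' => fderiv ℝ φ q' (VectorField.pullback ℝ φ Y q')) =ᶠ[𝓝 q] fun q' => Y (φ q') := by
    filter_upwards [h] with q' h'
    exact VectorField.fderiv_pullback _ _ _ h'.2.2.2.1
  have hφ1 : HasFDerivAt (fderiv ℝ φ) (fderiv ℝ (fderiv ℝ φ) q) q :=
    (hφ.fderiv_smooth.differentiableAt (by simp)).hasFDerivAt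
  have h1 := hφ1.clm_apply (hX.differentiableAt (by simp)).hasFDerivAt
  have h2 := ((hY.differentiable (by simp)) (φ q)).hasFDerivAt.comp q
    (hφ.differentiableAt (by simp)).hasFDerivAt
  have h3 := (h1.congr_of_eventuallyEq e.symm).unique h2
  have h4 := congrArg (fun L : W →L[ℝ] W => L v) h3
  simp only [add_apply, ContinuousLinearMap.comp_apply, ContinuousLinearMap.flip_apply, heq] at h4
  rw [map_add, ← h4, add_comm]

/-- Naturality of the Lie derivative of a connection: in an affine chart it becomes the second
derivative of the vector field. -/
theorem IsAffineChartNear.fderiv_lieConn_pullback [CompleteSpace W] {Γ : W → W →L[ℝ] W →L[ℝ] W}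
    {φ Y : W → W} {q : W} (h : IsAffineChartNear Γ φ q) (hY : ContDiff ℝ ∞ Y)
    (hX : ∀ᶠ q' in 𝓝 q, ContDiffAt ℝ ∞ (VectorField.pullback ℝ φ Y) q') (v w : W) :
    fderiv ℝ φ q (lieConn Γ (VectorField.pullback ℝ φ Y) q v w)
      = fderiv ℝ (fderiv ℝ Y) (φ q) (fderiv ℝ φ q v) (fderiv ℝ φ q w) := by
  obtain ⟨hφ, hΓ, hs, hinv, heq⟩ := h.self_of_nhds
  have hΓd : HasFDerivAt Γ (fderiv ℝ Γ q) q := (hΓ.differentiableAt (by simp)).hasFDerivAt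
  have hφd : HasFDerivAt φ (fderiv ℝ φ q) q := (hφ.differentiableAt (by simp)).hasFDerivAt
  have hφ1 : HasFDerivAt (fderiv ℝ φ) (fderiv ℝ (fderiv ℝ φ) q) q :=
    (hφ.fderiv_smooth.differentiableAt (by simp)).hasFDerivAt
  set X := VectorField.pullback ℝ φ Y with hXdef
  have hX0 := hX.self_of_nhds
  have hXd : HasFDerivAt X (fderiv ℝ X q) q := (hX0.differentiableAt (by simp)).hasFDerivAt
  have hX1 : HasFDerivAt (fderiv ℝ X) (fderiv ℝ (fderiv ℝ X) q) q :=
    (hX0.fderiv_smooth.differentiableAt (by simp)).hasFDerivAt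
  have hY1 : HasFDerivAt (fderiv ℝ Y) (fderiv ℝ (fderiv ℝ Y) (φ q)) (φ q) :=
    (hY.contDiffAt.fderiv_smooth.differentiableAt (by simp)).hasFDerivAt
  have e : (fun q' => fderiv ℝ Y (φ q') (fderiv ℝ φ q' w))
      =ᶠ[𝓝 q] fun q' => fderiv ℝ φ q' (Γ q' w (X q') + fderiv ℝ X q' w) := by
    filter_upwards [h.eventually, hX] with q' h' h''
    exact h'.fderiv_pullback_eq hY h'' w
  have h1 := (hY1.comp q hφd).clm_apply (hφ1.clm_apply (hasFDerivAt_const w q))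
  have h2 := hφ1.clm_apply (((hΓd.clm_apply (hasFDerivAt_const w q)).clm_apply hXd).add
    (hX1.clm_apply (hasFDerivAt_const w q)))
  have h3 := congrArg (fun L : W →L[ℝ] W => L v) (h1.unique (h2.congr_of_eventuallyEq e))
  simp only [add_apply, ContinuousLinearMap.comp_apply, ContinuousLinearMap.flip_apply, heq,
    Function.comp_apply, zero_apply, map_zero, zero_add, map_add, Pi.add_apply,
    h.fderiv_pullback_eq hY hX0] at h3
  have hc := congrArg (fderiv ℝ φ q) (h.curvature_eq_zero v (X q) w)
  rw [curvature] at hc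
  have hsΓ := fderiv_symm_of_eventually hΓd.differentiableAt (h.mono fun _ h' => h'.2.2.1)
  rw [hsΓ v (X q) w, hs (X q) w, hs (X q) (Γ q v w)] at hc
  simp only [map_add, map_sub, map_zero] at hc
  rw [lieConn_apply, hs (fderiv ℝ X q v) w]
  simp only [map_add, map_sub]
  linear_combination (norm := module) (-1 : ℝ) • h3 - hc

end Chart

/-! ### Symmetry algebras of maximal dimension -/

section Algebra

variable {F : Type*} [NormedAddCommGroup F] [NormedSpace ℝ F]

theorem finrank_slAlg (n : ℕ) (hn : 0 < n) : Module.finrank ℝ (slAlg n) = n ^ 2 - 1 := by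
  have h1 := LinearMap.finrank_range_add_finrank_ker (Matrix.traceLinearMap (Fin n) ℝ ℝ)
  have h2 : LinearMap.range (Matrix.traceLinearMap (Fin n) ℝ ℝ) = ⊤ := by
    rw [LinearMap.range_eq_top]
    intro c
    exact ⟨Matrix.single ⟨0, hn⟩ ⟨0, hn⟩ c, by simp⟩
  rw [h2, finrank_top, Module.finrank_self, Module.finrank_matrix, Fintype.card_fin,
    Module.finrank_self] at h1
  change Module.finrank ℝ (LinearMap.ker (Matrix.traceLinearMap (Fin n) ℝ ℝ)) = _
  refine (Nat.sub_eq_of_eq_add ?_).symm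
  rw [sq, add_comm, h1, mul_one]

/-- Matrices acting linearly on `ℝ × W`, through a choice of coordinates. -/
def matAction {V : Type*} [NormedAddCommGroup V] [NormedSpace ℝ V] [FiniteDimensional ℝ V] {n : ℕ}
    (e : (Fin n → ℝ) ≃ₗ[ℝ] V) : Matrix (Fin n) (Fin n) ℝ →ₗ[ℝ] (V →L[ℝ] V) :=
  LinearMap.toContinuousLinearMap.toLinearMap ∘ₗ e.conj.toLinearMap ∘ₗ Matrix.toLin'.toLinearMap

theorem matAction_apply {V : Type*} [NormedAddCommGroup V] [NormedSpace ℝ V]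
    [FiniteDimensional ℝ V] {n : ℕ} (e : (Fin n → ℝ) ≃ₗ[ℝ] V) (A : Matrix (Fin n) (Fin n) ℝ)
    (x : V) : matAction e A x = e (A.mulVec (e.symm x)) := rfl

theorem matAction_mul {V : Type*} [NormedAddCommGroup V] [NormedSpace ℝ V]
    [FiniteDimensional ℝ V] {n : ℕ} (e : (Fin n → ℝ) ≃ₗ[ℝ] V) (A B : Matrix (Fin n) (Fin n) ℝ) :
    matAction e (A * B) = matAction e A ∘L matAction e B := by
  ext x
  simp [matAction_apply]

/-- A traceless matrix acting as a homothety is zero. -/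
theorem eq_zero_of_matAction_eq_smul {V : Type*} [NormedAddCommGroup V] [NormedSpace ℝ V]
    [FiniteDimensional ℝ V] {n : ℕ} (hn : 0 < n) (e : (Fin n → ℝ) ≃ₗ[ℝ] V)
    {A : Matrix (Fin n) (Fin n) ℝ} (hA : A.trace = 0) {c : ℝ} (h : ∀ x, matAction e A x = c • x) :
    A = 0 := by
  have h1 : A = c • (1 : Matrix (Fin n) (Fin n) ℝ) := by
    refine Matrix.toLin'.injective (LinearMap.ext fun y => ?_)
    have := h (e y)
    rw [matAction_apply, e.symm_apply_apply, ← map_smul] at this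
    simpa using e.injective this
  rw [h1, Matrix.trace_smul, Matrix.trace_one, Fintype.card_fin, smul_eq_mul] at hA
  have hc : c = 0 := by
    rcases mul_eq_zero.1 hA with h | h
    · exact h
    · exact absurd (Nat.cast_eq_zero.1 h) hn.ne'
  rw [h1, hc, zero_smul]

/-- The vector field of the projective algebra attached to a matrix, read in the chart `φ`. The sign
turns the action into a homomorphism of Lie algebras. -/
def chartField {W : Type*} [NormedAddCommGroup W] [NormedSpace ℝ W] [FiniteDimensional ℝ W] {n : ℕ}
    (e : (Fin n → ℝ) ≃ₗ[ℝ] (ℝ × W)) (φ : W → W) (A : Matrix (Fin n) (Fin n) ℝ) : W → W :=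
  VectorField.pullback ℝ φ (homField (matAction e (-A)))

theorem chartField_add {W : Type*} [NormedAddCommGroup W] [NormedSpace ℝ W]
    [FiniteDimensional ℝ W] {n : ℕ} (e : (Fin n → ℝ) ≃ₗ[ℝ] (ℝ × W)) (φ : W → W)
    (A B : Matrix (Fin n) (Fin n) ℝ) :
    chartField e φ (A + B) = chartField e φ A + chartField e φ B := by
  ext1 q
  simp only [chartField, VectorField.pullback, Pi.add_apply, ← map_add]
  congr 1
  simp only [homField, neg_add, map_add, add_apply, Prod.fst_add, Prod.snd_add]
  module

theorem chartField_smul {W : Type*} [NormedAddCommGroup W] [NormedSpace ℝ W]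
    [FiniteDimensional ℝ W] {n : ℕ} (e : (Fin n → ℝ) ≃ₗ[ℝ] (ℝ × W)) (φ : W → W) (c : ℝ)
    (A : Matrix (Fin n) (Fin n) ℝ) : chartField e φ (c • A) = c • chartField e φ A := by
  ext1 q
  simp only [chartField, VectorField.pullback, Pi.smul_apply, ← map_smul]
  congr 1
  simp only [homField, ← smul_neg, map_smul, smul_apply, Prod.smul_fst, Prod.smul_snd,
    smul_eq_mul]
  module

theorem contDiffAt_pullback {W : Type*} [NormedAddCommGroup W] [NormedSpace ℝ W] [CompleteSpace W]
    {φ Y : W → W} {q : W} (hφ : ContDiffAt ℝ ∞ φ q) (hinv : (fderiv ℝ φ q).IsInvertible)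
    (hY : ContDiff ℝ ∞ Y) : ContDiffAt ℝ ∞ (VectorField.pullback ℝ φ Y) q :=
  (hinv.contDiffAt_map_inverse.comp q hφ.fderiv_smooth).clm_apply (hY.contDiffAt.comp q hφ)

theorem IsAffineChartNear.contDiffAt_chartField {W : Type*} [NormedAddCommGroup W]
    [NormedSpace ℝ W] [FiniteDimensional ℝ W] [CompleteSpace W] {Γ : W → W →L[ℝ] W →L[ℝ] W}
    {φ : W → W} {z : W} (h : IsAffineChartNear Γ φ z) {n : ℕ}
    (e : (Fin n → ℝ) ≃ₗ[ℝ] (ℝ × W)) (A : Matrix (Fin n) (Fin n) ℝ) :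
    ContDiffAt ℝ ∞ (chartField e φ A) z :=
  contDiffAt_pullback h.self_of_nhds.1 h.self_of_nhds.2.2.2.1 (contDiff_homField _)

theorem IsAffineChartNear.lieBracket_chartField {W : Type*} [NormedAddCommGroup W]
    [NormedSpace ℝ W] [FiniteDimensional ℝ W] [CompleteSpace W] {Γ : W → W →L[ℝ] W →L[ℝ] W}
    {φ : W → W} {z : W} (h : IsAffineChartNear Γ φ z) {n : ℕ}
    (e : (Fin n → ℝ) ≃ₗ[ℝ] (ℝ × W)) (A B : Matrix (Fin n) (Fin n) ℝ) :
    VectorField.lieBracket ℝ (chartField e φ A) (chartField e φ B) z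
      = chartField e φ (A * B - B * A) z := by
  rw [chartField, chartField, ← VectorField.pullback_lieBracket two_le_smooth h.self_of_nhds.1
    ((contDiff_homField _).differentiable (by simp) _)
    ((contDiff_homField _).differentiable (by simp) _), chartField, VectorField.pullback,
    VectorField.pullback, lieBracket_homField, ← matAction_mul, ← matAction_mul, ← map_sub]
  congr 4
  noncomm_ring

/-- The Lie algebra homomorphism from `sl(n, ℝ)` to germs of vector fields given by an affine
chart. -/
def IsAffineChartNear.slHom {W : Type*} [NormedAddCommGroup W] [NormedSpace ℝ W]
    [FiniteDimensional ℝ W] [CompleteSpace W] {Γ : W → W →L[ℝ] W →L[ℝ] W} {φ : W → W} {z : W}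
    (h : IsAffineChartNear Γ φ z) {n : ℕ} (e : (Fin n → ℝ) ≃ₗ[ℝ] (ℝ × W)) :
    slAlg n →ₗ⁅ℝ⁆ FieldGerm z where
  toFun A := ⟨(chartField e φ A.1 : W → W), chartField e φ A.1,
    h.eventually.mono fun _ h' => h'.contDiffAt_chartField e A.1, rfl⟩
  map_add' A B := Subtype.ext (congrArg (fun X : W → W => (X : Filter.Germ (𝓝 z) W))
    (chartField_add e φ A.1 B.1))
  map_smul' c A := Subtype.ext (congrArg (fun X : W → W => (X : Filter.Germ (𝓝 z) W))
    (chartField_smul e φ c A.1))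
  map_lie' {A B} := by
    apply Subtype.ext
    rw [FieldGerm.val_bracket, germBracket_coe]
    refine Filter.Germ.coe_eq.2 ?_
    filter_upwards [h.eventually] with q h'
    rw [h'.lieBracket_chartField]
    rfl

theorem IsAffineChartNear.isProjectiveAt_chartField [FiniteDimensional ℝ F]
    {Γ : ℝ × F → (ℝ × F) →L[ℝ] (ℝ × F) →L[ℝ] (ℝ × F)} {φ : ℝ × F → ℝ × F} {z : ℝ × F}
    (h : IsAffineChartNear Γ φ z) {n : ℕ} (e : (Fin n → ℝ) ≃ₗ[ℝ] (ℝ × ℝ × F))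
    (A : Matrix (Fin n) (Fin n) ℝ) : IsProjectiveAt Γ (chartField e φ A) z := by
  have : CompleteSpace (ℝ × F) := FiniteDimensional.complete ℝ _
  set L := matAction e (-A) with hL
  have hlie := h.fderiv_lieConn_pullback (Y := homField L) (contDiff_homField L)
    (h.eventually.mono fun _ h' => h'.contDiffAt_chartField e A)
  have hinv := h.self_of_nhds.2.2.2.1
  set ψ : (ℝ × F) →L[ℝ] ℝ := -(ContinuousLinearMap.fst ℝ ℝ (ℝ × F) ∘L L
    ∘L ContinuousLinearMap.inr ℝ ℝ (ℝ × F) ∘L fderiv ℝ φ z) with hψ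
  have key : ∀ v w, lieConn Γ (chartField e φ A) z v w = ψ v • w + ψ w • v := fun v w => by
    refine hinv.injective ((hlie v w).trans ?_)
    rw [fderiv_fderiv_homField]
    simp [hψ, ContinuousLinearMap.comp_apply]
    abel
  intro v w
  rw [pureTraceForm_eq key, key]

/-- In an affine chart a projective field of `sl(n, ℝ)` is determined by its jet. -/
theorem IsAffineChartNear.eq_zero_of_projJet_chartField [FiniteDimensional ℝ F]
    {Γ : ℝ × F → (ℝ × F) →L[ℝ] (ℝ × F) →L[ℝ] (ℝ × F)} {φ : ℝ × F → ℝ × F} {z : ℝ × F}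
    (h : IsAffineChartNear Γ φ z) {n : ℕ} (hn : 0 < n) (e : (Fin n → ℝ) ≃ₗ[ℝ] (ℝ × ℝ × F))
    {A : Matrix (Fin n) (Fin n) ℝ} (hA : A.trace = 0)
    (h0 : projJet Γ (chartField e φ A) z = 0) : A = 0 := by
  have : CompleteSpace (ℝ × F) := FiniteDimensional.complete ℝ _
  set L := matAction e (-A) with hL
  have hinv := h.self_of_nhds.2.2.2.1
  have hX0 : VectorField.pullback ℝ φ (homField L) z = 0 := congrArg Prod.fst h0
  have hX1 : fderiv ℝ (VectorField.pullback ℝ φ (homField L)) z = 0 :=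
    congrArg (fun j : ProjJet F => j.2.1) h0
  have hX2 : pureTraceForm (lieConn Γ (chartField e φ A) z) = 0 :=
    congrArg (fun j : ProjJet F => j.2.2) h0
  have hY0 : homField L (φ z) = 0 := by
    rw [← VectorField.fderiv_pullback φ (homField L) z hinv, hX0, map_zero]
  have hY1 : fderiv ℝ (homField L) (φ z) = 0 := by
    refine ContinuousLinearMap.ext fun y => ?_
    obtain ⟨v, rfl⟩ := hinv.surjective y
    rw [h.fderiv_pullback_eq (contDiff_homField L) (h.contDiffAt_chartField e A), hX0, hX1]
    simp
  have hY2 : fderiv ℝ (fderiv ℝ (homField L)) (φ z) = 0 := by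
    refine ContinuousLinearMap.ext fun y => ContinuousLinearMap.ext fun y' => ?_
    obtain ⟨v, rfl⟩ := hinv.surjective y
    obtain ⟨w, rfl⟩ := hinv.surjective y'
    rw [← h.fderiv_lieConn_pullback (contDiff_homField L)
      (h.eventually.mono fun _ h' => h'.contDiffAt_chartField e A)]
    have := h.isProjectiveAt_chartField e A v w
    rw [hX2] at this
    rw [chartField] at this
    rw [this]
    simp
  obtain ⟨c, hc⟩ := exists_eq_smul_of_homField_jet_eq_zero hY0 hY1 hY2
  exact neg_eq_zero.1 (eq_zero_of_matAction_eq_smul hn e (by rw [Matrix.trace_neg, hA, neg_zero]) hc)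

/-- If the connection `Γ` has an affine chart near `z`, the symmetry algebra of its unparametrized
geodesics is `sl(n + 1, ℝ)`: it contains the projective algebra of the chart, which already realizes
every jet. -/
theorem IsAffineChartNear.hasSymmetryAlgebra [FiniteDimensional ℝ F] [CompleteSpace F]
    [Nontrivial F] {Γ : ℝ × F → (ℝ × F) →L[ℝ] (ℝ × F) →L[ℝ] (ℝ × F)} {φ : ℝ × F → ℝ × F}
    {z : ℝ × F} (h : IsAffineChartNear Γ φ z) :
    HasSymmetryAlgebra (projRHS Γ) z (slAlg (Module.finrank ℝ F + 2)) := by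
  set n := Module.finrank ℝ F + 2 with hn
  have hΓ : ∀ᶠ q in 𝓝 z, ContDiffAt ℝ ∞ Γ q := h.mono fun _ h' => h'.2.1
  have hs : ∀ᶠ q in 𝓝 z, ∀ v w, Γ q v w = Γ q w v := h.mono fun _ h' => h'.2.2.1
  have e : (Fin n → ℝ) ≃ₗ[ℝ] (ℝ × ℝ × F) := LinearEquiv.ofFinrankEq _ _ (by
    rw [Module.finrank_fin_fun, Module.finrank_prod, Module.finrank_prod, Module.finrank_self, hn]
    ring)
  have hproj : ∀ A : slAlg n, ∀ᶠ q in 𝓝 z,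
      ContDiffAt ℝ ∞ (chartField e φ A.1) q ∧ IsProjectiveAt Γ (chartField e φ A.1) q := fun A =>
    h.eventually.mono fun _ h' =>
      ⟨h'.contDiffAt_chartField e A.1, h'.isProjectiveAt_chartField e A.1⟩
  obtain ⟨r₀, hr₀, hball⟩ := Metric.eventually_nhds_iff_ball.1 h.eventually
  obtain ⟨r₁, hr₁, huniq⟩ := exists_eq_zero_of_projJet_eq_zero hΓ
  -- every jet at `z` is that of a field of the projective algebra
  have hsurj : ∀ j : ProjJet F, ∃ A : slAlg n, projJet Γ (chartField e φ A.1) z = j := by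
    let B := Metric.ball z r₀
    have hzB : z ∈ B := Metric.mem_ball_self hr₀
    let Λ : slAlg n →ₗ[ℝ] projectiveFields Γ B :=
      { toFun := fun A => ⟨chartField e φ A.1, fun q hq =>
          ⟨(hball q hq).contDiffAt_chartField e A.1, (hball q hq).isProjectiveAt_chartField e A.1⟩⟩
        map_add' := fun A A' => Subtype.ext (chartField_add e φ A.1 A'.1)
        map_smul' := fun c A => Subtype.ext (chartField_smul e φ c A.1) }
    have hinj : Function.Injective (projJetₗ Γ hzB ∘ₗ Λ) := by
      rw [← LinearMap.ker_eq_bot, LinearMap.ker_eq_bot']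
      intro A hA
      exact Subtype.ext (h.eq_zero_of_projJet_chartField (by omega) e A.2 hA)
    have hdim : Module.finrank ℝ (slAlg n) = Module.finrank ℝ (ProjJet F) := by
      rw [finrank_slAlg n (by omega), finrank_projJet]
    exact (LinearMap.injective_iff_surjective_of_finrank_eq_finrank hdim).1 hinj
  have hinjG : Function.Injective (h.slHom e) := by
    rw [← LieHom.ker_eq_bot, LieHom.ker, ← LieSubmodule.toSubmodule_inj]
    refine (LinearMap.ker_eq_bot'.2 fun A hA => ?_)
    have h1 : chartField e φ A.1 =ᶠ[𝓝 z] 0 := Filter.Germ.coe_eq.1 (congrArg Subtype.val hA)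
    refine Subtype.ext (h.eq_zero_of_projJet_chartField (by omega) e A.2 ?_)
    have h2 : fderiv ℝ (chartField e φ A.1) =ᶠ[𝓝 z] 0 := by
      have := h1.fderiv (𝕜 := ℝ)
      simpa using this
    have h3 : lieConn Γ (chartField e φ A.1) z = 0 := by
      have h4 : fderiv ℝ (fderiv ℝ (chartField e φ A.1)) z = 0 := by
        rw [h2.fderiv_eq]; simp
      refine ContinuousLinearMap.ext fun v => ContinuousLinearMap.ext fun w => ?_
      rw [lieConn_apply, h4, h2.self_of_nhds, h1.self_of_nhds]
      simp
    rw [projJet, h3, h2.self_of_nhds, h1.self_of_nhds]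
    have : pureTraceForm (0 : (ℝ × F) →L[ℝ] (ℝ × F) →L[ℝ] (ℝ × F)) = 0 :=
      pureTraceForm_eq (by simp)
    rw [this]
    rfl
  refine ⟨(h.slHom e).range, fun ϕ => ⟨?_, ?_⟩, ⟨(LieEquiv.ofInjective _ hinjG).symm⟩⟩
  · rintro ⟨A, rfl⟩
    exact ⟨chartField e φ A.1, rfl, (isPointSymmetryNear_projRHS_iff hΓ hs
      ((hproj A).mono fun _ h' => h'.1)).2 ((hproj A).mono fun _ h' => h'.2)⟩
  · rintro ⟨X, hXϕ, hX⟩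
    obtain ⟨X', hX', hX'ϕ⟩ := ϕ.exists_rep
    have hXX' : X =ᶠ[𝓝 z] X' := Filter.Germ.coe_eq.1 (hXϕ.trans hX'ϕ.symm)
    have hXs : ∀ᶠ q in 𝓝 z, ContDiffAt ℝ ∞ X q := by
      filter_upwards [hX', hXX'.eventually_nhds] with q h1 h2
      exact h1.congr_of_eventuallyEq h2
    have hXp := (isPointSymmetryNear_projRHS_iff hΓ hs hXs).1 hX
    obtain ⟨A, hA⟩ := hsurj (projJet Γ X z)
    obtain ⟨r₂, hr₂, hball₂⟩ := Metric.eventually_nhds_iff_ball.1 ((hXs.and hXp).and (hproj A))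
    set r := min r₁ r₂ with hr
    have hr0 : 0 < r := lt_min hr₁ hr₂
    have hzB : z ∈ Metric.ball z r := Metric.mem_ball_self hr0
    have hsub : Metric.ball z r ⊆ Metric.ball z r₂ := Metric.ball_subset_ball (min_le_right _ _)
    have m1 : X ∈ projectiveFields Γ (Metric.ball z r) := fun q hq => (hball₂ q (hsub hq)).1
    have m2 : chartField e φ A.1 ∈ projectiveFields Γ (Metric.ball z r) :=
      fun q hq => (hball₂ q (hsub hq)).2
    have hj : projJet Γ (chartField e φ A.1 - X) z = 0 := by
      have := map_sub (projJetₗ Γ hzB) ⟨_, m2⟩ ⟨_, m1⟩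
      exact this.trans (sub_eq_zero.2 hA)
    have hz := huniq r (min_le_left _ _) _ (Submodule.sub_mem _ m2 m1) z hzB hj
    refine ⟨A, Subtype.ext ((Filter.Germ.coe_eq.2 ?_).trans hXϕ)⟩
    filter_upwards [Metric.isOpen_ball.mem_nhds hzB] with q hq
    exact sub_eq_zero.1 (hz q hq)

/-- If the symmetry algebra of the unparametrized geodesics of `Γ` near `z` is isomorphic to
`sl(n + 1, ℝ)`, then for dimension reasons every jet at every point near `z` is the jet of a
projective field. -/
theorem eventually_exists_projective [FiniteDimensional ℝ F] [CompleteSpace F]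
    [Nontrivial F] {Γ : ℝ × F → (ℝ × F) →L[ℝ] (ℝ × F) →L[ℝ] (ℝ × F)} {z : ℝ × F}
    (hΓ : ∀ᶠ q in 𝓝 z, ContDiffAt ℝ ∞ Γ q) (hs : ∀ᶠ q in 𝓝 z, ∀ v w, Γ q v w = Γ q w v)
    (h : HasSymmetryAlgebra (projRHS Γ) z (slAlg (Module.finrank ℝ F + 2))) :
    ∀ᶠ q in 𝓝 z, ∀ j : ProjJet F, ∃ X : ℝ × F → ℝ × F,
      (∀ᶠ q' in 𝓝 q, ContDiffAt ℝ ∞ X q' ∧ IsProjectiveAt Γ X q') ∧ projJet Γ X q = j := by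
  obtain ⟨S, hS, ⟨ε⟩⟩ := h
  set n := Module.finrank ℝ F + 2 with hn
  set d := Module.finrank ℝ (slAlg n) with hd
  let b := Module.finBasis ℝ (slAlg n)
  have hrep : ∀ i : Fin d, ∃ X : ℝ × F → ℝ × F,
      (X : Filter.Germ (𝓝 z) (ℝ × F)) = (ε.symm (b i)).1.1 ∧
      ∀ᶠ q in 𝓝 z, ContDiffAt ℝ ∞ X q ∧ IsProjectiveAt Γ X q := fun i => by
    obtain ⟨X, hXϕ, hX⟩ := (hS _).1 (ε.symm (b i)).2
    obtain ⟨X', hX', hX'ϕ⟩ := (ε.symm (b i)).1.exists_rep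
    have hXX' : X =ᶠ[𝓝 z] X' := Filter.Germ.coe_eq.1 (hXϕ.trans hX'ϕ.symm)
    have hXs : ∀ᶠ q in 𝓝 z, ContDiffAt ℝ ∞ X q := by
      filter_upwards [hX', hXX'.eventually_nhds] with q h1 h2
      exact h1.congr_of_eventuallyEq h2
    exact ⟨X, hXϕ, hXs.and ((isPointSymmetryNear_projRHS_iff hΓ hs hXs).1 hX)⟩
  choose X hXε hX using hrep
  obtain ⟨r₁, hr₁, huniq⟩ := exists_eq_zero_of_projJet_eq_zero hΓ
  obtain ⟨r₂, hr₂, hball⟩ := Metric.eventually_nhds_iff_ball.1 (Filter.eventually_all.2 hX)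
  set r := min r₁ r₂ with hr
  have hr0 : 0 < r := lt_min hr₁ hr₂
  have hsub : Metric.ball z r ⊆ Metric.ball z r₂ := Metric.ball_subset_ball (min_le_right _ _)
  let Xb : Fin d → projectiveFields Γ (Metric.ball z r) :=
    fun i => ⟨X i, fun q hq => hball q (hsub hq) i⟩
  have hsum : ∀ c : Fin d → ℝ, ((∑ i, c i • Xb i : projectiveFields Γ (Metric.ball z r)) :
      ℝ × F → ℝ × F) = ∑ i, c i • X i := fun c => by
    simp [Xb]
  filter_upwards [Metric.ball_mem_nhds z hr0] with q hq
  have hinj : Function.Injective (projJetₗ Γ hq ∘ₗ Fintype.linearCombination ℝ Xb) := by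
    rw [← LinearMap.ker_eq_bot, LinearMap.ker_eq_bot']
    intro c hc
    have h0 : ∀ q ∈ Metric.ball z r, (∑ i, c i • X i) q = 0 := by
      intro q' hq'
      have := huniq r (min_le_left _ _) _ (∑ i, c i • Xb i : projectiveFields Γ _).2 q hq
        (by rw [← hc]; rfl) q' hq'
      rwa [hsum] at this
    have h1 : ∑ i, c i • ε.symm (b i) = 0 := by
      apply Subtype.ext
      apply Subtype.ext
      have e1 : ((∑ i, c i • ε.symm (b i) : S) : FieldGerm z).1
          = ∑ i, c i • (X i : Filter.Germ (𝓝 z) (ℝ × F)) := by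
        simp only [hXε]
        simp
      have e2 : (∑ i, c i • (X i : Filter.Germ (𝓝 z) (ℝ × F)))
          = ((∑ i, c i • X i : ℝ × F → ℝ × F) : Filter.Germ (𝓝 z) (ℝ × F)) :=
        (map_sum (Filter.Germ.coeAddHom (𝓝 z)) (fun i => c i • X i) Finset.univ).symm
      rw [e1, e2]
      refine Filter.Germ.coe_eq.2 ?_
      filter_upwards [Metric.ball_mem_nhds z hr0] with q' hq' using h0 q' hq'
    have h2 : ∑ i, c i • b i = 0 := by
      have := congrArg ε h1
      have e3 : ε (∑ i, c i • ε.symm (b i)) = ∑ i, c i • b i := by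
        have := map_sum ε.toLinearEquiv (fun i => c i • ε.symm (b i)) Finset.univ
        refine this.trans (Finset.sum_congr rfl fun i _ => ?_)
        exact (map_smul ε.toLinearEquiv _ _).trans (congrArg _ (ε.apply_symm_apply _))
      rw [e3] at this
      exact this.trans (map_zero ε.toLinearEquiv)
    ext i
    exact Fintype.linearIndependent_iff.1 b.linearIndependent c h2 i
  have hdim : Module.finrank ℝ (Fin d → ℝ) = Module.finrank ℝ (ProjJet F) := by
    rw [Module.finrank_fin_fun, hd, finrank_slAlg n (by omega), finrank_projJet]
  intro j
  obtain ⟨c, hc⟩ := (LinearMap.injective_iff_surjective_of_finrank_eq_finrank hdim).1 hinj j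
  exact ⟨_, Filter.eventually_of_mem (Metric.isOpen_ball.mem_nhds hq)
    (∑ i, c i • Xb i : projectiveFields Γ _).2, hc⟩

end Algebra

/-! ### Affine charts of flat connections -/

section FlatChart

variable {W : Type*} [NormedAddCommGroup W] [NormedSpace ℝ W]

theorem contDiffAt_const_add_comp {G H : Type*} [NormedAddCommGroup G] [NormedSpace ℝ G]
    [NormedAddCommGroup H] [NormedSpace ℝ H] {Γ : W → W →L[ℝ] G} {q : W} (C₀ : W →L[ℝ] H)
    (C₁ : G →L[ℝ] H) (hΓ : ContDiffAt ℝ ∞ Γ q) :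
    ContDiffAt ℝ ∞ (fun q => C₀ + C₁ ∘L Γ q) q :=
  contDiffAt_const.add (contDiffAt_const.clm_comp hΓ)

theorem fderiv_const_add_comp {G H : Type*} [NormedAddCommGroup G] [NormedSpace ℝ G]
    [NormedAddCommGroup H] [NormedSpace ℝ H] {Γ : W → W →L[ℝ] G} {q : W} (C₀ : W →L[ℝ] H)
    (C₁ : G →L[ℝ] H) (hΓ : DifferentiableAt ℝ Γ q) (k h : W) :
    fderiv ℝ (fun q => C₀ + C₁ ∘L Γ q) q k h = C₁ (fderiv ℝ Γ q k h) := by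
  have h1 := ((hasFDerivAt_const C₁ q).clm_comp hΓ.hasFDerivAt).const_add C₀
  rw [h1.fderiv]
  simp

/-- The map `S ↦ ((u, θ) ↦ (0, θ ∘ S))`. -/
def affineSystemMap (W : Type*) [NormedAddCommGroup W] [NormedSpace ℝ W] :
    (W →L[ℝ] W) →L[ℝ] (W × (W →L[ℝ] W)) →L[ℝ] (W × (W →L[ℝ] W)) :=
  ContinuousLinearMap.postcomp _ (ContinuousLinearMap.inr ℝ W (W →L[ℝ] W)) ∘L
    ContinuousLinearMap.precomp _ (ContinuousLinearMap.snd ℝ W (W →L[ℝ] W)) ∘L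
    (ContinuousLinearMap.compL ℝ W W W).flip

/-- The map `h ↦ ((u, θ) ↦ (θ h, 0))`. -/
def affineSystemConst (W : Type*) [NormedAddCommGroup W] [NormedSpace ℝ W] :
    W →L[ℝ] (W × (W →L[ℝ] W)) →L[ℝ] (W × (W →L[ℝ] W)) :=
  ContinuousLinearMap.postcomp _ (ContinuousLinearMap.inl ℝ W (W →L[ℝ] W)) ∘L
    ContinuousLinearMap.precomp _ (ContinuousLinearMap.snd ℝ W (W →L[ℝ] W)) ∘L
    ContinuousLinearMap.apply ℝ W

/-- The coefficients of the total differential equation `du (h) = θ h`, `dθ (h) = θ ∘ Γ h` for an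
affine map `u` with derivative `θ`. -/
def affineSystem (Γ : W → W →L[ℝ] W →L[ℝ] W) (q : W) :
    W →L[ℝ] (W × (W →L[ℝ] W)) →L[ℝ] (W × (W →L[ℝ] W)) :=
  affineSystemConst W + affineSystemMap W ∘L Γ q

theorem affineSystemMap_apply (S : W →L[ℝ] W) (g : W × (W →L[ℝ] W)) :
    affineSystemMap W S g = (0, g.2 ∘L S) := by
  simp [affineSystemMap]

theorem affineSystem_apply (Γ : W → W →L[ℝ] W →L[ℝ] W) (q h : W) (g : W × (W →L[ℝ] W)) :
    affineSystem Γ q h g = (g.2 h, g.2 ∘L Γ q h) := by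
  simp [affineSystem, affineSystemConst, affineSystemMap_apply]

theorem fderiv_affineSystem {Γ : W → W →L[ℝ] W →L[ℝ] W} {q : W}
    (hΓ : DifferentiableAt ℝ Γ q) (k h : W) (g : W × (W →L[ℝ] W)) :
    fderiv ℝ (affineSystem Γ) q k h g = (0, g.2 ∘L fderiv ℝ Γ q k h) := by
  rw [← affineSystemMap_apply]
  exact congrArg (fun T => T g) (fderiv_const_add_comp (affineSystemConst W) (affineSystemMap W)
    hΓ k h)

/-- A flat torsion-free connection has affine maps with prescribed derivative at a point. -/
theorem exists_affine_map [CompleteSpace W] {Γ : W → W →L[ℝ] W →L[ℝ] W} {z : W}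
    (hΓ : ∀ᶠ q in 𝓝 z, ContDiffAt ℝ ∞ Γ q) (hs : ∀ᶠ q in 𝓝 z, ∀ v w, Γ q v w = Γ q w v)
    (hR : ∀ᶠ q in 𝓝 z, ∀ u v w, curvature Γ q u v w = 0) (T : W →L[ℝ] W) :
    ∃ φ : W → W, fderiv ℝ φ z = T ∧ ∀ᶠ q in 𝓝 z, ContDiffAt ℝ ∞ φ q ∧
      ∀ v w, fderiv ℝ (fderiv ℝ φ) q v w = fderiv ℝ φ q (Γ q v w) := by
  obtain ⟨u, hu0, hu⟩ := exists_total_solution (A := affineSystem Γ) (z := z)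
    (hΓ.mono fun _ h => contDiffAt_const_add_comp (affineSystemConst W)
      (affineSystemMap W) h) (by
      filter_upwards [hΓ, hs, hR] with q h1 h2 h3 h k
      refine ContinuousLinearMap.ext fun g => ?_
      have hd := h1.differentiableAt (by simp)
      simp only [add_apply, ContinuousLinearMap.comp_apply, fderiv_affineSystem hd,
        affineSystem_apply, Prod.mk_add_mk]
      refine Prod.ext (by simp [h2 k h]) ?_
      refine ContinuousLinearMap.ext fun w => ?_
      have := h3 k h w
      simp only [curvature] at this
      have h4 := congrArg g.2 this
      simp only [map_add, map_sub, map_zero] at h4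
      simp only [add_apply, ContinuousLinearMap.comp_apply]
      linear_combination (norm := module) h4) (0, T)
  have hφ : ∀ᶠ q in 𝓝 z, ContDiffAt ℝ ∞ (fun q => (u q).1) q ∧
      fderiv ℝ (fun q => (u q).1) q = (u q).2 := by
    filter_upwards [hu] with q hq
    refine ⟨hq.1.fst, ?_⟩
    have h1 : HasFDerivAt (fun q => (u q).1) _ q := hq.2.fst
    rw [h1.fderiv]
    refine ContinuousLinearMap.ext fun h => ?_
    simp [affineSystem_apply]
  refine ⟨fun q => (u q).1, by rw [hφ.self_of_nhds.2, hu0], ?_⟩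
  filter_upwards [hφ, hφ.eventually_nhds, hu] with q h1 h2 h3
  refine ⟨h1.1, fun v w => ?_⟩
  have h4 : fderiv ℝ (fun q => (u q).1) =ᶠ[𝓝 q] fun q => (u q).2 := h2.mono fun _ h => h.2
  have h5 : HasFDerivAt (fun q => (u q).2) _ q := h3.2.snd
  rw [h4.fderiv_eq, h5.fderiv, h1.2]
  simp [affineSystem_apply]

theorem exists_affine_chart [CompleteSpace W] {Γ : W → W →L[ℝ] W →L[ℝ] W} {z : W}
    (hΓ : ∀ᶠ q in 𝓝 z, ContDiffAt ℝ ∞ Γ q) (hs : ∀ᶠ q in 𝓝 z, ∀ v w, Γ q v w = Γ q w v)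
    (hR : ∀ᶠ q in 𝓝 z, ∀ u v w, curvature Γ q u v w = 0) {T : W →L[ℝ] W} (hT : T.IsInvertible) :
    ∃ φ : W → W, fderiv ℝ φ z = T ∧ IsAffineChartNear Γ φ z := by
  obtain ⟨φ, hφT, hφ⟩ := exists_affine_map hΓ hs hR T
  refine ⟨φ, hφT, ?_⟩
  have hc : ContinuousAt (fderiv ℝ φ) z := hφ.self_of_nhds.1.fderiv_smooth.continuousAt
  obtain ⟨e, rfl⟩ := hT
  have hinv : ∀ᶠ q in 𝓝 z, (fderiv ℝ φ q).IsInvertible := by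
    have h1 := hc.eventually_mem (hφT ▸ e.nhds)
    filter_upwards [h1] with q ⟨e', he'⟩
    exact ⟨e', he'⟩
  filter_upwards [hΓ, hs, hφ, hinv] with q h1 h2 h3 h4
  exact ⟨h3.1, h1, h2, h4, h3.2⟩

end FlatChart

/-! ### Curvature of connections with projective homotheties -/

section Homothety

variable {W : Type*} [NormedAddCommGroup W] [NormedSpace ℝ W]

theorem fderiv_lieConn_of_homothety {Γ : W → W →L[ℝ] W →L[ℝ] W} {X : W → W} {q : W}
    (hΓ : ContDiffAt ℝ ∞ Γ q) (hX : ContDiffAt ℝ ∞ X q) (hX0 : X q = 0)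
    (hX1 : fderiv ℝ X q = ContinuousLinearMap.id ℝ W) (u v w : W) :
    fderiv ℝ (fun q' => lieConn Γ X q' v w) q u = fderiv ℝ (fderiv ℝ (fderiv ℝ X)) q u v w
      + (2 : ℝ) • fderiv ℝ Γ q u v w + Γ q (fderiv ℝ (fderiv ℝ X) q u v) w
      + Γ q v (fderiv ℝ (fderiv ℝ X) q u w) - fderiv ℝ (fderiv ℝ X) q u (Γ q v w) := by
  have dX : HasFDerivAt X _ q := (hX.differentiableAt (by simp)).hasFDerivAt
  have dX1 : HasFDerivAt (fderiv ℝ X) _ q := (hX.fderiv_smooth.differentiableAt (by simp)).hasFDerivAt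
  have dX2 : HasFDerivAt (fderiv ℝ (fderiv ℝ X)) _ q :=
    (hX.fderiv_smooth.fderiv_smooth.differentiableAt (by simp)).hasFDerivAt
  have dΓ : HasFDerivAt Γ _ q := (hΓ.differentiableAt (by simp)).hasFDerivAt
  have dΓ1 : HasFDerivAt (fderiv ℝ Γ) _ q :=
    (hΓ.fderiv_smooth.differentiableAt (by simp)).hasFDerivAt
  have cv := hasFDerivAt_const (𝕜 := ℝ) (F := W) v q
  have cw := hasFDerivAt_const (𝕜 := ℝ) (F := W) w q
  have h : HasFDerivAt (fun q' => lieConn Γ X q' v w) _ q :=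
    (((((dX2.clm_apply cv).clm_apply cw).add (((dΓ1.clm_apply dX).clm_apply cv).clm_apply cw)).add
      ((dΓ.clm_apply (dX1.clm_apply cv)).clm_apply cw)).add
      ((dΓ.clm_apply cv).clm_apply (dX1.clm_apply cw))).sub
      (dX1.clm_apply ((dΓ.clm_apply cv).clm_apply cw))
  rw [h.fderiv]
  simp [hX0, hX1]
  module

/-- Since the third derivative of `X` is symmetric, differentiating the projective equation of a
field `X` with the first jet of a homothety expresses the curvature at its zero. -/
theorem two_smul_curvature_eq {Γ : W → W →L[ℝ] W →L[ℝ] W} {X : W → W} {ψ : W → W →L[ℝ] ℝ} {q : W}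
    (hΓ : ContDiffAt ℝ ∞ Γ q) (hs : ∀ v w, Γ q v w = Γ q w v)
    (hX : ContDiffAt ℝ ∞ X q) (hψ : DifferentiableAt ℝ ψ q)
    (hX0 : X q = 0) (hX1 : fderiv ℝ X q = ContinuousLinearMap.id ℝ W) (hψ0 : ψ q = 0)
    (h : ∀ᶠ q' in 𝓝 q, ∀ v w, lieConn Γ X q' v w = ψ q' v • w + ψ q' w • v) (u v w : W) :
    (2 : ℝ) • curvature Γ q u v w = (fderiv ℝ ψ q u v - fderiv ℝ ψ q v u) • w
      + fderiv ℝ ψ q u w • v - fderiv ℝ ψ q v w • u := by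
  have h2 : ∀ v w, fderiv ℝ (fderiv ℝ X) q v w = -Γ q v w := fun v w => by
    have := h.self_of_nhds v w
    rw [lieConn_apply, hX0, hX1, hψ0] at this
    simp only [map_zero, ContinuousLinearMap.id_apply, zero_apply, zero_smul, add_zero] at this
    linear_combination (norm := module) this
  have h3 : ∀ u v w, fderiv ℝ (fun q' => lieConn Γ X q' v w) q u
      = fderiv ℝ ψ q u v • w + fderiv ℝ ψ q u w • v := fun u v w => by
    have e : (fun q' => lieConn Γ X q' v w) =ᶠ[𝓝 q] fun q' => ψ q' v • w + ψ q' w • v :=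
      h.mono fun q' h' => h' v w
    have d := (hψ.hasFDerivAt.clm_apply (hasFDerivAt_const v q)).smul_const w
    have d' := (hψ.hasFDerivAt.clm_apply (hasFDerivAt_const w q)).smul_const v
    rw [e.fderiv_eq, (d.fun_add d').fderiv]
    simp
  have h4 : fderiv ℝ (fderiv ℝ (fderiv ℝ X)) q u v w = fderiv ℝ (fderiv ℝ (fderiv ℝ X)) q v u w := by
    rw [(hX.fderiv_smooth.isSymmSndFDerivAt two_le_smooth).eq u v]
  have h5 := h3 u v w
  have h6 := h3 v u w
  rw [fderiv_lieConn_of_homothety hΓ hX hX0 hX1] at h5 h6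
  simp only [h2, h4, map_neg, neg_apply, hs v u] at h5 h6
  rw [curvature]
  linear_combination (norm := module) h5 - h6

end Homothety

/-! ### Connections on the plane in coordinates -/

section Coordinates

/-- The bilinear map on `ℝ²` with the single component `i j k`. -/
def unitBilin (i j k : Fin 2) : (ℝ × ℝ) →L[ℝ] (ℝ × ℝ) →L[ℝ] (ℝ × ℝ) :=
  ((![ContinuousLinearMap.fst ℝ ℝ ℝ, ContinuousLinearMap.snd ℝ ℝ ℝ] : Fin 2 → _) k).smulRight
    (((![ContinuousLinearMap.fst ℝ ℝ ℝ, ContinuousLinearMap.snd ℝ ℝ ℝ] : Fin 2 → _) j).smulRight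
      ((![(1, 0), (0, 1)] : Fin 2 → ℝ × ℝ) i))

/-- The bilinear map on `ℝ²` with components `c i j k`; the first argument is contracted with the
last index. -/
def bilinOfCoeff (c : Fin 2 → Fin 2 → Fin 2 → ℝ) : (ℝ × ℝ) →L[ℝ] (ℝ × ℝ) →L[ℝ] (ℝ × ℝ) :=
  ∑ i, ∑ j, ∑ k, c i j k • unitBilin i j k

theorem bilinOfCoeff_apply (c : Fin 2 → Fin 2 → Fin 2 → ℝ) (v w : ℝ × ℝ) :
    bilinOfCoeff c v w =
      (c 0 0 0 * w.1 * v.1 + c 0 0 1 * w.1 * v.2 + c 0 1 0 * w.2 * v.1 + c 0 1 1 * w.2 * v.2,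
       c 1 0 0 * w.1 * v.1 + c 1 0 1 * w.1 * v.2 + c 1 1 0 * w.2 * v.1 + c 1 1 1 * w.2 * v.2) := by
  ext <;> simp [bilinOfCoeff, unitBilin, Fin.sum_univ_two] <;> ring

/-- The connection on the plane with coefficients `Γ i j k`. -/
def planeConn (Γ : Fin 2 → Fin 2 → Fin 2 → ℝ × ℝ → ℝ) (q : ℝ × ℝ) :
    (ℝ × ℝ) →L[ℝ] (ℝ × ℝ) →L[ℝ] (ℝ × ℝ) :=
  bilinOfCoeff fun i j k => Γ i j k q

theorem contDiffAt_planeConn {Γ : Fin 2 → Fin 2 → Fin 2 → ℝ × ℝ → ℝ} {q : ℝ × ℝ}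
    (hΓ : ∀ i j k, ContDiffAt ℝ ∞ (Γ i j k) q) : ContDiffAt ℝ ∞ (planeConn Γ) q :=
  ContDiffAt.sum (s := Finset.univ) fun i _ => ContDiffAt.sum (s := Finset.univ) fun j _ =>
    ContDiffAt.sum (s := Finset.univ) fun k _ =>
      (hΓ i j k).smul (contDiffAt_const (c := unitBilin i j k))

theorem fderiv_planeConn {Γ : Fin 2 → Fin 2 → Fin 2 → ℝ × ℝ → ℝ} {q : ℝ × ℝ}
    (hΓ : ∀ i j k, DifferentiableAt ℝ (Γ i j k) q) (u : ℝ × ℝ) :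
    fderiv ℝ (planeConn Γ) q u = bilinOfCoeff fun i j k => fderiv ℝ (Γ i j k) q u := by
  have h : HasFDerivAt (planeConn Γ) _ q :=
    HasFDerivAt.fun_sum (u := Finset.univ) fun i _ =>
      HasFDerivAt.fun_sum (u := Finset.univ) fun j _ =>
        HasFDerivAt.fun_sum (u := Finset.univ) fun k _ =>
          (hΓ i j k).hasFDerivAt.smul_const (unitBilin i j k)
  rw [h.fderiv]
  simp [bilinOfCoeff]

theorem fderiv_eq_pd (f : ℝ × ℝ → ℝ) (q u : ℝ × ℝ) :
    fderiv ℝ f q u = u.1 * pd 0 f q + u.2 * pd 1 f q := by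
  have : u = u.1 • (1, 0) + u.2 • (0, 1) := by ext <;> simp
  conv_lhs => rw [this, map_add, map_smul, map_smul]
  simp [pd]

theorem curvature_planeConn {Γ : Fin 2 → Fin 2 → Fin 2 → ℝ × ℝ → ℝ} {q : ℝ × ℝ}
    (hΓ : ∀ i j k, DifferentiableAt ℝ (Γ i j k) q) (u v w : ℝ × ℝ) :
    curvature (planeConn Γ) q u v w = (u.1 * v.2 - u.2 * v.1) •
      (riemann Γ 0 0 0 1 q * w.1 + riemann Γ 0 1 0 1 q * w.2,
       riemann Γ 1 0 0 1 q * w.1 + riemann Γ 1 1 0 1 q * w.2) := by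
  rw [curvature, fderiv_planeConn hΓ, fderiv_planeConn hΓ]
  simp only [planeConn, bilinOfCoeff_apply, fderiv_eq_pd _ q u, fderiv_eq_pd _ q v, riemann,
    Fin.sum_univ_two]
  ext
  · simp; ring
  · simp; ring

theorem riemann_swap (Γ : Fin 2 → Fin 2 → Fin 2 → ℝ × ℝ → ℝ) (i j k l : Fin 2) (q : ℝ × ℝ) :
    riemann Γ i j k l q = -riemann Γ i j l k q := by
  simp only [riemann]; ring

theorem riemannZero_iff_components (Γ : Fin 2 → Fin 2 → Fin 2 → ℝ × ℝ → ℝ) (q : ℝ × ℝ) :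
    RiemannZero Γ q ↔ ∀ i j, riemann Γ i j 0 1 q = 0 := by
  refine ⟨fun h i j => h i j 0 1, fun h i j k l => ?_⟩
  have hd : ∀ k, riemann Γ i j k k q = 0 := fun k => by simp [riemann]
  fin_cases k <;> fin_cases l
  · exact hd _
  · exact h i j
  · exact (riemann_swap Γ i j 1 0 q).trans (by rw [h i j, neg_zero])
  · exact hd _

theorem riemannZero_iff_curvature {Γ : Fin 2 → Fin 2 → Fin 2 → ℝ × ℝ → ℝ} {q : ℝ × ℝ}
    (hΓ : ∀ i j k, DifferentiableAt ℝ (Γ i j k) q) :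
    RiemannZero Γ q ↔ ∀ u v w, curvature (planeConn Γ) q u v w = 0 := by
  rw [riemannZero_iff_components]
  simp only [curvature_planeConn hΓ]
  constructor
  · intro h u v w
    simp [h]
  · intro h i j
    have h1 := h (1, 0) (0, 1) (1, 0)
    have h2 := h (1, 0) (0, 1) (0, 1)
    simp [Prod.ext_iff] at h1 h2
    fin_cases i <;> fin_cases j <;> simp [h1, h2]

theorem IsConnectionOn.planeConn_symm {Γ : Fin 2 → Fin 2 → Fin 2 → ℝ × ℝ → ℝ} {V : Set (ℝ × ℝ)}
    (h : IsConnectionOn Γ V) {q : ℝ × ℝ} (hq : q ∈ V) (v w : ℝ × ℝ) :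
    planeConn Γ q v w = planeConn Γ q w v := by
  simp only [planeConn, bilinOfCoeff_apply, h.2 0 1 0 q hq, h.2 1 1 0 q hq]
  ext <;> simp <;> ring

theorem IsConnectionOn.contDiffAt {Γ : Fin 2 → Fin 2 → Fin 2 → ℝ × ℝ → ℝ} {V : Set (ℝ × ℝ)}
    (h : IsConnectionOn Γ V) (hV : IsOpen V) {q : ℝ × ℝ} (hq : q ∈ V) (i j k : Fin 2) :
    ContDiffAt ℝ ∞ (Γ i j k) q := (h.1 i j k).contDiffAt (hV.mem_nhds hq)

theorem IsConnectionOn.curvature_eq_zero {Γ : Fin 2 → Fin 2 → Fin 2 → ℝ × ℝ → ℝ}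
    {V : Set (ℝ × ℝ)} (h : IsConnectionOn Γ V) (hV : IsOpen V) {q : ℝ × ℝ} (hq : q ∈ V)
    (h0 : RiemannZero Γ q) (u v w : ℝ × ℝ) : curvature (planeConn Γ) q u v w = 0 :=
  (riemannZero_iff_curvature fun i j k => (h.contDiffAt hV hq i j k).differentiableAt (by simp)).1
    h0 u v w

theorem IsConnectionOn.exists_affine_chart {Γ : Fin 2 → Fin 2 → Fin 2 → ℝ × ℝ → ℝ}
    {V : Set (ℝ × ℝ)} (h : IsConnectionOn Γ V) (hV : IsOpen V) (h0 : ∀ q ∈ V, RiemannZero Γ q)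
    {z : ℝ × ℝ} (hz : z ∈ V) {T : (ℝ × ℝ) →L[ℝ] (ℝ × ℝ)} (hT : T.IsInvertible) :
    ∃ φ : ℝ × ℝ → ℝ × ℝ, fderiv ℝ φ z = T ∧ IsAffineChartNear (planeConn Γ) φ z :=
  _root_.exists_affine_chart
    (Filter.eventually_of_mem (hV.mem_nhds hz) fun _ hq =>
      contDiffAt_planeConn (h.contDiffAt hV hq))
    (Filter.eventually_of_mem (hV.mem_nhds hz) fun _ hq => h.planeConn_symm hq)
    (Filter.eventually_of_mem (hV.mem_nhds hz) fun q hq => h.curvature_eq_zero hV hq (h0 q hq)) hT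

end Coordinates

/-! ### Systems of geodesic equations -/

section Suspension

variable {F : Type*} [NormedAddCommGroup F] [NormedSpace ℝ F]

/-- Extension of a bilinear map on `F` to `ℝ × F`, by zero. -/
def extendBilin (F : Type*) [NormedAddCommGroup F] [NormedSpace ℝ F] :
    (F →L[ℝ] F →L[ℝ] F) →L[ℝ] (ℝ × F) →L[ℝ] (ℝ × F) →L[ℝ] (ℝ × F) :=
  ContinuousLinearMap.postcomp _
      (ContinuousLinearMap.postcomp _ (ContinuousLinearMap.inr ℝ ℝ F) ∘L
        ContinuousLinearMap.precomp _ (ContinuousLinearMap.snd ℝ ℝ F)) ∘L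
    ContinuousLinearMap.precomp _ (ContinuousLinearMap.snd ℝ ℝ F)

theorem extendBilin_apply (B : F →L[ℝ] F →L[ℝ] F) (v w : ℝ × F) :
    extendBilin F B v w = (0, B v.2 w.2) := by
  simp [extendBilin]

/-- The product connection on `ℝ × F`; its unparametrized geodesics that are graphs over the first
factor are the geodesics of `Γ`. -/
def suspendConn (Γ : F → F →L[ℝ] F →L[ℝ] F) (q : ℝ × F) :
    (ℝ × F) →L[ℝ] (ℝ × F) →L[ℝ] (ℝ × F) := extendBilin F (Γ q.2)

theorem contDiffAt_suspendConn {Γ : F → F →L[ℝ] F →L[ℝ] F} {q : ℝ × F}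
    (hΓ : ContDiffAt ℝ ∞ Γ q.2) : ContDiffAt ℝ ∞ (suspendConn Γ) q :=
  (extendBilin F).contDiff.contDiffAt.comp q (hΓ.comp q contDiffAt_snd)

theorem curvature_suspendConn {Γ : F → F →L[ℝ] F →L[ℝ] F} {q : ℝ × F}
    (hΓ : DifferentiableAt ℝ Γ q.2) (u v w : ℝ × F) :
    curvature (suspendConn Γ) q u v w = (0, curvature Γ q.2 u.2 v.2 w.2) := by
  have h1 : HasFDerivAt (suspendConn Γ)
      (extendBilin F ∘L fderiv ℝ Γ q.2 ∘L ContinuousLinearMap.snd ℝ ℝ F) q :=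
    (extendBilin F).hasFDerivAt.comp q (hΓ.hasFDerivAt.comp q hasFDerivAt_snd)
  rw [curvature, h1.fderiv]
  simp only [ContinuousLinearMap.comp_apply, extendBilin_apply, suspendConn, curvature]
  simp

end Suspension

section Geodesics

theorem geodesicRHS_eq_projRHS (Γ : Fin 2 → Fin 2 → Fin 2 → ℝ × ℝ → ℝ) :
    geodesicRHS Γ = projRHS (suspendConn (planeConn Γ)) := by
  funext J
  simp only [geodesicRHS, projRHS, suspendConn, extendBilin_apply, planeConn, bilinOfCoeff_apply,
    Fin.sum_univ_two]
  ext <;> simp <;> ring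

theorem hasSymmetryAlgebra_geodesicRHS_iff {Γ : Fin 2 → Fin 2 → Fin 2 → ℝ × ℝ → ℝ}
    {V : Set (ℝ × ℝ)} (hV : IsOpen V) (h : IsConnectionOn Γ V) {z : ℝ × ℝ} (hz : z ∈ V) (s : ℝ) :
    HasSymmetryAlgebra (geodesicRHS Γ) (s, z) (slAlg 4) ↔ ∀ᶠ q in 𝓝 z, RiemannZero Γ q := by
  have hf : Module.finrank ℝ (ℝ × ℝ) + 2 = 4 := by simp
  have hVz : ∀ᶠ q : ℝ × ℝ × ℝ in 𝓝 (s, z), q.2 ∈ V :=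
    continuousAt_snd.eventually_mem (hV.mem_nhds hz)
  have hsm : ∀ᶠ q in 𝓝 (s, z), ContDiffAt ℝ ∞ (suspendConn (planeConn Γ)) q := hVz.mono
    fun q hq => contDiffAt_suspendConn (contDiffAt_planeConn (h.contDiffAt hV hq))
  have hsymm : ∀ᶠ q in 𝓝 (s, z), ∀ v w, suspendConn (planeConn Γ) q v w
      = suspendConn (planeConn Γ) q w v := hVz.mono fun q hq v w => by
    simp only [suspendConn, extendBilin_apply, h.planeConn_symm hq v.2 w.2]
  rw [geodesicRHS_eq_projRHS, ← hf]
  constructor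
  · intro hA
    have h1 := eventually_exists_projective hsm hsymm hA
    have h2 : Filter.Tendsto (fun q : ℝ × ℝ => (s, q)) (𝓝 z) (𝓝 (s, z)) :=
      (Continuous.prodMk_right s).tendsto z
    filter_upwards [h2.eventually h1, h2.eventually hsm, h2.eventually hsymm, hV.mem_nhds hz]
      with q hq hq1 hq2 hqV
    obtain ⟨X, hX, hj⟩ := hq (0, ContinuousLinearMap.id ℝ _, 0)
    have hX0 : X (s, q) = 0 := congrArg Prod.fst hj
    have hX1 : fderiv ℝ X (s, q) = ContinuousLinearMap.id ℝ _ := congrArg (fun j => j.2.1) hj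
    have hψ0 : pureTraceForm (lieConn (suspendConn (planeConn Γ)) X (s, q)) = 0 :=
      congrArg (fun j => j.2.2) hj
    have hXq := hX.self_of_nhds.1
    have hd : DifferentiableAt ℝ (planeConn Γ) q :=
      (contDiffAt_planeConn (h.contDiffAt hV hqV)).differentiableAt (by simp)
    have key := two_smul_curvature_eq hq1 hq2 hXq
      ((contDiffAt_lieConn hq1 hXq).pureTraceForm.differentiableAt (by simp)) hX0 hX1 hψ0
      (hX.mono fun _ h => h.2)
    simp only [curvature_suspendConn (q := (s, q)) hd] at key
    set B := fderiv ℝ (fun q => pureTraceForm (lieConn (suspendConn (planeConn Γ)) X q)) (s, q)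
    -- the curvature vanishes on the flat factor, which forces `B` to vanish on the other one
    have hB : ∀ v w : ℝ × ℝ, B (0, v) (0, w) = 0 := fun v w => by
      have := congrArg Prod.fst (key (1, 0) (0, v) (0, w))
      simpa using this.symm
    refine (riemannZero_iff_curvature fun i j k =>
      (h.contDiffAt hV hqV i j k).differentiableAt (by simp)).2 fun u v w => ?_
    have := congrArg Prod.snd (key (0, u) (0, v) (0, w))
    simpa [hB] using this
  · intro h0
    have hR : ∀ᶠ q in 𝓝 (s, z), ∀ u v w, curvature (suspendConn (planeConn Γ)) q u v w = 0 := by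
      filter_upwards [hVz, continuousAt_snd.eventually h0] with q hq hq0 u v w
      rw [curvature_suspendConn ((contDiffAt_planeConn (h.contDiffAt hV hq)).differentiableAt
        (by simp)), h.curvature_eq_zero hV hq hq0]
      rfl
    obtain ⟨φ, -, hφ⟩ := _root_.exists_affine_chart hsm hsymm hR
      (T := ContinuousLinearMap.id ℝ _) ⟨ContinuousLinearEquiv.refl ℝ _, rfl⟩
    exact hφ.hasSymmetryAlgebra

end Geodesics

/-! ### Projection to the cubic equation and the Lie conditions -/

section Projection

theorem pd_zero (f : ℝ × ℝ → ℝ) (q : ℝ × ℝ) : pd 0 f q = dx f q := rfl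

theorem pd_one (f : ℝ × ℝ → ℝ) (q : ℝ × ℝ) : pd 1 f q = dy f q := rfl

theorem Filter.EventuallyEq.dx_eq {f g : ℝ × ℝ → ℝ} {q : ℝ × ℝ} (h : f =ᶠ[𝓝 q] g) :
    dx f q = dx g q := by rw [dx, h.fderiv_eq, dx]

theorem Filter.EventuallyEq.dy_eq {f g : ℝ × ℝ → ℝ} {q : ℝ × ℝ} (h : f =ᶠ[𝓝 q] g) :
    dy f q = dy g q := by rw [dy, h.fderiv_eq, dy]

theorem LieConditions.congr {E : Fin 4 → ℝ × ℝ → ℝ} {b b' e e' : ℝ × ℝ → ℝ} {q : ℝ × ℝ}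
    (h : LieConditions E b e q) (hb : b =ᶠ[𝓝 q] b') (he : e =ᶠ[𝓝 q] e') :
    LieConditions E b' e' q := by
  rw [LieConditions, ← hb.dx_eq, ← hb.dy_eq, ← he.dx_eq, ← he.dy_eq, ← hb.self_of_nhds,
    ← he.self_of_nhds]
  exact h

theorem geodesicRHS_apply {Γ : Fin 2 → Fin 2 → Fin 2 → ℝ × ℝ → ℝ} {q : ℝ × ℝ}
    (hs : ∀ i j k, Γ i j k q = Γ i k j q) (s : ℝ) (w : ℝ × ℝ) :
    geodesicRHS Γ (s, q, w) =
      (-(Γ 0 0 0 q * w.1 ^ 2 + 2 * Γ 0 0 1 q * w.1 * w.2 + Γ 0 1 1 q * w.2 ^ 2),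
       -(Γ 1 0 0 q * w.1 ^ 2 + 2 * Γ 1 0 1 q * w.1 * w.2 + Γ 1 1 1 q * w.2 ^ 2)) := by
  simp only [geodesicRHS, Fin.sum_univ_two, hs 0 1 0, hs 1 1 0]
  ext
  · simp; ring
  · simp; ring

theorem projectsTo_iff {Γ : Fin 2 → Fin 2 → Fin 2 → ℝ × ℝ → ℝ} {E : Fin 4 → ℝ × ℝ → ℝ}
    {V : Set (ℝ × ℝ)} (hs : ∀ i j k, ∀ q ∈ V, Γ i j k q = Γ i k j q) :
    ProjectsTo Γ E V ↔ ∀ q ∈ V, E 0 q = Γ 1 0 0 q ∧ E 1 q = 2 * Γ 1 0 1 q - Γ 0 0 0 q ∧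
      E 2 q = Γ 1 1 1 q - 2 * Γ 0 0 1 q ∧ E 3 q = -Γ 0 1 1 q := by
  refine forall₂_congr fun q hq => ?_
  have hsq : ∀ i j k, Γ i j k q = Γ i k j q := fun i j k => hs i j k q hq
  simp only [geodesicRHS_apply hsq]
  constructor
  · intro h
    have h0 := h 0 (1, 0) one_ne_zero
    have h1 := h 0 (1, 1) one_ne_zero
    have h2 := h 0 (1, -1) one_ne_zero
    have h3 := h 0 (1, 2) one_ne_zero
    simp only [cubicRHS] at h0 h1 h2 h3
    norm_num at h0 h1 h2 h3
    refine ⟨?_, ?_, ?_, ?_⟩ <;> linarith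
  · rintro ⟨h0, h1, h2, h3⟩ s w hw
    simp only [cubicRHS, h0, h1, h2, h3]
    field_simp
    ring

theorem ProjectsTo.cubicRHS_eq {Γ : Fin 2 → Fin 2 → Fin 2 → ℝ × ℝ → ℝ} {E : Fin 4 → ℝ × ℝ → ℝ}
    {V : Set (ℝ × ℝ)} (hs : ∀ i j k, ∀ q ∈ V, Γ i j k q = Γ i k j q) (h : ProjectsTo Γ E V)
    {q : ℝ × ℝ} (hq : q ∈ V) (p : ℝ) :
    cubicRHS E (q.1, q.2, p) = projRHS (planeConn Γ) (q.1, q.2, p) := by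
  obtain ⟨h0, h1, h2, h3⟩ := (projectsTo_iff hs).1 h q hq
  simp only [cubicRHS, projRHS, planeConn, bilinOfCoeff_apply, h0, h1, h2, h3,
    hs 0 1 0 q hq, hs 1 1 0 q hq, smul_eq_mul]
  ring

theorem riemannZero_iff_flatness {Γ : Fin 2 → Fin 2 → Fin 2 → ℝ × ℝ → ℝ} {V : Set (ℝ × ℝ)}
    (hV : IsOpen V) (hΓ : IsConnectionOn Γ V) {q : ℝ × ℝ} (hq : q ∈ V) :
    RiemannZero Γ q ↔ FlatnessConditions (-Γ 0 0 0) (-Γ 0 0 1) (-Γ 0 1 1)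
          (-Γ 1 0 0) (-Γ 1 0 1) (-Γ 1 1 1) q := by
  have hd : ∀ i j k, DifferentiableAt ℝ (Γ i j k) q := fun i j k =>
    (hΓ.contDiffAt hV hq i j k).differentiableAt (by simp)
  have hs : ∀ i j k, Γ i j k =ᶠ[𝓝 q] Γ i k j := fun i j k =>
    Filter.eventually_of_mem (hV.mem_nhds hq) (hΓ.2 i j k)
  have e1 : dx (-Γ 0 0 1 + -Γ 1 1 1) q = -dx (Γ 0 0 1) q - dx (Γ 1 1 1) q := by
    simp only [dx, fderiv_add (hd 0 0 1).neg (hd 1 1 1).neg, fderiv_neg]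
    simp [sub_eq_add_neg]
  have e2 : dy (-Γ 0 0 0 + -Γ 1 0 1) q = -dy (Γ 0 0 0) q - dy (Γ 1 0 1) q := by
    simp only [dy, fderiv_add (hd 0 0 0).neg (hd 1 0 1).neg, fderiv_neg]
    simp [sub_eq_add_neg]
  have e3 : ∀ i j k, dx (-Γ i j k) q = -dx (Γ i j k) q := fun i j k => by simp [dx, fderiv_neg]
  have e4 : ∀ i j k, dy (-Γ i j k) q = -dy (Γ i j k) q := fun i j k => by simp [dy, fderiv_neg]
  have r : ∀ i j, riemann Γ i j 0 1 q = dx (Γ i j 1) q - dy (Γ i j 0) q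
      + (Γ i 0 0 q * Γ 0 j 1 q + Γ i 1 0 q * Γ 1 j 1 q)
      - (Γ i 0 1 q * Γ 0 j 0 q + Γ i 1 1 q * Γ 1 j 0 q) := fun i j => by
    simp only [riemann, Fin.sum_univ_two, pd_zero, pd_one]
  rw [riemannZero_iff_components, FlatnessConditions, e1, e2]
  simp only [Fin.forall_fin_two, r, e3, e4, Pi.neg_apply, (hs 0 1 0).self_of_nhds,
    (hs 1 1 0).self_of_nhds, (hs 0 1 0).dy_eq,
    (hs 1 1 0).dy_eq]
  constructor
  · rintro ⟨⟨h1, h2⟩, h3, h4⟩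
    refine ⟨?_, ?_, ?_, ?_⟩ <;> linarith
  · rintro ⟨h1, h2, h3, h4⟩
    refine ⟨⟨?_, ?_⟩, ?_, ?_⟩ <;> linarith

theorem flatness_iff_lieConditions {Γ : Fin 2 → Fin 2 → Fin 2 → ℝ × ℝ → ℝ}
    {E : Fin 4 → ℝ × ℝ → ℝ} {V : Set (ℝ × ℝ)} (hV : IsOpen V) (hΓ : IsConnectionOn Γ V)
    (hE : ProjectsTo Γ E V) {q : ℝ × ℝ} (hq : q ∈ V) :
    FlatnessConditions (-Γ 0 0 0) (-Γ 0 0 1) (-Γ 0 1 1) (-Γ 1 0 0) (-Γ 1 0 1) (-Γ 1 1 1) q ↔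
      LieConditions E (-Γ 0 0 1) (Γ 1 0 1) q := by
  have hd : ∀ i j k, DifferentiableAt ℝ (Γ i j k) q := fun i j k =>
    (hΓ.contDiffAt hV hq i j k).differentiableAt (by simp)
  have hE' := (projectsTo_iff hΓ.2).1 hE
  obtain ⟨h0, h1, h2, h3⟩ := hE' q hq
  -- near `q` the `Eᵢ` are combinations of the `Γⁱⱼₖ`, hence so are their derivatives
  have g0 : E 0 =ᶠ[𝓝 q] Γ 1 0 0 :=
    Filter.eventually_of_mem (hV.mem_nhds hq) fun q hq => (hE' q hq).1
  have g1 : E 1 =ᶠ[𝓝 q] fun q => 2 * Γ 1 0 1 q - Γ 0 0 0 q :=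
    Filter.eventually_of_mem (hV.mem_nhds hq) fun q hq => (hE' q hq).2.1
  have g2 : E 2 =ᶠ[𝓝 q] fun q => Γ 1 1 1 q - 2 * Γ 0 0 1 q :=
    Filter.eventually_of_mem (hV.mem_nhds hq) fun q hq => (hE' q hq).2.2.1
  have g3 : E 3 =ᶠ[𝓝 q] -Γ 0 1 1 :=
    Filter.eventually_of_mem (hV.mem_nhds hq) fun q hq => (hE' q hq).2.2.2
  have e1 : dx (-Γ 0 0 1 + -Γ 1 1 1) q = -dx (Γ 0 0 1) q - dx (Γ 1 1 1) q := by
    simp only [dx, fderiv_add (hd 0 0 1).neg (hd 1 1 1).neg, fderiv_neg]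
    simp [sub_eq_add_neg]
  have e2 : dy (-Γ 0 0 0 + -Γ 1 0 1) q = -dy (Γ 0 0 0) q - dy (Γ 1 0 1) q := by
    simp only [dy, fderiv_add (hd 0 0 0).neg (hd 1 0 1).neg, fderiv_neg]
    simp [sub_eq_add_neg]
  have e3 : ∀ i j k, dx (-Γ i j k) q = -dx (Γ i j k) q := fun i j k => by simp [dx, fderiv_neg]
  have e4 : ∀ i j k, dy (-Γ i j k) q = -dy (Γ i j k) q := fun i j k => by simp [dy, fderiv_neg]
  have e5 : dy (E 1) q = 2 * dy (Γ 1 0 1) q - dy (Γ 0 0 0) q := by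
    rw [g1.dy_eq, dy, fderiv_fun_sub ((hd 1 0 1).const_mul 2) (hd 0 0 0),
      fderiv_const_mul (hd 1 0 1)]
    rfl
  have e6 : dx (E 2) q = dx (Γ 1 1 1) q - 2 * dx (Γ 0 0 1) q := by
    rw [g2.dx_eq, dx, fderiv_fun_sub (hd 1 1 1) ((hd 0 0 1).const_mul 2),
      fderiv_const_mul (hd 0 0 1)]
    rfl
  rw [FlatnessConditions, LieConditions, e1, e2, e5, e6, g0.dy_eq, g3.dx_eq, h0, h1, h2, h3]
  simp only [e3, e4, Pi.neg_apply]
  constructor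
  · rintro ⟨h1, h2, h3, h4⟩
    refine ⟨?_, ?_, ?_, ?_⟩ <;> linarith
  · rintro ⟨h1, h2, h3, h4⟩
    refine ⟨?_, ?_, ?_, ?_⟩ <;> linarith

/-- The connection coefficients with prescribed projection and prescribed `b`, `e`. -/
def projectingCoeff (E : Fin 4 → ℝ × ℝ → ℝ) (b e : ℝ × ℝ → ℝ) :
    Fin 2 → Fin 2 → Fin 2 → ℝ × ℝ → ℝ :=
  ![![![fun q => -(E 1 q + 2 * e q), fun q => -b q], ![fun q => -b q, fun q => -E 3 q]],
    ![![E 0, fun q => -e q], ![fun q => -e q, fun q => -(2 * b q - E 2 q)]]]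

theorem exists_projecting {E : Fin 4 → ℝ × ℝ → ℝ} {V : Set (ℝ × ℝ)}
    (hE : ∀ i, ContDiffOn ℝ ∞ (E i) V) {b e : ℝ × ℝ → ℝ} (hb : ContDiffOn ℝ ∞ b V)
    (he : ContDiffOn ℝ ∞ e V) :
    ∃ Γ, IsConnectionOn Γ V ∧ ProjectsTo Γ E V ∧ ∀ q ∈ V,
        -Γ 0 0 0 q = E 1 q + 2 * e q ∧ -Γ 0 0 1 q = b q ∧ -Γ 0 1 1 q = E 3 q ∧
        -Γ 1 0 0 q = -E 0 q ∧ -Γ 1 0 1 q = e q ∧ -Γ 1 1 1 q = 2 * b q - E 2 q := by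
  have hs : ∀ i j k, ∀ q ∈ V, projectingCoeff E b e i j k q = projectingCoeff E b e i k j q :=
    fun i j k q _ => by fin_cases i <;> fin_cases j <;> fin_cases k <;> rfl
  refine ⟨projectingCoeff E b e, ⟨fun i j k => ?_, hs⟩, (projectsTo_iff hs).2 fun q _ => ?_,
    fun q _ => ?_⟩
  · have h2 : ContDiffOn ℝ ∞ (fun _ : ℝ × ℝ => (2 : ℝ)) V := contDiffOn_const
    fin_cases i <;> fin_cases j <;> fin_cases k
    · exact ((hE 1).add (h2.mul he)).neg
    · exact hb.neg
    · exact hb.neg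
    · exact (hE 3).neg
    · exact hE 0
    · exact he.neg
    · exact he.neg
    · exact ((h2.mul hb).sub (hE 2)).neg
  · simp [projectingCoeff]
  · simp [projectingCoeff]

end Projection

/-! ### Point transformations -/

section PointTransformations

/-- The second total derivative of a function of `(x, y)` along `y'' = Ω`. -/
theorem totalDeriv_totalDeriv_onJets {Ω : ℝ × ℝ × ℝ → ℝ} {f : ℝ × ℝ → ℝ} {j : ℝ × ℝ × ℝ}
    (hf : ∀ᶠ q in 𝓝 (j.1, j.2.1), ContDiffAt ℝ ∞ f q) :
    DifferentiableAt ℝ (totalDeriv Ω (onJets f)) j ∧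
    totalDeriv Ω (totalDeriv Ω (onJets f)) j
      = fderiv ℝ (fderiv ℝ f) (j.1, j.2.1) (1, j.2.2) (1, j.2.2)
        + fderiv ℝ f (j.1, j.2.1) (0, Ω j) := by
  have h1 : totalDeriv Ω (onJets f) =ᶠ[𝓝 j]
      fun j => fderiv ℝ f (j.1, j.2.1) (1, j.2.2) := by
    have hc : ContinuousAt (fun j : ℝ × ℝ × ℝ => (j.1, j.2.1)) j :=
      (hasFDerivAt_jet j).continuousAt
    filter_upwards [hc.eventually hf] with j' hj'
    exact totalDeriv_onJets (hj'.differentiableAt (by simp))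
  have h2 := ((hf.self_of_nhds.fderiv_smooth.differentiableAt (by simp)).hasFDerivAt.comp j
    (hasFDerivAt_jet j)).clm_apply (hasFDerivAt_jet_dir j)
  have h3 := h2.congr_of_eventuallyEq h1
  refine ⟨h3.differentiableAt, ?_⟩
  rw [totalDeriv, h3.fderiv]
  simp
  ring

theorem totalDeriv_div {Ω : ℝ × ℝ × ℝ → ℝ} {f g : ℝ × ℝ × ℝ → ℝ} {j : ℝ × ℝ × ℝ}
    (hf : DifferentiableAt ℝ f j) (hg : DifferentiableAt ℝ g j) (h0 : g j ≠ 0) :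
    totalDeriv Ω (fun j => f j / g j) j = (totalDeriv Ω f j * g j - f j * totalDeriv Ω g j)
      / g j ^ 2 := by
  have h1 := hf.hasFDerivAt.mul (((hasDerivAt_inv h0).comp_hasFDerivAt j hg.hasFDerivAt))
  have h2 : HasFDerivAt (fun j => f j / g j) _ j := h1.congr_of_eventuallyEq
    (Filter.Eventually.of_forall fun j => div_eq_mul_inv _ _)
  rw [totalDeriv, h2.fderiv]
  simp [totalDeriv]
  field_simp
  ring

/-- The equation `D(Dv / Du) = 0` cleared of denominators, with the total derivatives expressed by
the derivatives of `u` and `v`. -/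
theorem linearizes_zero_iff {E : Fin 4 → ℝ × ℝ → ℝ} {W : Set (ℝ × ℝ)} (hW : IsOpen W)
    {u v : ℝ × ℝ → ℝ} : Linearizes E W u v 0 0 0 ↔
      ContDiffOn ℝ ∞ u W ∧ ContDiffOn ℝ ∞ v W ∧
      (∀ q ∈ W, dx u q * dy v q - dy u q * dx v q ≠ 0) ∧
      ∀ q ∈ W, ∀ p : ℝ, fderiv ℝ u q (1, p) ≠ 0 →
        (fderiv ℝ (fderiv ℝ v) q (1, p) (1, p) + fderiv ℝ v q (0, cubicRHS E (q.1, q.2, p)))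
            * fderiv ℝ u q (1, p)
          = fderiv ℝ v q (1, p) * (fderiv ℝ (fderiv ℝ u) q (1, p) (1, p)
            + fderiv ℝ u q (0, cubicRHS E (q.1, q.2, p))) := by
  refine and_congr_right fun hu => and_congr_right fun hv => and_congr_right fun _ => ?_
  have h0 : ∀ q ∈ W, ContDiffAt ℝ ∞ (0 : ℝ → ℝ) (u q) ∧ ContDiffAt ℝ ∞ (0 : ℝ → ℝ) (u q) ∧
      ContDiffAt ℝ ∞ (0 : ℝ → ℝ) (u q) := fun q _ => by
    have : ContDiffAt ℝ ∞ (0 : ℝ → ℝ) (u q) := contDiffAt_const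
    exact ⟨this, this, this⟩
  rw [and_iff_right h0]
  refine forall₃_congr fun q hq p => ?_
  have hu' : ∀ᶠ q in 𝓝 q, ContDiffAt ℝ ∞ u q :=
    Filter.eventually_of_mem (hW.mem_nhds hq) fun q hq => hu.contDiffAt (hW.mem_nhds hq)
  have hv' : ∀ᶠ q in 𝓝 q, ContDiffAt ℝ ∞ v q :=
    Filter.eventually_of_mem (hW.mem_nhds hq) fun q hq => hv.contDiffAt (hW.mem_nhds hq)
  obtain ⟨du, hu2⟩ := totalDeriv_totalDeriv_onJets (Ω := cubicRHS E) (j := (q.1, q.2, p)) hu'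
  obtain ⟨dv, hv2⟩ := totalDeriv_totalDeriv_onJets (Ω := cubicRHS E) (j := (q.1, q.2, p)) hv'
  have hu1 := totalDeriv_onJets (Ω := cubicRHS E) (j := (q.1, q.2, p))
    (hu'.self_of_nhds.differentiableAt (by simp))
  have hv1 := totalDeriv_onJets (Ω := cubicRHS E) (j := (q.1, q.2, p))
    (hv'.self_of_nhds.differentiableAt (by simp))
  dsimp only at hu1 hv1 hu2 hv2
  simp only [Pi.zero_apply, zero_mul, add_zero, ne_eq]
  rw [hu1]
  refine imp_congr_right fun hne => ?_
  rw [totalDeriv_div dv du (by rwa [hu1]), hu1, hv1, hu2, hv2, div_eq_zero_iff,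
    or_iff_left hne, div_eq_zero_iff, or_iff_left (pow_ne_zero 2 hne), sub_eq_zero]

theorem fderiv_eq_dx_dy (f : ℝ × ℝ → ℝ) (q w : ℝ × ℝ) :
    fderiv ℝ f q w = w.1 * dx f q + w.2 * dy f q := fderiv_eq_pd f q w

theorem fderiv_prodMk_apply {u v : ℝ × ℝ → ℝ} {q : ℝ × ℝ} (hu : DifferentiableAt ℝ u q)
    (hv : DifferentiableAt ℝ v q) (w : ℝ × ℝ) :
    fderiv ℝ (fun q => (u q, v q)) q w = (fderiv ℝ u q w, fderiv ℝ v q w) := by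
  rw [(hu.hasFDerivAt.prodMk hv.hasFDerivAt).fderiv]
  rfl

theorem isInvertible_fderiv_prodMk {u v : ℝ × ℝ → ℝ} {q : ℝ × ℝ} (hu : DifferentiableAt ℝ u q)
    (hv : DifferentiableAt ℝ v q) (hJ : dx u q * dy v q - dy u q * dx v q ≠ 0) :
    (fderiv ℝ (fun q => (u q, v q)) q).IsInvertible := by
  set T := fderiv ℝ (fun q => (u q, v q)) q
  have hT : ∀ w, T w = (w.1 * dx u q + w.2 * dy u q, w.1 * dx v q + w.2 * dy v q) := fun w => by
    rw [← fderiv_eq_dx_dy, ← fderiv_eq_dx_dy]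
    exact fderiv_prodMk_apply hu hv w
  have hinj : Function.Injective T.toLinearMap := by
    rw [← LinearMap.ker_eq_bot, LinearMap.ker_eq_bot']
    intro w hw
    have h1 : T w = 0 := hw
    rw [hT, Prod.ext_iff] at h1
    obtain ⟨h2, h3⟩ := h1
    simp only [Prod.fst_zero, Prod.snd_zero] at h2 h3
    refine Prod.ext ((mul_left_inj' hJ).1 ?_) ((mul_left_inj' hJ).1 ?_)
    · simp only [Prod.fst_zero]
      linear_combination dy v q * h2 - dy u q * h3
    · simp only [Prod.snd_zero]
      linear_combination dx u q * h3 - dx v q * h2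
  exact ⟨(LinearEquiv.ofInjectiveEndo T.toLinearMap hinj).toContinuousLinearEquiv,
    ContinuousLinearMap.ext fun w => rfl⟩

theorem jacobian_ne_zero {u v : ℝ × ℝ → ℝ} {q : ℝ × ℝ} (hu : DifferentiableAt ℝ u q)
    (hv : DifferentiableAt ℝ v q) (h : (fderiv ℝ (fun q => (u q, v q)) q).IsInvertible) :
    dx u q * dy v q - dy u q * dx v q ≠ 0 := by
  intro h0
  have hT := fun w => fderiv_prodMk_apply hu hv w
  simp only [fderiv_eq_dx_dy] at hT
  have hinj := h.injective
  have h1 : ∀ w, fderiv ℝ (fun q => (u q, v q)) q w = 0 → w = 0 := fun w hw =>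
    hinj (hw.trans (map_zero _).symm)
  have h2 := h1 (dy v q, -dx v q) (by
    rw [hT]; refine Prod.ext ?_ ?_ <;> simp only [Prod.fst_zero, Prod.snd_zero]
    · linear_combination h0
    · ring)
  have h3 := h1 (dy u q, -dx u q) (by
    rw [hT]; refine Prod.ext ?_ ?_ <;> simp only [Prod.fst_zero, Prod.snd_zero]
    · ring
    · linear_combination -h0)
  simp only [Prod.mk_eq_zero, neg_eq_zero] at h2 h3
  have h4 := h1 (1, 0) (by rw [hT]; simp [h2.2, h3.2])
  simp at h4

/-- A smooth map with invertible derivative is injective near the point. -/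
theorem exists_injOn_nhds {φ : ℝ × ℝ → ℝ × ℝ} {z : ℝ × ℝ} (hφ : ContDiffAt ℝ ∞ φ z)
    (h : (fderiv ℝ φ z).IsInvertible) : ∃ N ∈ 𝓝 z, Set.InjOn φ N := by
  obtain ⟨e, he⟩ := h
  have h1 : HasStrictFDerivAt φ (e : (ℝ × ℝ) →L[ℝ] (ℝ × ℝ)) z :=
    he ▸ hφ.hasStrictFDerivAt (by simp)
  exact ⟨_, (h1.toOpenPartialHomeomorph φ).open_source.mem_nhds
    h1.mem_toOpenPartialHomeomorph_source, (h1.toOpenPartialHomeomorph φ).injOn⟩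

/-- An affine chart of a connection that projects to the cubic equation straightens the solutions
of the latter. -/
theorem linearizes_of_affine {E : Fin 4 → ℝ × ℝ → ℝ} {W : Set (ℝ × ℝ)} (hW : IsOpen W)
    {Γ : ℝ × ℝ → (ℝ × ℝ) →L[ℝ] (ℝ × ℝ) →L[ℝ] (ℝ × ℝ)}
    (hE : ∀ q ∈ W, ∀ p, cubicRHS E (q.1, q.2, p) = projRHS Γ (q.1, q.2, p))
    {u v : ℝ × ℝ → ℝ} (hu : ContDiffOn ℝ ∞ u W) (hv : ContDiffOn ℝ ∞ v W)
    (hJ : ∀ q ∈ W, dx u q * dy v q - dy u q * dx v q ≠ 0)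
    (hu2 : ∀ q ∈ W, ∀ w, fderiv ℝ (fderiv ℝ u) q w w = fderiv ℝ u q (Γ q w w))
    (hv2 : ∀ q ∈ W, ∀ w, fderiv ℝ (fderiv ℝ v) q w w = fderiv ℝ v q (Γ q w w)) :
    Linearizes E W u v 0 0 0 := by
  refine (linearizes_zero_iff hW).2 ⟨hu, hv, hJ, fun q hq p _ => ?_⟩
  rw [hu2 q hq, hv2 q hq, hE q hq, ← map_add, ← map_add]
  have : Γ q (1, p) (1, p) + (0, projRHS Γ (q.1, q.2, p)) = (Γ q (1, p) (1, p)).1 • (1, p) := by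
    ext <;> simp [projRHS]
  rw [this, map_smul, map_smul, smul_eq_mul, smul_eq_mul]
  ring

/-- The second derivative of a map, read in the frame of its first derivative: the connection for
which the map is an affine chart. -/
def pullbackConn (φ : ℝ × ℝ → ℝ × ℝ) (q : ℝ × ℝ) : (ℝ × ℝ) →L[ℝ] (ℝ × ℝ) →L[ℝ] (ℝ × ℝ) :=
  ContinuousLinearMap.compL ℝ _ _ _ (fderiv ℝ φ q).inverse ∘L fderiv ℝ (fderiv ℝ φ) q

theorem pullbackConn_apply (φ : ℝ × ℝ → ℝ × ℝ) (q v w : ℝ × ℝ) :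
    pullbackConn φ q v w = (fderiv ℝ φ q).inverse (fderiv ℝ (fderiv ℝ φ) q v w) := rfl

theorem isAffineChartNear_pullbackConn {φ : ℝ × ℝ → ℝ × ℝ} {z : ℝ × ℝ}
    (h : ∀ᶠ q in 𝓝 z, ContDiffAt ℝ ∞ φ q ∧ (fderiv ℝ φ q).IsInvertible) :
    IsAffineChartNear (pullbackConn φ) φ z := by
  filter_upwards [h] with q ⟨hφ, hinv⟩
  refine ⟨hφ, ?_, fun v w => ?_, hinv, fun v w => ?_⟩
  · exact ((ContinuousLinearMap.compL ℝ (ℝ × ℝ) (ℝ × ℝ) (ℝ × ℝ)).contDiff.contDiffAt.comp q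
      (hinv.contDiffAt_map_inverse.comp q hφ.fderiv_smooth)).clm_comp hφ.fderiv_smooth.fderiv_smooth
  · rw [pullbackConn_apply, pullbackConn_apply, (hφ.isSymmSndFDerivAt two_le_smooth).eq v w]
  · rw [pullbackConn_apply]
    obtain ⟨e, he⟩ := hinv
    rw [← he, ContinuousLinearMap.inverse_equiv]
    simp

theorem fderiv_fderiv_prodMk_apply {u v : ℝ × ℝ → ℝ} {q : ℝ × ℝ}
    (hu : ∀ᶠ q in 𝓝 q, ContDiffAt ℝ ∞ u q) (hv : ∀ᶠ q in 𝓝 q, ContDiffAt ℝ ∞ v q)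
    (w w' : ℝ × ℝ) : fderiv ℝ (fderiv ℝ (fun q => (u q, v q))) q w w'
      = (fderiv ℝ (fderiv ℝ u) q w w', fderiv ℝ (fderiv ℝ v) q w w') := by
  have h1 := hu.self_of_nhds
  have h2 := hv.self_of_nhds
  rw [fderiv_fderiv_apply (h1.prodMk h2), fderiv_fderiv_apply h1, fderiv_fderiv_apply h2]
  have h3 : (fun q' => fderiv ℝ (fun q => (u q, v q)) q' w') =ᶠ[𝓝 q]
      fun q' => (fderiv ℝ u q' w', fderiv ℝ v q' w') := by
    filter_upwards [hu, hv] with q' a b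
    exact fderiv_prodMk_apply (a.differentiableAt (by simp)) (b.differentiableAt (by simp)) w'
  rw [h3.fderiv_eq]
  have d : ∀ {f : ℝ × ℝ → ℝ}, ContDiffAt ℝ ∞ f q →
      DifferentiableAt ℝ (fun q' => fderiv ℝ f q' w') q := fun h =>
    (h.fderiv_smooth.clm_apply contDiffAt_const).differentiableAt (by simp)
  exact fderiv_prodMk_apply (d h1) (d h2) w

/-- If `(u, v)` turns the cubic equation into `v'' = 0`, then the cubic equation is that of the
geodesics of the flat connection with affine chart `(u, v)`. At the exceptional slope with
`Du = 0` this follows by continuity. -/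
theorem Linearizes.cubicRHS_eq {E : Fin 4 → ℝ × ℝ → ℝ} {W : Set (ℝ × ℝ)} (hW : IsOpen W)
    {u v : ℝ × ℝ → ℝ} (h : Linearizes E W u v 0 0 0) {q : ℝ × ℝ} (hq : q ∈ W) (p : ℝ) :
    cubicRHS E (q.1, q.2, p) = projRHS (pullbackConn fun q => (u q, v q)) (q.1, q.2, p) := by
  obtain ⟨hu, hv, hJ, hL⟩ := (linearizes_zero_iff hW).1 h
  have hu' : ∀ᶠ q in 𝓝 q, ContDiffAt ℝ ∞ u q :=
    Filter.eventually_of_mem (hW.mem_nhds hq) fun q hq => hu.contDiffAt (hW.mem_nhds hq)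
  have hv' : ∀ᶠ q in 𝓝 q, ContDiffAt ℝ ∞ v q :=
    Filter.eventually_of_mem (hW.mem_nhds hq) fun q hq => hv.contDiffAt (hW.mem_nhds hq)
  have du := hu'.self_of_nhds.differentiableAt (n := ∞) (by simp)
  have dv := hv'.self_of_nhds.differentiableAt (n := ∞) (by simp)
  set Γ := pullbackConn fun q => (u q, v q) with hΓ
  have hinv := isInvertible_fderiv_prodMk du dv (hJ q hq)
  have hΓq : ∀ w, fderiv ℝ (fderiv ℝ u) q w w = fderiv ℝ u q (Γ q w w) ∧
      fderiv ℝ (fderiv ℝ v) q w w = fderiv ℝ v q (Γ q w w) := fun w => by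
    have h1 : fderiv ℝ (fun q => (u q, v q)) q (Γ q w w)
        = fderiv ℝ (fderiv ℝ fun q => (u q, v q)) q w w := by
      rw [hΓ, pullbackConn_apply]
      obtain ⟨e, he⟩ := hinv
      rw [← he, ContinuousLinearMap.inverse_equiv]
      simp
    rw [fderiv_fderiv_prodMk_apply hu' hv', fderiv_prodMk_apply du dv, Prod.ext_iff] at h1
    exact ⟨h1.1.symm, h1.2.symm⟩
  -- the identity holds at all slopes where `Du` does not vanish
  have key : ∀ p, dx u q + p * dy u q ≠ 0 →
      cubicRHS E (q.1, q.2, p) = projRHS Γ (q.1, q.2, p) := fun p hp => by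
    have hp' : fderiv ℝ u q (1, p) ≠ 0 := by
      rw [fderiv_eq_dx_dy]; simpa using hp
    have h1 := hL q hq p hp'
    rw [(hΓq _).1, (hΓq _).2, ← map_add, ← map_add] at h1
    simp only [fderiv_eq_dx_dy, Prod.fst_add, Prod.snd_add, projRHS, smul_eq_mul] at h1 ⊢
    refine (mul_left_inj' (hJ q hq)).1 ?_
    linear_combination h1
  have hc1 : Continuous fun p => cubicRHS E (q.1, q.2, p) := by
    simp only [cubicRHS]; fun_prop
  have hc2 : Continuous fun p => projRHS Γ (q.1, q.2, p) := by
    simp only [projRHS]; fun_prop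
  by_cases hy : dy u q = 0
  · refine key p fun h0 => hJ q hq ?_
    have : dx u q = 0 := by rw [hy, mul_zero, add_zero] at h0; exact h0
    rw [this, hy]; ring
  · refine congrFun (Continuous.ext_on (dense_compl_singleton (-dx u q / dy u q)) hc1 hc2
      fun p hp => key p fun h0 => hp ?_) p
    rw [Set.mem_singleton_iff, eq_div_iff hy]
    linarith

theorem Linearizes.hasSymmetryAlgebra {E : Fin 4 → ℝ × ℝ → ℝ} {W : Set (ℝ × ℝ)} (hW : IsOpen W)
    {u v : ℝ × ℝ → ℝ} (h : Linearizes E W u v 0 0 0) {z : ℝ × ℝ} (hz : z ∈ W) :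
    HasSymmetryAlgebra (cubicRHS E) z (slAlg 3) := by
  obtain ⟨hu, hv, hJ, hL⟩ := (linearizes_zero_iff hW).1 h
  have h1 : IsAffineChartNear (pullbackConn fun q => (u q, v q)) (fun q => (u q, v q)) z := by
    refine isAffineChartNear_pullbackConn (Filter.eventually_of_mem (hW.mem_nhds hz) fun q hq => ?_)
    have h2 := hu.contDiffAt (hW.mem_nhds hq)
    have h3 := hv.contDiffAt (hW.mem_nhds hq)
    exact ⟨h2.prodMk h3, isInvertible_fderiv_prodMk (h2.differentiableAt (by simp))
      (h3.differentiableAt (by simp)) (hJ q hq)⟩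
  have h2 := h1.hasSymmetryAlgebra
  rw [show Module.finrank ℝ ℝ + 2 = 3 by simp] at h2
  exact (hasSymmetryAlgebra_congr (Filter.eventually_of_mem (hW.mem_nhds hz) fun q hq p =>
    (h.cubicRHS_eq hW hq p)) _).2 h2

end PointTransformations

/-! ### Flat connections straighten solutions -/

section Straightening

theorem exists_linearizes_of_flat {E : Fin 4 → ℝ × ℝ → ℝ} {V : Set (ℝ × ℝ)} (hV : IsOpen V)
    {Γ : Fin 2 → Fin 2 → Fin 2 → ℝ × ℝ → ℝ} (hΓ : IsConnectionOn Γ V) (hE : ProjectsTo Γ E V)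
    (h0 : ∀ q ∈ V, RiemannZero Γ q) {z : ℝ × ℝ} (hz : z ∈ V) :
    ∃ W ⊆ V, IsOpen W ∧ z ∈ W ∧ ∃ u v, Set.InjOn (fun q => (u q, v q)) W ∧
      Linearizes E W u v 0 0 0 := by
  obtain ⟨φ, -, hφ⟩ := hΓ.exists_affine_chart hV h0 hz (T := ContinuousLinearMap.id ℝ _)
    ⟨ContinuousLinearEquiv.refl ℝ _, rfl⟩
  obtain ⟨N, hN, hinj⟩ := exists_injOn_nhds hφ.self_of_nhds.1 hφ.self_of_nhds.2.2.2.1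
  obtain ⟨W, hW, hWo, hzW⟩ := eventually_nhds_iff.1 ((hφ.and hN).and (hV.mem_nhds hz))
  have hu : ∀ q ∈ W, ContDiffAt ℝ ∞ (fun q => (φ q).1) q := fun q hq => (hW q hq).1.1.1.fst
  have hv : ∀ q ∈ W, ContDiffAt ℝ ∞ (fun q => (φ q).2) q := fun q hq => (hW q hq).1.1.1.snd
  have hsecond : ∀ q ∈ W, ∀ w,
      fderiv ℝ (fderiv ℝ fun q => (φ q).1) q w w = fderiv ℝ (fun q => (φ q).1) q (planeConn Γ q w w)
      ∧ fderiv ℝ (fderiv ℝ fun q => (φ q).2) q w w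
        = fderiv ℝ (fun q => (φ q).2) q (planeConn Γ q w w) := fun q hq w => by
    have h1 := fderiv_fderiv_prodMk_apply
      (Filter.eventually_of_mem (hWo.mem_nhds hq) hu) (Filter.eventually_of_mem (hWo.mem_nhds hq) hv)
      w w
    have h2 := fderiv_prodMk_apply ((hu q hq).differentiableAt (by simp))
      ((hv q hq).differentiableAt (by simp)) (planeConn Γ q w w)
    have h3 := (hW q hq).1.1.2.2.2.2 w w
    exact Prod.ext_iff.1 (h1.symm.trans (h3.trans h2))
  refine ⟨W, fun q hq => (hW q hq).2, hWo, hzW, fun q => (φ q).1, fun q => (φ q).2,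
    hinj.mono fun q hq => (hW q hq).1.2, linearizes_of_affine hWo
      (fun q hq p => hE.cubicRHS_eq hΓ.2 (hW q hq).2 p) (fun q hq => (hu q hq).contDiffWithinAt)
      (fun q hq => (hv q hq).contDiffWithinAt) (fun q hq => ?_) (fun q hq w => (hsecond q hq w).1)
      fun q hq w => (hsecond q hq w).2⟩
  exact jacobian_ne_zero ((hu q hq).differentiableAt (by simp))
    ((hv q hq).differentiableAt (by simp)) (hW q hq).1.1.2.2.2.1

end Straightening

/-! ### Linear equations are reducible to `v'' = 0` -/

section LinearEquations

/-- Solutions of linear second-order equations with smooth coefficients. -/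
theorem exists_second_order_solution {a b c : ℝ → ℝ} {t₀ : ℝ}
    (ha : ∀ᶠ t in 𝓝 t₀, ContDiffAt ℝ ∞ a t) (hb : ∀ᶠ t in 𝓝 t₀, ContDiffAt ℝ ∞ b t)
    (hc : ∀ᶠ t in 𝓝 t₀, ContDiffAt ℝ ∞ c t) (y₀ y₁ : ℝ) :
    ∃ y y' : ℝ → ℝ, y t₀ = y₀ ∧ y' t₀ = y₁ ∧ ∀ᶠ t in 𝓝 t₀, ContDiffAt ℝ ∞ y t ∧
      ContDiffAt ℝ ∞ y' t ∧ HasDerivAt y (y' t) t ∧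
      HasDerivAt y' (a t * y' t + b t * y t + c t) t := by
  let pr0 : (ℝ × ℝ × ℝ) →L[ℝ] ℝ := ContinuousLinearMap.fst ℝ ℝ (ℝ × ℝ)
  let pr1 : (ℝ × ℝ × ℝ) →L[ℝ] ℝ :=
    ContinuousLinearMap.fst ℝ ℝ ℝ ∘L ContinuousLinearMap.snd ℝ ℝ (ℝ × ℝ)
  let pr2 : (ℝ × ℝ × ℝ) →L[ℝ] ℝ :=
    ContinuousLinearMap.snd ℝ ℝ ℝ ∘L ContinuousLinearMap.snd ℝ ℝ (ℝ × ℝ)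
  -- the third component carries the inhomogeneity; it is the constant `1`
  let M : ℝ → (ℝ × ℝ × ℝ) →L[ℝ] (ℝ × ℝ × ℝ) := fun t =>
    pr1.smulRight (1, 0, 0) + a t • pr1.smulRight (0, 1, 0) + b t • pr0.smulRight (0, 1, 0)
      + c t • pr2.smulRight (0, 1, 0)
  have hM : ∀ t g, M t g = (g.2.1, a t * g.2.1 + b t * g.1 + c t * g.2.2, 0) := fun t g => by
    ext <;> simp [M, pr0, pr1, pr2]
  let A : ℝ → ℝ →L[ℝ] (ℝ × ℝ × ℝ) →L[ℝ] (ℝ × ℝ × ℝ) := fun t =>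
    ContinuousLinearMap.smulRightL ℝ ℝ _ (ContinuousLinearMap.id ℝ ℝ) (M t)
  have hA : ∀ t h, A t h = h • M t := fun t h => rfl
  obtain ⟨u, hu0, hu⟩ := exists_total_solution (A := A) (z := t₀) (by
    filter_upwards [ha, hb, hc] with t h1 h2 h3
    refine (ContinuousLinearMap.contDiff _).contDiffAt.comp t ?_
    exact ((contDiffAt_const.add (h1.smul contDiffAt_const)).add
      (h2.smul contDiffAt_const)).add (h3.smul contDiffAt_const)) (by
    refine Filter.Eventually.of_forall fun t h k => ?_
    -- in one dimension there is no integrability condition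
    have e1 : ∀ h k : ℝ, fderiv ℝ A t k h = (k * h) • fderiv ℝ A t 1 1 := fun h k => by
      conv_lhs => rw [← mul_one k, ← mul_one h, ← smul_eq_mul, ← smul_eq_mul, map_smul, map_smul,
        smul_apply]
      rw [smul_smul, mul_comm]
    rw [e1, e1 k h, hA, hA, mul_comm]
    refine congrArg _ (ContinuousLinearMap.ext fun g => ?_)
    simp [smul_smul, mul_comm]) (y₀, y₁, 1)
  have hd : ∀ᶠ t in 𝓝 t₀, HasDerivAt u (M t (u t)) t := hu.mono fun t ht => by
    have := ht.2.hasDerivAt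
    simpa [hA] using this
  have hd3 : ∀ᶠ t in 𝓝 t₀, (u t).2.2 = 1 := by
    obtain ⟨r, hr, hball⟩ := Metric.eventually_nhds_iff_ball.1 hd
    have h3 : ∀ t ∈ Metric.ball t₀ r, HasDerivAt (fun t => (u t).2.2) 0 t := fun t ht => by
      have h := (hball t ht)
      have h' : HasDerivAt (fun t => (u t).2.2) ((M t (u t)).2.2) t :=
        (pr2.hasFDerivAt.comp_hasDerivAt t h)
      rwa [hM] at h'
    filter_upwards [Metric.ball_mem_nhds t₀ hr] with t ht
    have := (convex_ball t₀ r).is_const_of_fderivWithin_eq_zero (𝕜 := ℝ)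
      (f := fun t => (u t).2.2) (fun t ht => (h3 t ht).differentiableAt.differentiableWithinAt)
      (fun t ht => by
        rw [fderivWithin_of_isOpen Metric.isOpen_ball ht]
        ext; simp [(h3 t ht).deriv]) ht (Metric.mem_ball_self hr)
    simp only [this, hu0]
  refine ⟨fun t => (u t).1, fun t => (u t).2.1, congrArg Prod.fst hu0,
    congrArg (fun g => g.2.1) hu0, ?_⟩
  filter_upwards [hu, hd, hd3] with t h1 h2 h3
  rw [hM, h3, mul_one] at h2
  exact ⟨h1.1.fst, h1.1.snd.fst, pr0.hasFDerivAt.comp_hasDerivAt t h2,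
    pr1.hasFDerivAt.comp_hasDerivAt t h2⟩

theorem totalDeriv_eq_of_hasFDerivAt {Ω : ℝ × ℝ × ℝ → ℝ} {f : ℝ × ℝ × ℝ → ℝ} {j : ℝ × ℝ × ℝ}
    {f' : (ℝ × ℝ × ℝ) →L[ℝ] ℝ} (h : HasFDerivAt f f' j) :
    totalDeriv Ω f j = f' (1, j.2.2, Ω j) := by rw [totalDeriv, h.fderiv]

/-- Under `u ↦ U(u)`, `v ↦ f(u) v + g(u)` the linear equation for `(u, v)` becomes `v'' = 0`, if
the coefficients of `dv/du`, `v` and `1` in the transformed equation vanish. -/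
theorem Linearizes.change {E : Fin 4 → ℝ × ℝ → ℝ} {W : Set (ℝ × ℝ)} (hW : IsOpen W)
    {u v : ℝ × ℝ → ℝ} {α β γ : ℝ → ℝ} (hL : Linearizes E W u v α β γ)
    {U U' f f' f'' g g' g'' h : ℝ → ℝ}
    (hU : ∀ q ∈ W, ContDiffAt ℝ ∞ U (u q) ∧ HasDerivAt U (U' (u q)) (u q) ∧
      HasDerivAt U' (h (u q) * U' (u q)) (u q) ∧ U' (u q) ≠ 0)
    (hf : ∀ q ∈ W, ContDiffAt ℝ ∞ f (u q) ∧ HasDerivAt f (f' (u q)) (u q) ∧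
      HasDerivAt f' (f'' (u q)) (u q) ∧ f (u q) ≠ 0)
    (hg : ∀ q ∈ W, ContDiffAt ℝ ∞ g (u q) ∧ HasDerivAt g (g' (u q)) (u q) ∧
      HasDerivAt g' (g'' (u q)) (u q))
    (h1 : ∀ q ∈ W, 2 * f' (u q) - α (u q) * f (u q) - h (u q) * f (u q) = 0)
    (h2 : ∀ q ∈ W, f'' (u q) - β (u q) * f (u q) - h (u q) * f' (u q) = 0)
    (h3 : ∀ q ∈ W, g'' (u q) - γ (u q) * f (u q) - h (u q) * g' (u q) = 0) :
    Linearizes E W (fun q => U (u q)) (fun q => f (u q) * v q + g (u q)) 0 0 0 := by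
  obtain ⟨hu, hv, hJ, -, hL⟩ := hL
  have hu' : ∀ q ∈ W, ContDiffAt ℝ ∞ u q := fun q hq => hu.contDiffAt (hW.mem_nhds hq)
  have hv' : ∀ q ∈ W, ContDiffAt ℝ ∞ v q := fun q hq => hv.contDiffAt (hW.mem_nhds hq)
  have du : ∀ q ∈ W, HasFDerivAt u (fderiv ℝ u q) q := fun q hq =>
    ((hu' q hq).differentiableAt (by simp)).hasFDerivAt
  have dv : ∀ q ∈ W, HasFDerivAt v (fderiv ℝ v q) q := fun q hq =>
    ((hv' q hq).differentiableAt (by simp)).hasFDerivAt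
  have dU : ∀ q ∈ W, HasFDerivAt (fun q => U (u q)) (U' (u q) • fderiv ℝ u q) q := fun q hq =>
    (hU q hq).2.1.comp_hasFDerivAt q (du q hq)
  have dV : ∀ q ∈ W, HasFDerivAt (fun q => f (u q) * v q + g (u q))
      (f (u q) • fderiv ℝ v q + v q • f' (u q) • fderiv ℝ u q + g' (u q) • fderiv ℝ u q) q :=
    fun q hq => (((hf q hq).2.1.comp_hasFDerivAt q (du q hq)).mul (dv q hq)).add
      ((hg q hq).2.1.comp_hasFDerivAt q (du q hq))
  refine ⟨fun q hq => ((hU q hq).1.comp q (hu' q hq)).contDiffWithinAt,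
    fun q hq => ((((hf q hq).1.comp q (hu' q hq)).mul (hv' q hq)).add
      ((hg q hq).1.comp q (hu' q hq))).contDiffWithinAt, fun q hq => ?_, fun q hq => ?_, ?_⟩
  · have : dx u q * dy v q - dy u q * dx v q ≠ 0 := hJ q hq
    simp only [dx, dy, (dU q hq).fderiv, (dV q hq).fderiv, add_apply, smul_apply, smul_eq_mul]
      at this ⊢
    have h5 := mul_ne_zero (mul_ne_zero (hU q hq).2.2.2 (hf q hq).2.2.2) this
    intro h0
    apply h5
    linear_combination h0
  · have : ContDiffAt ℝ ∞ (0 : ℝ → ℝ) (U (u q)) := contDiffAt_const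
    exact ⟨this, this, this⟩
  intro q hq p
  dsimp only
  intro hne
  have hL' := hL q hq p
  dsimp only at hL'
  set Ω := cubicRHS E
  set j : ℝ × ℝ × ℝ := (q.1, q.2, p) with hj
  have jW : ∀ᶠ j' in 𝓝 j, (j'.1, j'.2.1) ∈ W :=
    (hasFDerivAt_jet j).continuousAt.eventually_mem (hW.mem_nhds hq)
  have Du : ∀ j' : ℝ × ℝ × ℝ, (j'.1, j'.2.1) ∈ W →
      totalDeriv Ω (onJets u) j' = fderiv ℝ u (j'.1, j'.2.1) (1, j'.2.2) :=
    fun j' hj' => totalDeriv_onJets (du _ hj').differentiableAt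
  have DU : ∀ j' : ℝ × ℝ × ℝ, (j'.1, j'.2.1) ∈ W →
      totalDeriv Ω (onJets fun q => U (u q)) j' = U' (onJets u j') * totalDeriv Ω (onJets u) j' :=
    fun j' hj' => by
      rw [totalDeriv_onJets (dU _ hj').differentiableAt, (dU _ hj').fderiv, Du j' hj']
      rfl
  have DV : ∀ j' : ℝ × ℝ × ℝ, (j'.1, j'.2.1) ∈ W →
      totalDeriv Ω (onJets fun q => f (u q) * v q + g (u q)) j'
        = f (onJets u j') * totalDeriv Ω (onJets v) j'
          + onJets v j' * f' (onJets u j') * totalDeriv Ω (onJets u) j'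
          + g' (onJets u j') * totalDeriv Ω (onJets u) j' :=
    fun j' hj' => by
      rw [totalDeriv_onJets (dV _ hj').differentiableAt, (dV _ hj').fderiv, Du j' hj',
        totalDeriv_onJets (dv _ hj').differentiableAt]
      simp [onJets, mul_assoc]
  have hu0 : totalDeriv Ω (onJets u) j ≠ 0 := fun h0 => hne (by rw [DU j hq, h0, mul_zero])
  specialize hL' hu0
  have du1 := (totalDeriv_totalDeriv_onJets (Ω := Ω) (j := j)
    (Filter.eventually_of_mem (hW.mem_nhds hq) hu')).1
  have dv1 := (totalDeriv_totalDeriv_onJets (Ω := Ω) (j := j)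
    (Filter.eventually_of_mem (hW.mem_nhds hq) hv')).1
  set s : ℝ × ℝ × ℝ → ℝ := fun j => totalDeriv Ω (onJets v) j / totalDeriv Ω (onJets u) j with hs
  have ds : DifferentiableAt ℝ s j := (dv1.mul
    ((hasDerivAt_inv hu0).comp_hasFDerivAt j du1.hasFDerivAt).differentiableAt).congr_of_eventuallyEq
      (Filter.Eventually.of_forall fun j => div_eq_mul_inv _ _)
  have hs' : ∀ j, s j = totalDeriv Ω (onJets v) j / totalDeriv Ω (onJets u) j := fun j => rfl
  clear_value s
  -- the new slope in terms of the old one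
  have hslope : (fun j => totalDeriv Ω (onJets fun q => f (u q) * v q + g (u q)) j
      / totalDeriv Ω (onJets fun q => U (u q)) j) =ᶠ[𝓝 j]
      fun j => (f (onJets u j) * s j + onJets v j * f' (onJets u j) + g' (onJets u j))
        / U' (onJets u j) := by
    filter_upwards [jW, du1.continuousAt.eventually_ne hu0] with j' hj' h0
    have h6 := (hU _ hj').2.2.2
    have h7 : U' (onJets u j') ≠ 0 := h6
    rw [DU j' hj', DV j' hj', hs']
    field_simp
  have du0 : HasFDerivAt (onJets u) (fderiv ℝ (onJets u) j) j :=
    (((du q hq).comp j (hasFDerivAt_jet j)).differentiableAt).hasFDerivAt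
  have dv0 : HasFDerivAt (onJets v) (fderiv ℝ (onJets v) j) j :=
    (((dv q hq).comp j (hasFDerivAt_jet j)).differentiableAt).hasFDerivAt
  have df : HasFDerivAt (fun j => f (onJets u j)) _ j :=
    HasDerivAt.comp_hasFDerivAt j (hf q hq).2.1 du0
  have df' : HasFDerivAt (fun j => f' (onJets u j)) _ j :=
    HasDerivAt.comp_hasFDerivAt j (hf q hq).2.2.1 du0
  have dg' : HasFDerivAt (fun j => g' (onJets u j)) _ j :=
    HasDerivAt.comp_hasFDerivAt j (hg q hq).2.2 du0
  have dU' : HasFDerivAt (fun j => U' (onJets u j)) _ j :=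
    HasDerivAt.comp_hasFDerivAt j (hU q hq).2.2.1 du0
  have dnum := ((df.mul ds.hasFDerivAt).add (dv0.mul df')).add dg'
  have hDv : totalDeriv Ω (onJets v) j = s j * totalDeriv Ω (onJets u) j := by
    rw [hs']; field_simp
  have e1 : totalDeriv Ω (fun j => totalDeriv Ω (onJets fun q => f (u q) * v q + g (u q)) j
      / totalDeriv Ω (onJets fun q => U (u q)) j) j = 0 := by
    rw [totalDeriv, hslope.fderiv_eq]
    refine (totalDeriv_div (Ω := Ω) dnum.differentiableAt dU'.differentiableAt (hU q hq).2.2.2).trans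
      ?_
    rw [div_eq_zero_iff]
    left
    rw [totalDeriv_eq_of_hasFDerivAt dnum, totalDeriv_eq_of_hasFDerivAt dU']
    have hT : totalDeriv Ω s j = -totalDeriv Ω (onJets u) j
        * (α (u q) * s j + β (u q) * v q + γ (u q)) := by
      field_simp at hL'
      linear_combination hL' - α (u q) * hDv
    rw [totalDeriv] at hT hDv
    rw [totalDeriv] at hT hDv
    simp only [add_apply, smul_apply, smul_eq_mul, hT, hDv, Pi.add_apply, Pi.mul_apply]
    have k1 := h1 q hq
    have k2 := h2 q hq
    have k3 := h3 q hq
    have r1 : onJets u j = u q := rfl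
    have r2 : onJets v j = v q := rfl
    rw [r1, r2]
    set δ := fderiv ℝ (onJets u) j (1, j.2.2, Ω j)
    linear_combination δ * U' (u q) * (s j * k1 + v q * k2 + k3)
  rw [e1]
  simp

/-- With a nowhere vanishing solution `w` of the homogeneous equation, `v / w` satisfies an equation
without zeroth-order term; reparametrization and subtraction of a solution then give `v'' = 0`. -/
theorem Linearizes.exists_linearizes_zero {E : Fin 4 → ℝ × ℝ → ℝ} {W : Set (ℝ × ℝ)}
    (hW : IsOpen W) {u v : ℝ × ℝ → ℝ} {α β γ : ℝ → ℝ} (hL : Linearizes E W u v α β γ)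
    {z : ℝ × ℝ} (hz : z ∈ W) :
    ∃ W' ⊆ W, IsOpen W' ∧ z ∈ W' ∧ ∃ u v, Set.InjOn (fun q => (u q, v q)) W' ∧
      Linearizes E W' u v 0 0 0 := by
  have hu : ContDiffAt ℝ ∞ u z := hL.1.contDiffAt (hW.mem_nhds hz)
  have hopen : Filter.map u (𝓝 z) = 𝓝 (u z) := by
    refine (hu.hasStrictFDerivAt (by simp)).map_nhds_eq_of_surj ?_
    refine LinearMap.range_eq_top.2 (LinearMap.surjective ?_)
    intro h0
    have h1 : fderiv ℝ u z = 0 := ContinuousLinearMap.coe_injective h0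
    refine hL.2.2.1 z hz ?_
    simp [dx, dy, h1]
  have hcoef : ∀ᶠ t in 𝓝 (u z), ContDiffAt ℝ ∞ α t ∧ ContDiffAt ℝ ∞ β t ∧
      ContDiffAt ℝ ∞ γ t := by
    rw [← hopen, Filter.eventually_map]
    exact Filter.eventually_of_mem (hW.mem_nhds hz) hL.2.2.2.1
  have hzero : ∀ t, ContDiffAt ℝ ∞ (fun _ : ℝ => (0 : ℝ)) t := fun t => contDiffAt_const
  obtain ⟨w, w', hw0, -, hw⟩ := exists_second_order_solution (a := fun t => -α t)
    (b := fun t => -β t) (c := fun _ => 0) (hcoef.mono fun t h => h.1.neg)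
    (hcoef.mono fun t h => h.2.1.neg) (Filter.Eventually.of_forall hzero) 1 0
  have hwne : ∀ᶠ t in 𝓝 (u z), w t ≠ 0 :=
    hw.self_of_nhds.1.continuousAt.eventually_ne (by rw [hw0]; exact one_ne_zero)
  have hh : ∀ᶠ t in 𝓝 (u z), ContDiffAt ℝ ∞ (fun t => -2 * w' t * (w t)⁻¹ - α t) t := by
    filter_upwards [hw, hwne, hcoef] with t h1 h2 h3
    have hc : ContDiffAt ℝ ∞ (fun _ : ℝ => (-2 : ℝ)) t := contDiffAt_const
    exact ((hc.mul h1.2.1).mul (h1.1.inv h2)).sub h3.1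
  obtain ⟨U, U', -, hU0, hU⟩ := exists_second_order_solution hh
    (Filter.Eventually.of_forall hzero) (Filter.Eventually.of_forall hzero) 0 1
  obtain ⟨g, g', -, -, hg⟩ := exists_second_order_solution (c := fun t => γ t * (w t)⁻¹) hh
    (Filter.Eventually.of_forall hzero) (by
      filter_upwards [hw, hwne, hcoef] with t h1 h2 h3
      exact h3.2.2.mul (h1.1.inv h2)) 0 0
  have hU'ne : ∀ᶠ t in 𝓝 (u z), U' t ≠ 0 :=
    hU.self_of_nhds.2.1.continuousAt.eventually_ne (by rw [hU0]; exact one_ne_zero)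
  have hall := hu.continuousAt.eventually (((hw.and hwne).and (hU.and hU'ne)).and hg)
  obtain ⟨W₁, hW₁, hW₁o, hzW₁⟩ := eventually_nhds_iff.1 (hall.and (hW.mem_nhds hz))
  have hL₁ : Linearizes E W₁ u v α β γ := by
    obtain ⟨a1, a2, a3, a4, a5⟩ := hL
    have hs : W₁ ⊆ W := fun q hq => (hW₁ q hq).2
    exact ⟨a1.mono hs, a2.mono hs, fun q hq => a3 q (hs hq), fun q hq => a4 q (hs hq),
      fun q hq => a5 q (hs hq)⟩
  have hres := hL₁.change hW₁o (U := U) (U' := U') (f := fun t => (w t)⁻¹)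
    (f' := fun t => -w' t / w t ^ 2)
    (f'' := fun t => (-(-α t * w' t + -β t * w t + 0) * w t ^ 2
      - -w' t * ((2 : ℕ) * w t ^ (2 - 1) * w' t)) / (w t ^ 2) ^ 2)
    (g := g) (g' := g')
    (g'' := fun t => (-2 * w' t * (w t)⁻¹ - α t) * g' t + 0 * g t + γ t * (w t)⁻¹)
    (h := fun t => -2 * w' t * (w t)⁻¹ - α t)
    (fun q hq => by
      obtain ⟨⟨⟨-, -⟩, b1, b2⟩, -⟩ := (hW₁ q hq).1
      refine ⟨b1.1, b1.2.2.1, ?_, b2⟩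
      simpa using b1.2.2.2)
    (fun q hq => by
      obtain ⟨⟨⟨b1, b2⟩, -⟩, -⟩ := (hW₁ q hq).1
      exact ⟨b1.1.inv b2, b1.2.2.1.inv b2, b1.2.2.2.neg.div (b1.2.2.1.pow 2) (pow_ne_zero 2 b2),
        inv_ne_zero b2⟩)
    (fun q hq => by
      obtain ⟨-, b1⟩ := (hW₁ q hq).1
      exact ⟨b1.1, b1.2.2.1, b1.2.2.2⟩)
    (fun q hq => by
      obtain ⟨⟨⟨-, b2⟩, -⟩, -⟩ := (hW₁ q hq).1
      field_simp
      ring)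
    (fun q hq => by
      obtain ⟨⟨⟨-, b2⟩, -⟩, -⟩ := (hW₁ q hq).1
      field_simp
      ring)
    (fun q hq => by ring)
  set u₁ := fun q => U (u q)
  set v₁ := fun q => (w (u q))⁻¹ * v q + g (u q)
  have hu₁ : ContDiffAt ℝ ∞ u₁ z := hres.1.contDiffAt (hW₁o.mem_nhds hzW₁)
  have hv₁ : ContDiffAt ℝ ∞ v₁ z := hres.2.1.contDiffAt (hW₁o.mem_nhds hzW₁)
  obtain ⟨N, hN, hinj⟩ := exists_injOn_nhds (hu₁.prodMk hv₁)
    (isInvertible_fderiv_prodMk (hu₁.differentiableAt (by simp)) (hv₁.differentiableAt (by simp))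
      (hres.2.2.1 z hzW₁))
  obtain ⟨N', hN', hN'o, hzN'⟩ := mem_nhds_iff.1 hN
  have hs : W₁ ∩ N' ⊆ W₁ := Set.inter_subset_left
  obtain ⟨a1, a2, a3, a4, a5⟩ := hres
  exact ⟨W₁ ∩ N', fun q hq => (hW₁ q hq.1).2, hW₁o.inter hN'o, ⟨hzW₁, hzN'⟩, u₁, v₁,
    hinj.mono fun q hq => hN' hq.2, a1.mono hs, a2.mono hs, fun q hq => a3 q (hs hq),
    fun q hq => a4 q (hs hq), fun q hq => a5 q (hs hq)⟩

end LinearEquations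

/-! ### Metrics with given Christoffel symbols -/

section Partials

theorem HasFDerivAt.dx_eq {f : ℝ × ℝ → ℝ} {q : ℝ × ℝ} {f' : (ℝ × ℝ) →L[ℝ] ℝ}
    (h : HasFDerivAt f f' q) : dx f q = f' (1, 0) := by rw [dx, h.fderiv]

theorem HasFDerivAt.dy_eq {f : ℝ × ℝ → ℝ} {q : ℝ × ℝ} {f' : (ℝ × ℝ) →L[ℝ] ℝ}
    (h : HasFDerivAt f f' q) : dy f q = f' (0, 1) := by rw [dy, h.fderiv]

theorem ContDiffAt.dx_smooth {f : ℝ × ℝ → ℝ} {q : ℝ × ℝ} (hf : ContDiffAt ℝ ∞ f q) :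
    ContDiffAt ℝ ∞ (dx f) q := hf.fderiv_smooth.clm_apply contDiffAt_const

theorem ContDiffAt.dy_smooth {f : ℝ × ℝ → ℝ} {q : ℝ × ℝ} (hf : ContDiffAt ℝ ∞ f q) :
    ContDiffAt ℝ ∞ (dy f) q := hf.fderiv_smooth.clm_apply contDiffAt_const

theorem dx_dy_comm {f : ℝ × ℝ → ℝ} {q : ℝ × ℝ} (hf : ContDiffAt ℝ ∞ f q) :
    dx (dy f) q = dy (dx f) q := by
  have h1 := fderiv_fderiv_apply hf (1, 0) (0, 1)
  have h2 := fderiv_fderiv_apply hf (0, 1) (1, 0)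
  exact h1.symm.trans (((hf.isSymmSndFDerivAt two_le_smooth).eq _ _).trans h2)

theorem fderiv_fderiv_self_apply {f : ℝ × ℝ → ℝ} {q : ℝ × ℝ} (hf : ContDiffAt ℝ ∞ f q)
    (w : ℝ × ℝ) : fderiv ℝ (fderiv ℝ f) q w w =
      w.1 ^ 2 * dx (dx f) q + 2 * w.1 * w.2 * dy (dx f) q + w.2 ^ 2 * dy (dy f) q := by
  have h1 := fderiv_fderiv_apply hf w (1, 0)
  have h2 := fderiv_fderiv_apply hf w (0, 1)
  have h3 : fderiv ℝ (fderiv ℝ f) q w w = w.1 * fderiv ℝ (fderiv ℝ f) q w (1, 0)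
      + w.2 * fderiv ℝ (fderiv ℝ f) q w (0, 1) := by
    have : w = w.1 • (1, 0) + w.2 • (0, 1) := by ext <;> simp
    conv_lhs => rw [this, map_add, map_smul, map_smul, ← this]
    rfl
  rw [h3, h1, h2]
  change w.1 * fderiv ℝ (dx f) q w + w.2 * fderiv ℝ (dy f) q w = _
  rw [fderiv_eq_dx_dy, fderiv_eq_dx_dy, dx_dy_comm hf]
  ring

theorem fderiv_mul_add_mul {f g h k : ℝ × ℝ → ℝ} {q : ℝ × ℝ} (hf : DifferentiableAt ℝ f q)
    (hg : DifferentiableAt ℝ g q) (hh : DifferentiableAt ℝ h q) (hk : DifferentiableAt ℝ k q)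
    (w : ℝ × ℝ) : fderiv ℝ (fun q => f q * g q + h q * k q) q w =
      fderiv ℝ f q w * g q + f q * fderiv ℝ g q w + (fderiv ℝ h q w * k q + h q * fderiv ℝ k q w) := by
  have h1 : HasFDerivAt (fun q => f q * g q + h q * k q) _ q :=
    (hf.hasFDerivAt.mul hg.hasFDerivAt).add (hh.hasFDerivAt.mul hk.hasFDerivAt)
  rw [h1.fderiv]
  simp
  ring

end Partials

section AffineFunctions

/-- The function `u` is affine at `q` for the connection with coefficients `Γ`: its covariant
Hessian vanishes. -/
def IsAffineFunAt (Γ : Fin 2 → Fin 2 → Fin 2 → ℝ × ℝ → ℝ) (u : ℝ × ℝ → ℝ) (q : ℝ × ℝ) : Prop :=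
  dx (dx u) q = Γ 0 0 0 q * dx u q + Γ 1 0 0 q * dy u q ∧
  dy (dx u) q = Γ 0 0 1 q * dx u q + Γ 1 0 1 q * dy u q ∧
  dy (dy u) q = Γ 0 1 1 q * dx u q + Γ 1 1 1 q * dy u q

theorem isAffineFunAt_iff {Γ : Fin 2 → Fin 2 → Fin 2 → ℝ × ℝ → ℝ} {u : ℝ × ℝ → ℝ} {q : ℝ × ℝ}
    (hs : ∀ i j k, Γ i j k q = Γ i k j q) (hu : ContDiffAt ℝ ∞ u q) :
    IsAffineFunAt Γ u q ↔
      ∀ w, fderiv ℝ (fderiv ℝ u) q w w = fderiv ℝ u q (planeConn Γ q w w) := by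
  simp only [fderiv_fderiv_self_apply hu, planeConn, bilinOfCoeff_apply, fderiv_eq_dx_dy u,
    hs 0 1 0, hs 1 1 0, IsAffineFunAt]
  constructor
  · rintro ⟨h1, h2, h3⟩ w
    rw [h1, h2, h3]
    ring
  · intro h
    have h1 := h (1, 0)
    have h2 := h (0, 1)
    have h3 := h (1, 1)
    norm_num at h1 h2 h3
    refine ⟨h1, ?_, h2⟩
    linarith

/-- The components of `du² + dv²`. -/
def pullbackMetric (u v : ℝ × ℝ → ℝ) (i j : Fin 2) (q : ℝ × ℝ) : ℝ :=
  (![dx u, dy u] : Fin 2 → ℝ × ℝ → ℝ) i q * (![dx u, dy u] : Fin 2 → ℝ × ℝ → ℝ) j q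
    + (![dx v, dy v] : Fin 2 → ℝ × ℝ → ℝ) i q * (![dx v, dy v] : Fin 2 → ℝ × ℝ → ℝ) j q

theorem partials_pullbackMetric {u v : ℝ × ℝ → ℝ} {q : ℝ × ℝ} (hu : ContDiffAt ℝ ∞ u q)
    (hv : ContDiffAt ℝ ∞ v q) :
    dx (pullbackMetric u v 0 0) q = 2 * (dx u q * dx (dx u) q + dx v q * dx (dx v) q) ∧
    dx (pullbackMetric u v 0 1) q = dx (dx u) q * dy u q + dx u q * dy (dx u) q
      + (dx (dx v) q * dy v q + dx v q * dy (dx v) q) ∧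
    dx (pullbackMetric u v 1 1) q = 2 * (dy u q * dy (dx u) q + dy v q * dy (dx v) q) ∧
    dy (pullbackMetric u v 0 0) q = 2 * (dx u q * dy (dx u) q + dx v q * dy (dx v) q) ∧
    dy (pullbackMetric u v 0 1) q = dy (dx u) q * dy u q + dx u q * dy (dy u) q
      + (dy (dx v) q * dy v q + dx v q * dy (dy v) q) ∧
    dy (pullbackMetric u v 1 1) q = 2 * (dy u q * dy (dy u) q + dy v q * dy (dy v) q) := by
  have d1 := hu.dx_smooth.differentiableAt (n := ∞) (by simp)
  have d2 := hu.dy_smooth.differentiableAt (n := ∞) (by simp)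
  have d3 := hv.dx_smooth.differentiableAt (n := ∞) (by simp)
  have d4 := hv.dy_smooth.differentiableAt (n := ∞) (by simp)
  have e00 := fderiv_mul_add_mul d1 d1 d3 d3
  have e01 := fderiv_mul_add_mul d1 d2 d3 d4
  have e11 := fderiv_mul_add_mul d2 d2 d4 d4
  rw [← dx_dy_comm hu, ← dx_dy_comm hv]
  refine ⟨(e00 (1, 0)).trans ?_, ?_, (e11 (1, 0)).trans ?_, (e00 (0, 1)).trans ?_, ?_,
    (e11 (0, 1)).trans ?_⟩
  · change dx (dx u) q * dx u q + dx u q * dx (dx u) q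
      + (dx (dx v) q * dx v q + dx v q * dx (dx v) q) = _
    ring
  · exact e01 (1, 0)
  · change dx (dy u) q * dy u q + dy u q * dx (dy u) q
      + (dx (dy v) q * dy v q + dy v q * dx (dy v) q) = _
    ring
  · rw [dx_dy_comm hu, dx_dy_comm hv]
    change dy (dx u) q * dx u q + dx u q * dy (dx u) q
      + (dy (dx v) q * dx v q + dx v q * dy (dx v) q) = _
    ring
  · rw [dx_dy_comm hu, dx_dy_comm hv]
    exact e01 (0, 1)
  · change dy (dy u) q * dy u q + dy u q * dy (dy u) q
      + (dy (dy v) q * dy v q + dy v q * dy (dy v) q) = _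
    ring

theorem metricEquations_pullbackMetric {Γ : Fin 2 → Fin 2 → Fin 2 → ℝ × ℝ → ℝ}
    {u v : ℝ × ℝ → ℝ} {q : ℝ × ℝ} (hu : ContDiffAt ℝ ∞ u q) (hv : ContDiffAt ℝ ∞ v q)
    (hu2 : IsAffineFunAt Γ u q) (hv2 : IsAffineFunAt Γ v q) :
    MetricEquations (-Γ 0 0 0) (-Γ 0 0 1) (-Γ 0 1 1) (-Γ 1 0 0) (-Γ 1 0 1) (-Γ 1 1 1)
      (pullbackMetric u v 0 0) (pullbackMetric u v 0 1) (pullbackMetric u v 1 1) q := by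
  obtain ⟨a1, a2, a3⟩ := hu2
  obtain ⟨b1, b2, b3⟩ := hv2
  obtain ⟨e1, e2, e3, e4, e5, e6⟩ := partials_pullbackMetric hu hv
  simp only [MetricEquations, e1, e2, e3, e4, e5, e6, a1, a2, a3, b1, b2, b3, Pi.neg_apply]
  simp only [pullbackMetric, Matrix.cons_val_zero, Matrix.cons_val_one]
  refine ⟨?_, ?_, ?_, ?_, ?_, ?_⟩ <;> ring

/-- The Christoffel symbols of `du² + dv²`, given by derivatives of the metric, determine the second
derivatives of `u` and `v`. -/
theorem isAffineFunAt_of_metricEquations {Γ : Fin 2 → Fin 2 → Fin 2 → ℝ × ℝ → ℝ}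
    {u v : ℝ × ℝ → ℝ} {q : ℝ × ℝ} (hu : ContDiffAt ℝ ∞ u q) (hv : ContDiffAt ℝ ∞ v q)
    (hJ : dx u q * dy v q - dy u q * dx v q ≠ 0)
    (hM : MetricEquations (-Γ 0 0 0) (-Γ 0 0 1) (-Γ 0 1 1) (-Γ 1 0 0) (-Γ 1 0 1) (-Γ 1 1 1)
      (pullbackMetric u v 0 0) (pullbackMetric u v 0 1) (pullbackMetric u v 1 1) q) :
    IsAffineFunAt Γ u q ∧ IsAffineFunAt Γ v q := by
  obtain ⟨e1, e2, e3, e4, e5, e6⟩ := partials_pullbackMetric hu hv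
  simp only [MetricEquations, e1, e2, e3, e4, e5, e6, Pi.neg_apply] at hM
  simp only [pullbackMetric, Matrix.cons_val_zero, Matrix.cons_val_one] at hM
  obtain ⟨m1, m2, m3, m4, m5, m6⟩ := hM
  -- a vector orthogonal to both columns of the Jacobian matrix vanishes
  have key : ∀ x y : ℝ, dx u q * x + dx v q * y = 0 → dy u q * x + dy v q * y = 0 →
      x = 0 ∧ y = 0 := fun x y h1 h2 => by
    refine ⟨(mul_left_inj' hJ).1 ?_, (mul_left_inj' hJ).1 ?_⟩
    · linear_combination dy v q * h1 - dx v q * h2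
    · linear_combination dx u q * h2 - dy u q * h1
  obtain ⟨k1, k2⟩ := key (dx (dx u) q - (Γ 0 0 0 q * dx u q + Γ 1 0 0 q * dy u q))
    (dx (dx v) q - (Γ 0 0 0 q * dx v q + Γ 1 0 0 q * dy v q))
    (by linear_combination m1 / 2) (by linear_combination m2 - m4 / 2)
  obtain ⟨k3, k4⟩ := key (dy (dx u) q - (Γ 0 0 1 q * dx u q + Γ 1 0 1 q * dy u q))
    (dy (dx v) q - (Γ 0 0 1 q * dx v q + Γ 1 0 1 q * dy v q))
    (by linear_combination m4 / 2) (by linear_combination m3 / 2)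
  obtain ⟨k5, k6⟩ := key (dy (dy u) q - (Γ 0 1 1 q * dx u q + Γ 1 1 1 q * dy u q))
    (dy (dy v) q - (Γ 0 1 1 q * dx v q + Γ 1 1 1 q * dy v q))
    (by linear_combination m5 - m3 / 2) (by linear_combination m6 / 2)
  exact ⟨⟨sub_eq_zero.1 k1, sub_eq_zero.1 k3, sub_eq_zero.1 k5⟩,
    sub_eq_zero.1 k2, sub_eq_zero.1 k4, sub_eq_zero.1 k6⟩

theorem IsAffineChartNear.isAffineFunAt {Γ : Fin 2 → Fin 2 → Fin 2 → ℝ × ℝ → ℝ}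
    {φ : ℝ × ℝ → ℝ × ℝ} {q : ℝ × ℝ} (h : IsAffineChartNear (planeConn Γ) φ q)
    (hs : ∀ i j k, Γ i j k q = Γ i k j q) :
    IsAffineFunAt Γ (fun q => (φ q).1) q ∧ IsAffineFunAt Γ (fun q => (φ q).2) q := by
  have h1 : ∀ᶠ q' in 𝓝 q, ContDiffAt ℝ ∞ (fun q => (φ q).1) q' := h.mono fun q hq => hq.1.fst
  have h2 : ∀ᶠ q' in 𝓝 q, ContDiffAt ℝ ∞ (fun q => (φ q).2) q' := h.mono fun q hq => hq.1.snd
  have key : ∀ w, _ := fun w => by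
    have k1 := fderiv_fderiv_prodMk_apply h1 h2 w w
    have k2 := fderiv_prodMk_apply (h1.self_of_nhds.differentiableAt (by simp))
      (h2.self_of_nhds.differentiableAt (by simp)) (planeConn Γ q w w)
    exact Prod.ext_iff.1 (k1.symm.trans ((h.self_of_nhds.2.2.2.2 w w).trans k2))
  exact ⟨(isAffineFunAt_iff hs h1.self_of_nhds).2 fun w => (key w).1,
    (isAffineFunAt_iff hs h2.self_of_nhds).2 fun w => (key w).2⟩

end AffineFunctions

section MetricAlgebra

theorem posDef_fin_two_iff (g : Fin 2 → Fin 2 → ℝ) : (Matrix.of g).PosDef ↔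
    g 1 0 = g 0 1 ∧ 0 < g 0 0 ∧ 0 < g 0 0 * g 1 1 - g 0 1 ^ 2 := by
  constructor
  · intro h
    have h1 : g 1 0 = g 0 1 := by simpa using h.isHermitian.apply 0 1
    have h2 := h.det_pos
    rw [Matrix.det_fin_two] at h2
    simp only [Matrix.of_apply, h1] at h2
    refine ⟨h1, h.diag_pos (i := 0), ?_⟩
    linarith
  · rintro ⟨h1, h2, h3⟩
    refine Matrix.posDef_iff_dotProduct_mulVec.2 ⟨?_, fun x hx => ?_⟩
    · ext i j
      fin_cases i <;> fin_cases j <;> simp [h1]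
    · have e : star x ⬝ᵥ (Matrix.of g).mulVec x
          = g 0 0 * x 0 ^ 2 + 2 * g 0 1 * x 0 * x 1 + g 1 1 * x 1 ^ 2 := by
        simp [dotProduct, Matrix.mulVec, Fin.sum_univ_two, h1]
        ring
      rw [e]
      refine pos_of_mul_pos_right (a := g 0 0) ?_ h2.le
      have e2 : g 0 0 * (g 0 0 * x 0 ^ 2 + 2 * g 0 1 * x 0 * x 1 + g 1 1 * x 1 ^ 2)
          = (g 0 0 * x 0 + g 0 1 * x 1) ^ 2 + (g 0 0 * g 1 1 - g 0 1 ^ 2) * x 1 ^ 2 := by ring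
      rw [e2]
      by_cases hx1 : x 1 = 0
      · have hx0 : x 0 ≠ 0 := fun hx0 => hx (by ext i; fin_cases i <;> assumption)
        have := sq_pos_of_ne_zero (mul_ne_zero h2.ne' hx0)
        simpa [hx1] using this
      · have := mul_pos h3 (pow_pos (abs_pos.2 hx1) 2)
        rw [sq_abs] at this
        nlinarith [sq_nonneg (g 0 0 * x 0 + g 0 1 * x 1)]

theorem isMetricOn_iff {g : Fin 2 → Fin 2 → ℝ × ℝ → ℝ} {V : Set (ℝ × ℝ)} : IsMetricOn g V ↔
    (∀ i j, ContDiffOn ℝ ∞ (g i j) V) ∧ ∀ q ∈ V, g 1 0 q = g 0 1 q ∧ 0 < g 0 0 q ∧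
      0 < g 0 0 q * g 1 1 q - g 0 1 q ^ 2 :=
  and_congr_right fun _ => forall₂_congr fun q _ => posDef_fin_two_iff fun i j => g i j q

theorem christoffel_eq {g : Fin 2 → Fin 2 → ℝ × ℝ → ℝ} {q : ℝ × ℝ} (h1 : g 1 0 q = g 0 1 q)
    (j k : Fin 2) :
    christoffel g 0 j k q = 1 / 2 * ((g 1 1 q * (pd k (g j 0) q + pd j (g k 0) q - pd 0 (g j k) q)
      - g 0 1 q * (pd k (g j 1) q + pd j (g k 1) q - pd 1 (g j k) q))
        * (g 0 0 q * g 1 1 q - g 0 1 q ^ 2)⁻¹) ∧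
    christoffel g 1 j k q = 1 / 2 * ((g 0 0 q * (pd k (g j 1) q + pd j (g k 1) q - pd 1 (g j k) q)
      - g 0 1 q * (pd k (g j 0) q + pd j (g k 0) q - pd 0 (g j k) q))
        * (g 0 0 q * g 1 1 q - g 0 1 q ^ 2)⁻¹) := by
  simp only [christoffel, Fin.sum_univ_two, Matrix.inv_def, Matrix.adjugate_fin_two,
    Matrix.det_fin_two, Matrix.smul_apply, Matrix.of_apply, smul_eq_mul, h1, Ring.inverse_eq_inv',
    Matrix.cons_val_zero, Matrix.cons_val_one, Matrix.cons_val', Matrix.cons_val_fin_one]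
  constructor <;> ring

theorem IsMetricOn.pd_symm {g : Fin 2 → Fin 2 → ℝ × ℝ → ℝ} {V : Set (ℝ × ℝ)} (hV : IsOpen V)
    (h : IsMetricOn g V) {q : ℝ × ℝ} (hq : q ∈ V) (i j k : Fin 2) :
    pd k (g i j) q = pd k (g j i) q := by
  have h1 : g 1 0 =ᶠ[𝓝 q] g 0 1 :=
    Filter.eventually_of_mem (hV.mem_nhds hq) fun q hq => ((isMetricOn_iff.1 h).2 q hq).1
  have h2 : g i j =ᶠ[𝓝 q] g j i := by
    fin_cases i <;> fin_cases j
    · rfl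
    · exact h1.symm
    · exact h1
    · rfl
  rw [pd, h2.fderiv_eq, pd]

theorem IsMetricOn.isConnectionOn {g : Fin 2 → Fin 2 → ℝ × ℝ → ℝ} {V : Set (ℝ × ℝ)}
    (hV : IsOpen V) (h : IsMetricOn g V) : IsConnectionOn (christoffel g) V := by
  have hg := isMetricOn_iff.1 h
  constructor
  · intro i j k q hq
    refine ContDiffAt.contDiffWithinAt ?_
    have hs : ∀ i j, ContDiffAt ℝ ∞ (g i j) q := fun i j => (hg.1 i j).contDiffAt (hV.mem_nhds hq)
    have hp : ∀ k i j, ContDiffAt ℝ ∞ (pd k (g i j)) q := fun k i j =>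
      (hs i j).fderiv_smooth.clm_apply contDiffAt_const
    have hdet := ((((hs 0 0).mul (hs 1 1)).sub ((hs 0 1).pow 2)).inv (hg.2 q hq).2.2.ne')
    have hhalf : ContDiffAt ℝ ∞ (fun _ : ℝ × ℝ => (1 / 2 : ℝ)) q := contDiffAt_const
    have hT : ∀ m, ContDiffAt ℝ ∞ (fun q => pd k (g j m) q + pd j (g k m) q - pd m (g j k) q) q :=
      fun m => ((hp k j m).add (hp j k m)).sub (hp m j k)
    have hev : ∀ᶠ q in 𝓝 q, g 1 0 q = g 0 1 q :=
      Filter.eventually_of_mem (hV.mem_nhds hq) fun q hq => (hg.2 q hq).1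
    fin_cases i
    · exact (hhalf.mul ((((hs 1 1).mul (hT 0)).sub ((hs 0 1).mul (hT 1))).mul
        hdet)).congr_of_eventuallyEq (hev.mono fun q hq => (christoffel_eq hq j k).1)
    · exact (hhalf.mul ((((hs 0 0).mul (hT 1)).sub ((hs 0 1).mul (hT 0))).mul
        hdet)).congr_of_eventuallyEq (hev.mono fun q hq => (christoffel_eq hq j k).2)
  · intro i j k q hq
    simp only [christoffel]
    congr 1
    refine Finset.sum_congr rfl fun m _ => ?_
    rw [h.pd_symm hV hq j k m]
    ring

theorem half_mul_inv_eq {N D G : ℝ} (hD : D ≠ 0) (h : N = 2 * G * D) :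
    1 / 2 * (N * D⁻¹) = G := by
  rw [h, mul_assoc, mul_inv_cancel₀ hD]; ring

/-- A connection for which a metric is parallel is the Levi-Civita connection of this metric. -/
theorem IsMetricOn.christoffel_eq {g : Fin 2 → Fin 2 → ℝ × ℝ → ℝ} {V : Set (ℝ × ℝ)}
    (hV : IsOpen V) (h : IsMetricOn g V) {Γ : Fin 2 → Fin 2 → Fin 2 → ℝ × ℝ → ℝ} {q : ℝ × ℝ}
    (hq : q ∈ V) (hs : ∀ i j k, Γ i j k q = Γ i k j q)
    (hM : MetricEquations (-Γ 0 0 0) (-Γ 0 0 1) (-Γ 0 1 1) (-Γ 1 0 0) (-Γ 1 0 1) (-Γ 1 1 1)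
      (g 0 0) (g 0 1) (g 1 1) q) (i j k : Fin 2) : christoffel g i j k q = Γ i j k q := by
  obtain ⟨h1, -, h2⟩ := (isMetricOn_iff.1 h).2 q hq
  have hp := fun k => h.pd_symm hV hq 1 0 k
  obtain ⟨m1, m2, m3, m4, m5, m6⟩ := hM
  simp only [Pi.neg_apply] at m1 m2 m3 m4 m5 m6
  have e : ∀ j k, christoffel g 0 j k q = Γ 0 j k q ∧ christoffel g 1 j k q = Γ 1 j k q := by
    intro j k
    rw [(_root_.christoffel_eq h1 j k).1, (_root_.christoffel_eq h1 j k).2]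
    refine ⟨half_mul_inv_eq h2.ne' ?_, half_mul_inv_eq h2.ne' ?_⟩ <;> fin_cases j <;> fin_cases k <;>
      simp only [Fin.zero_eta, Fin.mk_one, Fin.isValue, hp, pd_zero, pd_one, m1, m2, m3, m4, m5, m6,
        hs 0 1 0, hs 1 1 0] <;>
      ring
  fin_cases i
  · exact (e j k).1
  · exact (e j k).2

end MetricAlgebra

/-! ### Isometric charts of flat metrics -/

section Isometry

theorem MetricEquations.congr {a b c d e f p q r p' q' r' : ℝ × ℝ → ℝ} {z : ℝ × ℝ}
    (h : MetricEquations a b c d e f p q r z) (hp : p =ᶠ[𝓝 z] p') (hq : q =ᶠ[𝓝 z] q')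
    (hr : r =ᶠ[𝓝 z] r') : MetricEquations a b c d e f p' q' r' z := by
  rw [MetricEquations, ← hp.dx_eq, ← hp.dy_eq, ← hq.dx_eq, ← hq.dy_eq, ← hr.dx_eq, ← hr.dy_eq,
    ← hp.self_of_nhds, ← hq.self_of_nhds, ← hr.self_of_nhds]
  exact h

theorem isometryEquations_iff {u v p q r : ℝ × ℝ → ℝ} {z : ℝ × ℝ} :
    IsometryEquations u v p q r z ↔ pullbackMetric u v 0 0 z = p z ∧
      pullbackMetric u v 0 1 z = q z ∧ pullbackMetric u v 1 1 z = r z := by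
  simp only [IsometryEquations, pullbackMetric, Matrix.cons_val_zero, Matrix.cons_val_one, sq]

/-- A solution of the linear metric equations is determined by its value at one point. -/
theorem MetricEquations.eventually_eq {a b c d e f p q r p' q' r' : ℝ × ℝ → ℝ} {z : ℝ × ℝ}
    (hc : ∀ k ∈ [a, b, c, d, e, f], ContinuousAt k z)
    (hd : ∀ᶠ w in 𝓝 z, ∀ k ∈ [p, q, r, p', q', r'], DifferentiableAt ℝ k w)
    (h : ∀ᶠ w in 𝓝 z, MetricEquations a b c d e f p q r w)
    (h' : ∀ᶠ w in 𝓝 z, MetricEquations a b c d e f p' q' r' w)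
    (hp : p z = p' z) (hq : q z = q' z) (hr : r z = r' z) :
    ∀ᶠ w in 𝓝 z, p w = p' w ∧ q w = q' w ∧ r w = r' w := by
  obtain ⟨M, hM⟩ : ∃ M : ℝ, ∀ᶠ w in 𝓝 z, ∀ k ∈ [a, b, c, d, e, f], |k w| ≤ M := by
    refine ⟨|a z| + |b z| + |c z| + |d z| + |e z| + |f z| + 1, ?_⟩
    have h0 : ∀ k ∈ [a, b, c, d, e, f], ∀ᶠ w in 𝓝 z, |k w| < |k z| + 1 := fun k hk =>
      (hc k hk).abs.eventually_lt_const (lt_add_one _)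
    simp only [List.mem_cons, List.not_mem_nil, or_false, forall_eq_or_imp, forall_eq] at h0 ⊢
    obtain ⟨h1, h2, h3, h4, h5, h6⟩ := h0
    filter_upwards [h1, h2, h3, h4, h5, h6] with w h1 h2 h3 h4 h5 h6
    have := abs_nonneg (a z); have := abs_nonneg (b z); have := abs_nonneg (c z)
    have := abs_nonneg (d z); have := abs_nonneg (e z); have := abs_nonneg (f z)
    refine ⟨?_, ?_, ?_, ?_, ?_, ?_⟩ <;> linarith
  obtain ⟨ρ, hρ, hball⟩ := Metric.eventually_nhds_iff_ball.1 ((hM.and hd).and (h.and h'))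
  let P : ℝ × ℝ → ℝ × ℝ × ℝ := fun w => (p w - p' w, q w - q' w, r w - r' w)
  have hP : ∀ w ∈ Metric.ball z ρ, ∀ k, fderiv ℝ P w k =
      (fderiv ℝ p w k - fderiv ℝ p' w k, fderiv ℝ q w k - fderiv ℝ q' w k,
        fderiv ℝ r w k - fderiv ℝ r' w k) ∧ DifferentiableAt ℝ P w := fun w hw k => by
    have h0 := (hball w hw).1.2
    simp only [List.mem_cons, List.not_mem_nil, or_false, forall_eq_or_imp, forall_eq] at h0
    obtain ⟨d1, d2, d3, d4, d5, d6⟩ := h0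
    have h2 : HasFDerivAt P _ w := (d1.hasFDerivAt.sub d4.hasFDerivAt).prodMk
      ((d2.hasFDerivAt.sub d5.hasFDerivAt).prodMk (d3.hasFDerivAt.sub d6.hasFDerivAt))
    exact ⟨by rw [h2.fderiv]; rfl, h2.differentiableAt⟩
  have hzero := eq_zero_of_norm_fderiv_le (P := P) (C := 8 * M) (fun w hw => (hP w hw 0).2) ?_
    (Metric.mem_ball_self hρ) (by simp [P, hp, hq, hr])
  · filter_upwards [Metric.ball_mem_nhds z hρ] with w hw
    have := hzero w hw
    simp only [P, Prod.mk_eq_zero, sub_eq_zero] at this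
    exact this
  intro w hw
  have h0 := (hball w hw).1.1
  simp only [List.mem_cons, List.not_mem_nil, or_false, forall_eq_or_imp, forall_eq] at h0
  obtain ⟨b1, b2, b3, b4, b5, b6⟩ := h0
  have hM0 : 0 ≤ M := (abs_nonneg _).trans b1
  set N := ‖P w‖ with hN
  have hN0 : 0 ≤ N := norm_nonneg _
  have n1 : |p w - p' w| ≤ N := norm_fst_le (P w)
  have n2 : |q w - q' w| ≤ N := (norm_fst_le (P w).2).trans (norm_snd_le (P w))
  have n3 : |r w - r' w| ≤ N := (norm_snd_le (P w).2).trans (norm_snd_le (P w))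
  have hmul : ∀ {x y : ℝ}, |x| ≤ M → |y| ≤ N → |x * y| ≤ M * N := fun hx hy => by
    rw [abs_mul]; exact mul_le_mul hx hy (abs_nonneg _) hM0
  have key : ∀ {s₁ s₂ : ℝ} {k : ℝ × ℝ}, |s₁| ≤ 4 * (M * N) → |s₂| ≤ 4 * (M * N) →
      |k.1 * s₁ + k.2 * s₂| ≤ 8 * M * N * ‖k‖ := fun {s₁ s₂ k} h1 h2 => by
    have e1 : |k.1| ≤ ‖k‖ := norm_fst_le k
    have e2 : |k.2| ≤ ‖k‖ := norm_snd_le k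
    calc |k.1 * s₁ + k.2 * s₂| ≤ |k.1| * |s₁| + |k.2| * |s₂| := by
          rw [← abs_mul, ← abs_mul]; exact abs_add_le _ _
      _ ≤ ‖k‖ * (4 * (M * N)) + ‖k‖ * (4 * (M * N)) := by gcongr
      _ = 8 * M * N * ‖k‖ := by ring
  obtain ⟨m1, m2, m3, m4, m5, m6⟩ := (hball w hw).2.1
  obtain ⟨m1', m2', m3', m4', m5', m6'⟩ := (hball w hw).2.2
  have ap := abs_le.1 (hmul b1 n1)
  have aq := abs_le.1 (hmul b1 n2)
  have bp := abs_le.1 (hmul b2 n1)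
  have bq := abs_le.1 (hmul b2 n2)
  have cp := abs_le.1 (hmul b3 n1)
  have cq := abs_le.1 (hmul b3 n2)
  have dq := abs_le.1 (hmul b4 n2)
  have dr := abs_le.1 (hmul b4 n3)
  have eq := abs_le.1 (hmul b5 n2)
  have er := abs_le.1 (hmul b5 n3)
  have fq := abs_le.1 (hmul b6 n2)
  have fr := abs_le.1 (hmul b6 n3)
  refine ContinuousLinearMap.opNorm_le_bound _ (by positivity) fun k => ?_
  rw [(hP w hw k).1]
  have e : ∀ x y z : ℝ, ‖(x, y, z)‖ = max |x| (max |y| |z|) := fun _ _ _ => rfl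
  rw [e]
  have hsplit : ∀ x y : ℝ × ℝ → ℝ, fderiv ℝ x w k - fderiv ℝ y w k
      = k.1 * (dx x w - dx y w) + k.2 * (dy x w - dy y w) := fun x y => by
    rw [fderiv_eq_dx_dy, fderiv_eq_dx_dy]; ring
  rw [hsplit, hsplit, hsplit, m1, m2, m3, m4, m5, m6, m1', m2', m3', m4', m5', m6']
  refine max_le (key ?_ ?_) (max_le (key ?_ ?_) (key ?_ ?_)) <;>
    exact abs_le.2 ⟨by linarith, by linarith⟩

theorem isMetricOn_pullbackMetric {u v : ℝ × ℝ → ℝ} {W : Set (ℝ × ℝ)}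
    (hu : ∀ q ∈ W, ContDiffAt ℝ ∞ u q) (hv : ∀ q ∈ W, ContDiffAt ℝ ∞ v q)
    (hJ : ∀ q ∈ W, dx u q * dy v q - dy u q * dx v q ≠ 0) :
    IsMetricOn (pullbackMetric u v) W := by
  refine isMetricOn_iff.2 ⟨fun i j q hq => ?_, fun q hq => ⟨?_, ?_, ?_⟩⟩
  · have h1 : ∀ i, ContDiffAt ℝ ∞ ((![dx u, dy u] : Fin 2 → ℝ × ℝ → ℝ) i) q := fun i => by
      fin_cases i
      · exact (hu q hq).dx_smooth
      · exact (hu q hq).dy_smooth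
    have h2 : ∀ i, ContDiffAt ℝ ∞ ((![dx v, dy v] : Fin 2 → ℝ × ℝ → ℝ) i) q := fun i => by
      fin_cases i
      · exact (hv q hq).dx_smooth
      · exact (hv q hq).dy_smooth
    exact (((h1 i).mul (h1 j)).add ((h2 i).mul (h2 j))).contDiffWithinAt
  · simp only [pullbackMetric, Matrix.cons_val_zero, Matrix.cons_val_one]
    ring
  · simp only [pullbackMetric, Matrix.cons_val_zero]
    by_contra h0
    have h1 : dx u q = 0 := by nlinarith [mul_self_nonneg (dx u q), mul_self_nonneg (dx v q)]
    have h2 : dx v q = 0 := by nlinarith [mul_self_nonneg (dx u q), mul_self_nonneg (dx v q)]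
    exact hJ q hq (by rw [h1, h2]; ring)
  · have h1 := sq_pos_of_ne_zero (hJ q hq)
    simp only [pullbackMetric, Matrix.cons_val_zero, Matrix.cons_val_one]
    linarith

/-- A flat connection has, near each point, a pair of affine functions with prescribed first
derivatives at this point. -/
theorem IsConnectionOn.exists_affine_functions {Γ : Fin 2 → Fin 2 → Fin 2 → ℝ × ℝ → ℝ}
    {V : Set (ℝ × ℝ)} (h : IsConnectionOn Γ V) (hV : IsOpen V) (h0 : ∀ q ∈ V, RiemannZero Γ q)
    {z : ℝ × ℝ} (hz : z ∈ V) {a b c d : ℝ} (hJ : a * d - b * c ≠ 0) :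
    ∃ W ⊆ V, IsOpen W ∧ z ∈ W ∧ ∃ u v : ℝ × ℝ → ℝ,
      (dx u z = a ∧ dy u z = b ∧ dx v z = c ∧ dy v z = d) ∧
      ∀ q ∈ W, ContDiffAt ℝ ∞ u q ∧ ContDiffAt ℝ ∞ v q ∧
        dx u q * dy v q - dy u q * dx v q ≠ 0 ∧ IsAffineFunAt Γ u q ∧ IsAffineFunAt Γ v q := by
  let L : ℝ → ℝ → (ℝ × ℝ) →L[ℝ] ℝ := fun a b =>
    a • ContinuousLinearMap.fst ℝ ℝ ℝ + b • ContinuousLinearMap.snd ℝ ℝ ℝ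
  have hLx : ∀ a b, dx (L a b) z = a := fun a b => by
    rw [dx, ContinuousLinearMap.fderiv]; simp [L]
  have hLy : ∀ a b, dy (L a b) z = b := fun a b => by
    rw [dy, ContinuousLinearMap.fderiv]; simp [L]
  have hT := isInvertible_fderiv_prodMk (u := L a b) (v := L c d) (q := z)
    (L a b).differentiableAt (L c d).differentiableAt (by rw [hLx, hLx, hLy, hLy]; exact hJ)
  obtain ⟨φ, hφz, hφ⟩ := h.exists_affine_chart hV h0 hz hT
  obtain ⟨W, hW, hWo, hzW⟩ := eventually_nhds_iff.1 (hφ.eventually.and (hV.mem_nhds hz))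
  have hd : ∀ q ∈ W, ContDiffAt ℝ ∞ (fun q => (φ q).1) q ∧ ContDiffAt ℝ ∞ (fun q => (φ q).2) q :=
    fun q hq => ⟨(hW q hq).1.self_of_nhds.1.fst, (hW q hq).1.self_of_nhds.1.snd⟩
  refine ⟨W, fun q hq => (hW q hq).2, hWo, hzW, fun q => (φ q).1, fun q => (φ q).2, ?_,
    fun q hq => ⟨(hd q hq).1, (hd q hq).2, ?_,
      (hW q hq).1.isAffineFunAt fun i j k => h.2 i j k q (hW q hq).2⟩⟩
  · have e1 : ∀ w, (fderiv ℝ (fun q => (φ q).1) z w, fderiv ℝ (fun q => (φ q).2) z w)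
        = (fderiv ℝ (L a b) z w, fderiv ℝ (L c d) z w) := fun w => by
      rw [← fderiv_prodMk_apply (L a b).differentiableAt (L c d).differentiableAt, ← hφz]
      exact (fderiv_prodMk_apply ((hd z hzW).1.differentiableAt (by simp))
        ((hd z hzW).2.differentiableAt (by simp)) w).symm
    have e2 := Prod.ext_iff.1 (e1 (1, 0))
    have e3 := Prod.ext_iff.1 (e1 (0, 1))
    exact ⟨e2.1.trans (hLx a b), e3.1.trans (hLy a b), e2.2.trans (hLx c d),
      e3.2.trans (hLy c d)⟩
  · exact jacobian_ne_zero ((hd q hq).1.differentiableAt (by simp))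
      ((hd q hq).2.differentiableAt (by simp)) (hW q hq).1.self_of_nhds.2.2.2.1

theorem IsConnectionOn.exists_metric {Γ : Fin 2 → Fin 2 → Fin 2 → ℝ × ℝ → ℝ}
    {V : Set (ℝ × ℝ)} (h : IsConnectionOn Γ V) (hV : IsOpen V) (h0 : ∀ q ∈ V, RiemannZero Γ q)
    {z : ℝ × ℝ} (hz : z ∈ V) :
    ∃ W ⊆ V, IsOpen W ∧ z ∈ W ∧ ∃ g, IsMetricOn g W ∧
      ∀ q ∈ W, MetricEquations (-Γ 0 0 0) (-Γ 0 0 1) (-Γ 0 1 1)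
        (-Γ 1 0 0) (-Γ 1 0 1) (-Γ 1 1 1) (g 0 0) (g 0 1) (g 1 1) q := by
  obtain ⟨W, hWV, hWo, hzW, u, v, -, huv⟩ := h.exists_affine_functions hV h0 hz (a := 1) (b := 0)
    (c := 0) (d := 1) (by norm_num)
  exact ⟨W, hWV, hWo, hzW, pullbackMetric u v, isMetricOn_pullbackMetric (fun q hq => (huv q hq).1)
    (fun q hq => (huv q hq).2.1) fun q hq => (huv q hq).2.2.1, fun q hq =>
    metricEquations_pullbackMetric (huv q hq).1 (huv q hq).2.1 (huv q hq).2.2.2.1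
      (huv q hq).2.2.2.2⟩

/-- An affine chart whose derivative at one point is an isometry is an isometry, since the metric
and the pulled back Euclidean metric are both parallel. -/
theorem IsConnectionOn.exists_isometry {Γ : Fin 2 → Fin 2 → Fin 2 → ℝ × ℝ → ℝ}
    {V : Set (ℝ × ℝ)} (h : IsConnectionOn Γ V) (hV : IsOpen V) (h0 : ∀ q ∈ V, RiemannZero Γ q)
    {W : Set (ℝ × ℝ)} (hWV : W ⊆ V) (hW : IsOpen W) {g : Fin 2 → Fin 2 → ℝ × ℝ → ℝ}
    (hg : IsMetricOn g W)
    (hM : ∀ q ∈ W, MetricEquations (-Γ 0 0 0) (-Γ 0 0 1) (-Γ 0 1 1)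
      (-Γ 1 0 0) (-Γ 1 0 1) (-Γ 1 1 1) (g 0 0) (g 0 1) (g 1 1) q) {z : ℝ × ℝ} (hz : z ∈ W) :
    ∃ W' ⊆ W, IsOpen W' ∧ z ∈ W' ∧ ∃ u v, ContDiffOn ℝ ∞ u W' ∧ ContDiffOn ℝ ∞ v W' ∧
      ∀ q ∈ W', IsometryEquations u v (g 0 0) (g 0 1) (g 1 1) q := by
  obtain ⟨-, g1, g2⟩ := (isMetricOn_iff.1 hg).2 z hz
  -- the Cholesky factor of the metric at `z`
  set a := Real.sqrt (g 0 0 z) with ha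
  have ha0 : 0 < a := Real.sqrt_pos.2 g1
  have haa : a * a = g 0 0 z := Real.mul_self_sqrt g1.le
  set b := g 0 1 z / a with hb
  have hab : a * b = g 0 1 z := by rw [hb]; field_simp
  have hpos : 0 < g 1 1 z - b * b := by
    have e : g 0 0 z * (g 1 1 z - b * b) = g 0 0 z * g 1 1 z - g 0 1 z ^ 2 := by
      rw [← hab, ← haa]; ring
    rw [← e] at g2
    exact pos_of_mul_pos_right g2 g1.le
  set d := Real.sqrt (g 1 1 z - b * b) with hd
  have hd0 : 0 < d := Real.sqrt_pos.2 hpos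
  have hdd : d * d = g 1 1 z - b * b := Real.mul_self_sqrt hpos.le
  obtain ⟨W₁, hW₁V, hW₁o, hzW₁, u, v, ⟨u1, u2, v1, v2⟩, huv⟩ :=
    h.exists_affine_functions hV h0 (hWV hz) (a := a) (b := b) (c := 0) (d := d)
      (by rw [mul_zero, sub_zero]; exact (mul_pos ha0 hd0).ne')
  have hsm := (isMetricOn_pullbackMetric (fun q hq => (huv q hq).1)
    (fun q hq => (huv q hq).2.1) fun q hq => (huv q hq).2.2.1).1
  have hev := MetricEquations.eventually_eq (z := z) (a := -Γ 0 0 0) (b := -Γ 0 0 1)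
    (c := -Γ 0 1 1) (d := -Γ 1 0 0) (e := -Γ 1 0 1) (f := -Γ 1 1 1)
    (p := pullbackMetric u v 0 0) (q := pullbackMetric u v 0 1) (r := pullbackMetric u v 1 1)
    (p' := g 0 0) (q' := g 0 1) (r' := g 1 1) (by
      have hc : ∀ i j k, ContinuousAt (-Γ i j k) z := fun i j k =>
        (h.contDiffAt hV (hWV hz) i j k).continuousAt.neg
      simp only [List.mem_cons, List.not_mem_nil, or_false, forall_eq_or_imp, forall_eq]
      exact ⟨hc _ _ _, hc _ _ _, hc _ _ _, hc _ _ _, hc _ _ _, hc _ _ _⟩) (by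
      filter_upwards [hW.mem_nhds hz, hW₁o.mem_nhds hzW₁] with q hq hq1
      have d1 : ∀ i j, DifferentiableAt ℝ (g i j) q := fun i j =>
        ((hg.1 i j).contDiffAt (hW.mem_nhds hq)).differentiableAt (by simp)
      have d2 : ∀ i j, DifferentiableAt ℝ (pullbackMetric u v i j) q := fun i j =>
        ((hsm i j).contDiffAt (hW₁o.mem_nhds hq1)).differentiableAt (by simp)
      simp only [List.mem_cons, List.not_mem_nil, or_false, forall_eq_or_imp, forall_eq]
      exact ⟨d2 _ _, d2 _ _, d2 _ _, d1 _ _, d1 _ _, d1 _ _⟩)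
    (Filter.eventually_of_mem (hW₁o.mem_nhds hzW₁) fun q hq =>
      metricEquations_pullbackMetric (huv q hq).1 (huv q hq).2.1 (huv q hq).2.2.2.1
        (huv q hq).2.2.2.2)
    (Filter.eventually_of_mem (hW.mem_nhds hz) hM)
    (by simp [pullbackMetric, u1, v1, haa]) (by simp [pullbackMetric, u1, u2, v1, hab])
    (by simp [pullbackMetric, u2, v2, hdd])
  obtain ⟨W', hW', hW'o, hzW'⟩ := eventually_nhds_iff.1
    (hev.and ((hW.eventually_mem hz).and (hW₁o.eventually_mem hzW₁)))
  exact ⟨W', fun q hq => (hW' q hq).2.1, hW'o, hzW', u, v,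
    fun q hq => (huv q (hW' q hq).2.2).1.contDiffWithinAt,
    fun q hq => (huv q (hW' q hq).2.2).2.1.contDiffWithinAt,
    fun q hq => isometryEquations_iff.2 (hW' q hq).1⟩

theorem linearizes_of_isometry {E : Fin 4 → ℝ × ℝ → ℝ} {Γ : Fin 2 → Fin 2 → Fin 2 → ℝ × ℝ → ℝ}
    {V : Set (ℝ × ℝ)} (h : IsConnectionOn Γ V) (hE : ProjectsTo Γ E V)
    {W : Set (ℝ × ℝ)} (hWV : W ⊆ V) (hW : IsOpen W) {g : Fin 2 → Fin 2 → ℝ × ℝ → ℝ}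
    (hg : ∀ q ∈ W, 0 < g 0 0 q * g 1 1 q - g 0 1 q ^ 2)
    (hM : ∀ q ∈ W, MetricEquations (-Γ 0 0 0) (-Γ 0 0 1) (-Γ 0 1 1)
      (-Γ 1 0 0) (-Γ 1 0 1) (-Γ 1 1 1) (g 0 0) (g 0 1) (g 1 1) q)
    {u v : ℝ × ℝ → ℝ} (hu : ContDiffOn ℝ ∞ u W) (hv : ContDiffOn ℝ ∞ v W)
    (huv : ∀ q ∈ W, IsometryEquations u v (g 0 0) (g 0 1) (g 1 1) q) :
    Linearizes E W u v 0 0 0 := by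
  have hu' : ∀ q ∈ W, ContDiffAt ℝ ∞ u q := fun q hq => hu.contDiffAt (hW.mem_nhds hq)
  have hv' : ∀ q ∈ W, ContDiffAt ℝ ∞ v q := fun q hq => hv.contDiffAt (hW.mem_nhds hq)
  have hiso := fun q hq => isometryEquations_iff.1 (huv q hq)
  have hJ : ∀ q ∈ W, dx u q * dy v q - dy u q * dx v q ≠ 0 := fun q hq h0 => by
    have h1 := hg q hq
    obtain ⟨i1, i2, i3⟩ := hiso q hq
    simp only [pullbackMetric, Matrix.cons_val_zero, Matrix.cons_val_one] at i1 i2 i3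
    rw [← i1, ← i2, ← i3] at h1
    have h2 : (dx u q * dy v q - dy u q * dx v q) ^ 2 = 0 := by rw [h0]; ring
    linarith
  have haff : ∀ q ∈ W, IsAffineFunAt Γ u q ∧ IsAffineFunAt Γ v q := fun q hq =>
    isAffineFunAt_of_metricEquations (hu' q hq) (hv' q hq) (hJ q hq) <| (hM q hq).congr
      (Filter.eventually_of_mem (hW.mem_nhds hq) fun q hq => (hiso q hq).1.symm)
      (Filter.eventually_of_mem (hW.mem_nhds hq) fun q hq => (hiso q hq).2.1.symm)
      (Filter.eventually_of_mem (hW.mem_nhds hq) fun q hq => (hiso q hq).2.2.symm)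
  have hs : ∀ q ∈ W, ∀ i j k, Γ i j k q = Γ i k j q := fun q hq i j k => h.2 i j k q (hWV hq)
  exact linearizes_of_affine hW (fun q hq p => hE.cubicRHS_eq h.2 (hWV hq) p) hu hv hJ
    (fun q hq => (isAffineFunAt_iff (hs q hq) (hu' q hq)).1 (haff q hq).1)
    fun q hq => (isAffineFunAt_iff (hs q hq) (hv' q hq)).1 (haff q hq).2

theorem RiemannZero.congr {Γ Γ' : Fin 2 → Fin 2 → Fin 2 → ℝ × ℝ → ℝ} {q : ℝ × ℝ}
    (h : RiemannZero Γ q) (hΓ : ∀ i j k, Γ i j k =ᶠ[𝓝 q] Γ' i j k) : RiemannZero Γ' q := by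
  intro i j k l
  have h1 := h i j k l
  have e : ∀ i j k m, pd m (Γ i j k) q = pd m (Γ' i j k) q := fun i j k m => by
    rw [pd, (hΓ i j k).fderiv_eq, pd]
  simp only [riemann, e, fun i j k => (hΓ i j k).self_of_nhds] at h1
  exact h1

theorem ProjectsTo.congr {Γ Γ' : Fin 2 → Fin 2 → Fin 2 → ℝ × ℝ → ℝ} {E : Fin 4 → ℝ × ℝ → ℝ}
    {V : Set (ℝ × ℝ)} (h : ProjectsTo Γ E V) (hΓ : ∀ q ∈ V, ∀ i j k, Γ i j k q = Γ' i j k q) :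
    ProjectsTo Γ' E V := by
  intro q hq s w hw
  have h1 := h q hq s w hw
  simp only [geodesicRHS, hΓ q hq] at h1 ⊢
  exact h1

/-- A flat connection is locally the Levi-Civita connection of a metric. -/
theorem exists_flat_metric {E : Fin 4 → ℝ × ℝ → ℝ} {V : Set (ℝ × ℝ)} (hV : IsOpen V)
    {Γ : Fin 2 → Fin 2 → Fin 2 → ℝ × ℝ → ℝ} (hΓ : IsConnectionOn Γ V) (hE : ProjectsTo Γ E V)
    (h0 : ∀ q ∈ V, RiemannZero Γ q) {z : ℝ × ℝ} (hz : z ∈ V) :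
    ∃ W ⊆ V, IsOpen W ∧ z ∈ W ∧ ∃ g, IsMetricOn g W ∧ ProjectsTo (christoffel g) E W ∧
      ∀ q ∈ W, RiemannZero (christoffel g) q := by
  obtain ⟨W, hWV, hW, hzW, g, hg, hM⟩ := hΓ.exists_metric hV h0 hz
  have he : ∀ q ∈ W, ∀ i j k, Γ i j k q = christoffel g i j k q := fun q hq i j k =>
    (hg.christoffel_eq hW hq (fun i j k => hΓ.2 i j k q (hWV hq)) (hM q hq) i j k).symm
  refine ⟨W, hWV, hW, hzW, g, hg, ProjectsTo.congr (fun q hq => hE q (hWV hq)) he, fun q hq =>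
    (h0 q (hWV hq)).congr fun i j k => ?_⟩
  exact Filter.eventually_of_mem (hW.mem_nhds hq) fun q hq => he q hq i j k

end Isometry

/-! ### Linear systems for the Hessian of a function of two variables -/

section HessianSystem

/-- The coefficients of the total differential equation `dτ = λ dx + μ dy`,
`λ_x = c₀ λ + c₁ μ + c₂ τ`, `λ_y = μ_x = c₃ λ + c₄ μ + c₅ τ`, `μ_y = c₆ λ + c₇ μ + c₈ τ` for
`(τ, λ, μ)`. -/
def hessianSystem (c : Fin 9 → ℝ × ℝ → ℝ) (q : ℝ × ℝ) :
    (ℝ × ℝ) →L[ℝ] (ℝ × ℝ × ℝ) →L[ℝ] (ℝ × ℝ × ℝ) :=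
  let π : Fin 3 → (ℝ × ℝ × ℝ) →L[ℝ] ℝ := ![
    ContinuousLinearMap.fst ℝ ℝ ℝ ∘L ContinuousLinearMap.snd ℝ ℝ (ℝ × ℝ),
    ContinuousLinearMap.snd ℝ ℝ ℝ ∘L ContinuousLinearMap.snd ℝ ℝ (ℝ × ℝ),
    ContinuousLinearMap.fst ℝ ℝ (ℝ × ℝ)]
  let X := ContinuousLinearMap.fst ℝ ℝ ℝ
  let Y := ContinuousLinearMap.snd ℝ ℝ ℝ
  let xx : Fin 3 → _ := fun i => X.smulRight ((π i).smulRight ((0 : ℝ), (1 : ℝ), (0 : ℝ)))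
  let xy : Fin 3 → _ := fun i => X.smulRight ((π i).smulRight ((0 : ℝ), (0 : ℝ), (1 : ℝ)))
    + Y.smulRight ((π i).smulRight ((0 : ℝ), (1 : ℝ), (0 : ℝ)))
  let yy : Fin 3 → _ := fun i => Y.smulRight ((π i).smulRight ((0 : ℝ), (0 : ℝ), (1 : ℝ)))
  X.smulRight ((π 0).smulRight ((1 : ℝ), (0 : ℝ), (0 : ℝ)))
    + Y.smulRight ((π 1).smulRight ((1 : ℝ), (0 : ℝ), (0 : ℝ)))
    + ∑ i : Fin 9, c i q •
      (![xx 0, xx 1, xx 2, xy 0, xy 1, xy 2, yy 0, yy 1, yy 2] : Fin 9 → _) i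

theorem hessianSystem_apply (c : Fin 9 → ℝ × ℝ → ℝ) (q h : ℝ × ℝ) (g : ℝ × ℝ × ℝ) :
    hessianSystem c q h g = (h.1 * g.2.1 + h.2 * g.2.2,
      h.1 * (c 0 q * g.2.1 + c 1 q * g.2.2 + c 2 q * g.1)
        + h.2 * (c 3 q * g.2.1 + c 4 q * g.2.2 + c 5 q * g.1),
      h.1 * (c 3 q * g.2.1 + c 4 q * g.2.2 + c 5 q * g.1)
        + h.2 * (c 6 q * g.2.1 + c 7 q * g.2.2 + c 8 q * g.1)) := by
  ext
  · simp [hessianSystem, Fin.sum_univ_succ]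
  · simp [hessianSystem, Fin.sum_univ_succ]
    ring
  · simp [hessianSystem, Fin.sum_univ_succ]
    ring

theorem contDiffAt_hessianSystem {c : Fin 9 → ℝ × ℝ → ℝ} {q : ℝ × ℝ}
    (hc : ∀ i, ContDiffAt ℝ ∞ (c i) q) : ContDiffAt ℝ ∞ (hessianSystem c) q :=
  contDiffAt_const.add (ContDiffAt.sum (s := Finset.univ) fun i _ =>
    (hc i).smul contDiffAt_const)

theorem fderiv_hessianSystem_apply {c : Fin 9 → ℝ × ℝ → ℝ} {q : ℝ × ℝ}
    (hc : ∀ i, DifferentiableAt ℝ (c i) q) (k h : ℝ × ℝ) (g : ℝ × ℝ × ℝ) :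
    fderiv ℝ (hessianSystem c) q k h g = hessianSystem (fun i q => fderiv ℝ (c i) q k) q h g
      - hessianSystem 0 q h g := by
  have h1 : HasFDerivAt (hessianSystem c) _ q :=
    (HasFDerivAt.fun_sum (u := Finset.univ) fun i _ =>
      (hc i).hasFDerivAt.smul_const _).const_add _
  rw [h1.fderiv]
  simp only [hessianSystem, add_apply, sum_apply, smul_apply,
    ContinuousLinearMap.smulRight_apply]
  simp

/-- The system is solvable if mixed third derivatives agree, that is, if the coefficients of
`λ`, `μ` and `τ` in `(λ_x)_y - (λ_y)_x` and in `(μ_x)_y - (μ_y)_x` vanish. -/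
theorem exists_hessianSystem_solution {c : Fin 9 → ℝ × ℝ → ℝ} {z : ℝ × ℝ}
    (hc : ∀ᶠ q in 𝓝 z, ∀ i, ContDiffAt ℝ ∞ (c i) q)
    (h : ∀ᶠ q in 𝓝 z,
      dy (c 0) q + c 0 q * c 3 q + c 1 q * c 6 q
        = dx (c 3) q + c 3 q * c 0 q + c 4 q * c 3 q + c 5 q ∧
      dy (c 1) q + c 0 q * c 4 q + c 1 q * c 7 q + c 2 q
        = dx (c 4) q + c 3 q * c 1 q + c 4 q * c 4 q ∧
      dy (c 2) q + c 0 q * c 5 q + c 1 q * c 8 q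
        = dx (c 5) q + c 3 q * c 2 q + c 4 q * c 5 q ∧
      dy (c 3) q + c 3 q * c 3 q + c 4 q * c 6 q
        = dx (c 6) q + c 6 q * c 0 q + c 7 q * c 3 q + c 8 q ∧
      dy (c 4) q + c 3 q * c 4 q + c 4 q * c 7 q + c 5 q
        = dx (c 7) q + c 6 q * c 1 q + c 7 q * c 4 q ∧
      dy (c 5) q + c 3 q * c 5 q + c 4 q * c 8 q
        = dx (c 8) q + c 6 q * c 2 q + c 7 q * c 5 q) :
    ∃ t l m : ℝ × ℝ → ℝ, t z = 1 ∧ ∀ᶠ q in 𝓝 z,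
      (ContDiffAt ℝ ∞ t q ∧ ContDiffAt ℝ ∞ l q ∧ ContDiffAt ℝ ∞ m q) ∧
      (dx t q = l q ∧ dy t q = m q) ∧
      dx l q = c 0 q * l q + c 1 q * m q + c 2 q * t q ∧
      dy l q = c 3 q * l q + c 4 q * m q + c 5 q * t q ∧
      dx m q = c 3 q * l q + c 4 q * m q + c 5 q * t q ∧
      dy m q = c 6 q * l q + c 7 q * m q + c 8 q * t q := by
  obtain ⟨u, hu0, hu⟩ := exists_total_solution (A := hessianSystem c) (z := z)
    (hc.mono fun _ h => contDiffAt_hessianSystem h) (by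
      filter_upwards [hc, h] with q hq ⟨h1, h2, h3, h4, h5, h6⟩ k k'
      refine ContinuousLinearMap.ext fun g => ?_
      have hd := fun i => (hq i).differentiableAt (n := ∞) (by simp)
      simp only [add_apply, ContinuousLinearMap.comp_apply, fderiv_hessianSystem_apply hd,
        hessianSystem_apply, fderiv_eq_dx_dy, Pi.zero_apply]
      refine Prod.ext ?_ (Prod.ext ?_ ?_)
      · simp; ring
      · simp
        linear_combination (k.1 * k'.2 - k.2 * k'.1) * (g.2.1 * h1 + g.2.2 * h2 + g.1 * h3)
      · simp
        linear_combination (k.1 * k'.2 - k.2 * k'.1) * (g.2.1 * h4 + g.2.2 * h5 + g.1 * h6))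
    (1, 0, 0)
  refine ⟨fun q => (u q).1, fun q => (u q).2.1, fun q => (u q).2.2, congrArg Prod.fst hu0, ?_⟩
  filter_upwards [hu] with q hq
  have h1 : HasFDerivAt (fun q => (u q).1) _ q := hq.2.fst
  have h2 : HasFDerivAt (fun q => (u q).2.1) _ q := hq.2.snd.fst
  have h3 : HasFDerivAt (fun q => (u q).2.2) _ q := hq.2.snd.snd
  refine ⟨⟨hq.1.fst, hq.1.snd.fst, hq.1.snd.snd⟩, ?_⟩
  rw [h1.dx_eq, h1.dy_eq, h2.dx_eq, h2.dy_eq, h3.dx_eq, h3.dy_eq]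
  simp [hessianSystem_apply]

end HessianSystem

/-! ### The relative invariants of the cubic equation -/

section Invariants

variable {R : Type*} [CommRing R] (X Y : Derivation ℤ R R)

/-- The components `11`, `12`, `22` of `-9` times the Ricci tensor of the trace-free connection that
projects to the cubic equation with coefficients `E₀, …, E₃`, where `X` and `Y` stand for the
derivations `∂/∂x` and `∂/∂y` of a ring of functions. -/
def ricci (E : Fin 4 → R) : Fin 3 → R := ![
  3 * X (E 1) - 9 * Y (E 0) + 2 * E 1 * E 1 - 6 * E 0 * E 2,
  3 * X (E 2) - 3 * Y (E 1) + E 1 * E 2 - 9 * E 0 * E 3,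
  9 * X (E 3) - 3 * Y (E 2) + 2 * E 2 * E 2 - 6 * E 1 * E 3]

/-- The linearization of `ricci` at `E` in the direction `D`. -/
def ricciDeriv (E D : Fin 4 → R) : Fin 3 → R := ![
  3 * X (D 1) - 9 * Y (D 0) + 4 * E 1 * D 1 - 6 * (D 0 * E 2 + E 0 * D 2),
  3 * X (D 2) - 3 * Y (D 1) + D 1 * E 2 + E 1 * D 2 - 9 * (D 0 * E 3 + E 0 * D 3),
  9 * X (D 3) - 3 * Y (D 2) + 4 * E 2 * D 2 - 6 * (D 1 * E 3 + E 1 * D 3)]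

/-- The two components, up to sign, of three times the antisymmetrized covariant derivative of
`ricci`: the relative invariants of the cubic equation under point transformations. -/
def cotton (E : Fin 4 → R) : Fin 2 → R := ![
  3 * Y (ricci X Y E 0) - 3 * X (ricci X Y E 1) - 2 * E 1 * ricci X Y E 1
    + 3 * E 0 * ricci X Y E 2 + E 2 * ricci X Y E 0,
  3 * X (ricci X Y E 2) - 3 * Y (ricci X Y E 1) + 2 * E 2 * ricci X Y E 1
    - 3 * E 3 * ricci X Y E 0 - E 1 * ricci X Y E 2]

/-- The linearization of `cotton` at `E` in the direction `D`. -/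
def cottonDeriv (E D : Fin 4 → R) : Fin 2 → R := ![
  3 * Y (ricciDeriv X Y E D 0) - 3 * X (ricciDeriv X Y E D 1)
    - 2 * (D 1 * ricci X Y E 1 + E 1 * ricciDeriv X Y E D 1)
    + 3 * (D 0 * ricci X Y E 2 + E 0 * ricciDeriv X Y E D 2)
    + (D 2 * ricci X Y E 0 + E 2 * ricciDeriv X Y E D 0),
  3 * X (ricciDeriv X Y E D 2) - 3 * Y (ricciDeriv X Y E D 1)
    + 2 * (D 2 * ricci X Y E 1 + E 2 * ricciDeriv X Y E D 1)
    - 3 * (D 3 * ricci X Y E 0 + E 3 * ricciDeriv X Y E D 0)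
    - (D 1 * ricci X Y E 2 + E 1 * ricciDeriv X Y E D 2)]

/-- The variation of the coefficients of the cubic equation under the infinitesimal point
transformation `ξ ∂/∂x + η ∂/∂y`. -/
def coeffVariation (E : Fin 4 → R) (ξ η : R) : Fin 4 → R := ![
  X (X η) + ξ * X (E 0) + η * Y (E 0) + 2 * X ξ * E 0 - Y η * E 0 + X η * E 1,
  2 * X (Y η) - X (X ξ) + ξ * X (E 1) + η * Y (E 1) + X ξ * E 1 + 3 * Y ξ * E 0 + 2 * X η * E 2,
  Y (Y η) - 2 * X (Y ξ) + ξ * X (E 2) + η * Y (E 2) + Y η * E 2 + 2 * Y ξ * E 1 + 3 * X η * E 3,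
  -Y (Y ξ) + ξ * X (E 3) + η * Y (E 3) + 2 * Y η * E 3 - X ξ * E 3 + Y ξ * E 2]

/-- Infinitesimal invariance of `cotton`: its variation under an infinitesimal point transformation
is its Lie derivative as a density of weight one with values in covectors, up to the sign of the
second component. In particular, the variation is linear in `cotton` and its derivatives. -/
theorem cottonDeriv_coeffVariation (hXY : ∀ a, Y (X a) = X (Y a)) (E : Fin 4 → R) (ξ η : R) :
    cottonDeriv X Y E (coeffVariation X Y E ξ η) 0 = ξ * X (cotton X Y E 0)
      + η * Y (cotton X Y E 0) + (2 * X ξ + Y η) * cotton X Y E 0 - X η * cotton X Y E 1 ∧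
    cottonDeriv X Y E (coeffVariation X Y E ξ η) 1 = ξ * X (cotton X Y E 1)
      + η * Y (cotton X Y E 1) + (X ξ + 2 * Y η) * cotton X Y E 1 - Y ξ * cotton X Y E 0 := by
  have hn : ∀ (D : Derivation ℤ R R) (n : ℕ) [n.AtLeastTwo], D (OfNat.ofNat n : R) = 0 :=
    fun D n _ => D.map_natCast n
  simp only [cotton, cottonDeriv, ricci, ricciDeriv, coeffVariation, Matrix.cons_val_zero,
    Matrix.cons_val_one, Matrix.cons_val, map_add, map_sub, map_neg, Derivation.leibniz,
    smul_eq_mul, hn, mul_zero, add_zero, hXY]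
  constructor
  · ring
  · ring

end Invariants

/-! ### The differential ring of germs of smooth functions -/

section GermRing

/-- The ring of germs at `z` of real functions that are smooth near `z`. With the partial derivatives
as derivations it is a differential ring, to which identities between differential polynomials
apply. -/
def smoothGerms (z : ℝ × ℝ) : Subring (Filter.Germ (𝓝 z) ℝ) where
  carrier := {φ | ∃ f : ℝ × ℝ → ℝ, (∀ᶠ q in 𝓝 z, ContDiffAt ℝ ∞ f q) ∧
    (f : Filter.Germ (𝓝 z) ℝ) = φ}
  zero_mem' := ⟨0, Filter.Eventually.of_forall fun _ => contDiffAt_const, rfl⟩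
  one_mem' := ⟨1, Filter.Eventually.of_forall fun _ => contDiffAt_const, rfl⟩
  add_mem' := by
    rintro _ _ ⟨f, hf, rfl⟩ ⟨g, hg, rfl⟩
    exact ⟨f + g, hf.mp (hg.mono fun q hq hq' => hq'.add hq), rfl⟩
  mul_mem' := by
    rintro _ _ ⟨f, hf, rfl⟩ ⟨g, hg, rfl⟩
    exact ⟨f * g, hf.mp (hg.mono fun q hq hq' => hq'.mul hq), rfl⟩
  neg_mem' := by
    rintro _ ⟨f, hf, rfl⟩
    exact ⟨-f, hf.mono fun q hq => hq.neg, rfl⟩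

/-- The germ of a smooth function. -/
def toGerm {z : ℝ × ℝ} (f : ℝ × ℝ → ℝ) (hf : ∀ᶠ q in 𝓝 z, ContDiffAt ℝ ∞ f q) : smoothGerms z :=
  ⟨f, f, hf, rfl⟩

theorem toGerm_eq {z : ℝ × ℝ} {f g : ℝ × ℝ → ℝ} {hf : ∀ᶠ q in 𝓝 z, ContDiffAt ℝ ∞ f q}
    {hg : ∀ᶠ q in 𝓝 z, ContDiffAt ℝ ∞ g q} : toGerm f hf = toGerm g hg ↔ f =ᶠ[𝓝 z] g :=
  Subtype.ext_iff.trans Filter.Germ.coe_eq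

theorem exists_toGerm {z : ℝ × ℝ} (φ : smoothGerms z) : ∃ f hf, φ = toGerm f hf := by
  obtain ⟨f, hf, h⟩ := φ.2
  exact ⟨f, hf, Subtype.ext h.symm⟩

theorem ContDiffAt.fderiv_apply_smooth {f : ℝ × ℝ → ℝ} {q : ℝ × ℝ} (hf : ContDiffAt ℝ ∞ f q)
    (w : ℝ × ℝ) : ContDiffAt ℝ ∞ (fun q => fderiv ℝ f q w) q :=
  hf.fderiv_smooth.clm_apply contDiffAt_const

theorem toGerm_fderiv_congr {z : ℝ × ℝ} {f g : ℝ × ℝ → ℝ}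
    (hf : ∀ᶠ q in 𝓝 z, ContDiffAt ℝ ∞ f q) (hg : ∀ᶠ q in 𝓝 z, ContDiffAt ℝ ∞ g q) (w : ℝ × ℝ)
    (h : f =ᶠ[𝓝 z] g) :
    toGerm (fun q => fderiv ℝ f q w) (hf.mono fun _ h => h.fderiv_apply_smooth w)
      = toGerm (fun q => fderiv ℝ g q w) (hg.mono fun _ h => h.fderiv_apply_smooth w) :=
  toGerm_eq.2 ((h.fderiv (𝕜 := ℝ)).mono fun q hq => by simp only [hq])

/-- The directional derivative of germs. -/
def germDerivFun {z : ℝ × ℝ} (w : ℝ × ℝ) (φ : smoothGerms z) : smoothGerms z :=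
  toGerm (fun q => fderiv ℝ φ.2.choose q w)
    (φ.2.choose_spec.1.mono fun _ h => h.fderiv_apply_smooth w)

theorem germDerivFun_toGerm {z : ℝ × ℝ} (w : ℝ × ℝ) (f : ℝ × ℝ → ℝ)
    (hf : ∀ᶠ q in 𝓝 z, ContDiffAt ℝ ∞ f q) : germDerivFun w (toGerm f hf)
      = toGerm (fun q => fderiv ℝ f q w) (hf.mono fun _ h => h.fderiv_apply_smooth w) :=
  toGerm_fderiv_congr (toGerm f hf).2.choose_spec.1 hf w
    (Filter.Germ.coe_eq.1 (toGerm f hf).2.choose_spec.2)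

/-- The directional derivative, as a derivation of the ring of germs. -/
def germDeriv (z w : ℝ × ℝ) : Derivation ℤ (smoothGerms z) (smoothGerms z) :=
  Derivation.mk' (AddMonoidHom.toIntLinearMap (AddMonoidHom.mk' (germDerivFun w) fun φ ψ => by
    obtain ⟨f, hf, rfl⟩ := exists_toGerm φ
    obtain ⟨g, hg, rfl⟩ := exists_toGerm ψ
    have e : toGerm f hf + toGerm g hg
        = toGerm (fun q => f q + g q) (hf.mp (hg.mono fun q hq hq' => hq'.add hq)) := rfl
    rw [e, germDerivFun_toGerm, germDerivFun_toGerm, germDerivFun_toGerm]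
    refine Subtype.ext (Filter.Germ.coe_eq.2 ?_)
    filter_upwards [hf, hg] with q h1 h2
    rw [fderiv_fun_add (h1.differentiableAt (by simp)) (h2.differentiableAt (by simp))]
    rfl)) fun φ ψ => by
    obtain ⟨f, hf, rfl⟩ := exists_toGerm φ
    obtain ⟨g, hg, rfl⟩ := exists_toGerm ψ
    have e : toGerm f hf * toGerm g hg
        = toGerm (fun q => f q * g q) (hf.mp (hg.mono fun q hq hq' => hq'.mul hq)) := rfl
    change germDerivFun w _ = _ * germDerivFun w _ + _ * germDerivFun w _
    rw [e, germDerivFun_toGerm, germDerivFun_toGerm, germDerivFun_toGerm]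
    refine Subtype.ext (Filter.Germ.coe_eq.2 ?_)
    filter_upwards [hf, hg] with q h1 h2
    rw [fderiv_fun_mul (h1.differentiableAt (by simp)) (h2.differentiableAt (by simp))]
    rfl

theorem germDeriv_toGerm {z : ℝ × ℝ} (w : ℝ × ℝ) (f : ℝ × ℝ → ℝ)
    (hf : ∀ᶠ q in 𝓝 z, ContDiffAt ℝ ∞ f q) : germDeriv z w (toGerm f hf)
      = toGerm (fun q => fderiv ℝ f q w) (hf.mono fun _ h => h.fderiv_apply_smooth w) :=
  germDerivFun_toGerm w f hf

theorem germDeriv_comm {z : ℝ × ℝ} (v w : ℝ × ℝ) (φ : smoothGerms z) :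
    germDeriv z v (germDeriv z w φ) = germDeriv z w (germDeriv z v φ) := by
  obtain ⟨f, hf, rfl⟩ := exists_toGerm φ
  rw [germDeriv_toGerm, germDeriv_toGerm, germDeriv_toGerm, germDeriv_toGerm, toGerm_eq]
  filter_upwards [hf] with q hq
  rw [← fderiv_fderiv_apply hq, ← fderiv_fderiv_apply hq,
    (hq.isSymmSndFDerivAt two_le_smooth).eq v w]

/-- The value at `z` of a germ. -/
def germValue (z : ℝ × ℝ) : smoothGerms z →+* ℝ :=
  (Filter.Germ.valueRingHom : Filter.Germ (𝓝 z) ℝ →+* ℝ).comp (smoothGerms z).subtype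

theorem germValue_toGerm {z : ℝ × ℝ} (f : ℝ × ℝ → ℝ) (hf : ∀ᶠ q in 𝓝 z, ContDiffAt ℝ ∞ f q) :
    germValue z (toGerm f hf) = f z := rfl

theorem ofNat_eq_toGerm (z : ℝ × ℝ) (n : ℕ) [n.AtLeastTwo] :
    (OfNat.ofNat n : smoothGerms z) = toGerm (fun _ => OfNat.ofNat n)
      (Filter.Eventually.of_forall fun _ => contDiffAt_const) := by
  refine Subtype.ext ?_
  have h1 : ((OfNat.ofNat n : smoothGerms z) : Filter.Germ (𝓝 z) ℝ) = (n : Filter.Germ (𝓝 z) ℝ) :=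
    map_natCast (smoothGerms z).subtype n
  rw [h1]
  rfl

end GermRing

/-! ### Equations with an eight-dimensional symmetry algebra -/

section MaximalSymmetry

/-- The connection coefficients that project to the cubic equation and have `Γ¹₁₂ = Γ²₁₂ = 0`. -/
def simpleCoeff (E : Fin 4 → ℝ × ℝ → ℝ) : Fin 2 → Fin 2 → Fin 2 → ℝ × ℝ → ℝ :=
  ![![![-E 1, 0], ![0, -E 3]], ![![E 0, 0], ![0, E 2]]]

theorem simpleCoeff_symm (E : Fin 4 → ℝ × ℝ → ℝ) (i j k : Fin 2) (q : ℝ × ℝ) :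
    simpleCoeff E i j k q = simpleCoeff E i k j q := by
  fin_cases i <;> fin_cases j <;> fin_cases k <;> rfl

theorem contDiffAt_simpleCoeff {E : Fin 4 → ℝ × ℝ → ℝ} {q : ℝ × ℝ}
    (hE : ∀ i, ContDiffAt ℝ ∞ (E i) q) (i j k : Fin 2) : ContDiffAt ℝ ∞ (simpleCoeff E i j k) q := by
  have h0 : ContDiffAt ℝ ∞ (0 : ℝ × ℝ → ℝ) q := contDiffAt_const
  fin_cases i <;> fin_cases j <;> fin_cases k
  exacts [(hE 1).neg, h0, h0, (hE 3).neg, hE 0, h0, h0, hE 2]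

theorem planeConn_simpleCoeff_apply (E : Fin 4 → ℝ × ℝ → ℝ) (q v w : ℝ × ℝ) :
    planeConn (simpleCoeff E) q v w = (-E 1 q * w.1 * v.1 - E 3 q * w.2 * v.2,
      E 0 q * w.1 * v.1 + E 2 q * w.2 * v.2) := by
  rw [planeConn, bilinOfCoeff_apply]
  simp [simpleCoeff]
  ring

theorem fderiv_planeConn_simpleCoeff_apply {E : Fin 4 → ℝ × ℝ → ℝ} {q : ℝ × ℝ}
    (hE : ∀ i, ContDiffAt ℝ ∞ (E i) q) (u v w : ℝ × ℝ) :
    fderiv ℝ (planeConn (simpleCoeff E)) q u v w =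
      (-(u.1 * dx (E 1) q + u.2 * dy (E 1) q) * w.1 * v.1
        - (u.1 * dx (E 3) q + u.2 * dy (E 3) q) * w.2 * v.2,
      (u.1 * dx (E 0) q + u.2 * dy (E 0) q) * w.1 * v.1
        + (u.1 * dx (E 2) q + u.2 * dy (E 2) q) * w.2 * v.2) := by
  rw [fderiv_planeConn fun i j k => (contDiffAt_simpleCoeff hE i j k).differentiableAt (by simp),
    bilinOfCoeff_apply]
  simp only [← fderiv_eq_dx_dy]
  simp [simpleCoeff, fderiv_neg]
  ring

/-- The four coefficients of the determining equations of the point symmetries. -/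
theorem IsProjectiveAt.coeff_eq_zero {E : Fin 4 → ℝ × ℝ → ℝ} {ξ η : ℝ × ℝ → ℝ} {q : ℝ × ℝ}
    (hE : ∀ i, ContDiffAt ℝ ∞ (E i) q) (hξ : ∀ᶠ q in 𝓝 q, ContDiffAt ℝ ∞ ξ q)
    (hη : ∀ᶠ q in 𝓝 q, ContDiffAt ℝ ∞ η q)
    (h : IsProjectiveAt (planeConn (simpleCoeff E)) (fun q => (ξ q, η q)) q) :
    (dx (dx η) q + ξ q * dx (E 0) q + η q * dy (E 0) q + 2 * dx ξ q * E 0 q - dy η q * E 0 q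
      + dx η q * E 1 q = 0) ∧
    (2 * dx (dy η) q - dx (dx ξ) q + ξ q * dx (E 1) q + η q * dy (E 1) q + dx ξ q * E 1 q
      + 3 * dy ξ q * E 0 q + 2 * dx η q * E 2 q = 0) ∧
    (dy (dy η) q - 2 * dx (dy ξ) q + ξ q * dx (E 2) q + η q * dy (E 2) q + dy η q * E 2 q
      + 2 * dy ξ q * E 1 q + 3 * dx η q * E 3 q = 0) ∧
    (-dy (dy ξ) q + ξ q * dx (E 3) q + η q * dy (E 3) q + 2 * dy η q * E 3 q - dx ξ q * E 3 q
      + dy ξ q * E 2 q = 0) := by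
  set ψ := pureTraceForm (lieConn (planeConn (simpleCoeff E)) (fun q => (ξ q, η q)) q)
  have hξ0 := hξ.self_of_nhds
  have hη0 := hη.self_of_nhds
  have h1 : ∀ v w : ℝ × ℝ, _ = ψ v • w + ψ w • v := h
  simp only [lieConn_apply, fderiv_fderiv_prodMk_apply hξ hη,
    fderiv_prodMk_apply (hξ0.differentiableAt (by simp)) (hη0.differentiableAt (by simp)),
    fderiv_planeConn_simpleCoeff_apply hE, planeConn_simpleCoeff_apply,
    fderiv_fderiv_apply hξ0, fderiv_fderiv_apply hη0, fderiv_eq_dx_dy ξ, fderiv_eq_dx_dy η] at h1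
  have a := h1 (1, 0) (1, 0)
  have b := h1 (1, 0) (0, 1)
  have c := h1 (0, 1) (0, 1)
  simp [← dx.eq_1, ← dy.eq_1] at a b c
  obtain ⟨a1, a2⟩ := a
  obtain ⟨b1, b2⟩ := b
  obtain ⟨c1, c2⟩ := c
  refine ⟨?_, ?_, ?_, ?_⟩
  · linear_combination a2
  · linear_combination 2 * b2 - a1
  · linear_combination c2 - 2 * b1
  · linear_combination -c1

/-- The functions whose germs are the entries of `ricci`. -/
def ricciFun (E : Fin 4 → ℝ × ℝ → ℝ) : Fin 3 → ℝ × ℝ → ℝ := ![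
  fun q => 3 * dx (E 1) q - 9 * dy (E 0) q + 2 * E 1 q * E 1 q - 6 * E 0 q * E 2 q,
  fun q => 3 * dx (E 2) q - 3 * dy (E 1) q + E 1 q * E 2 q - 9 * E 0 q * E 3 q,
  fun q => 9 * dx (E 3) q - 3 * dy (E 2) q + 2 * E 2 q * E 2 q - 6 * E 1 q * E 3 q]

theorem contDiffAt_ricciFun {E : Fin 4 → ℝ × ℝ → ℝ} {q : ℝ × ℝ}
    (hE : ∀ i, ContDiffAt ℝ ∞ (E i) q) (i : Fin 3) : ContDiffAt ℝ ∞ (ricciFun E i) q := by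
  have c : ∀ r : ℝ, ContDiffAt ℝ ∞ (fun _ : ℝ × ℝ => r) q := fun r => contDiffAt_const
  fin_cases i
  · exact ((((c 3).mul (hE 1).dx_smooth).sub ((c 9).mul (hE 0).dy_smooth)).add
      (((c 2).mul (hE 1)).mul (hE 1))).sub (((c 6).mul (hE 0)).mul (hE 2))
  · exact ((((c 3).mul (hE 2).dx_smooth).sub ((c 3).mul (hE 1).dy_smooth)).add
      ((hE 1).mul (hE 2))).sub (((c 9).mul (hE 0)).mul (hE 3))
  · exact ((((c 9).mul (hE 3).dx_smooth).sub ((c 3).mul (hE 2).dy_smooth)).add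
      (((c 2).mul (hE 2)).mul (hE 2))).sub (((c 6).mul (hE 1)).mul (hE 3))

theorem ricci_toGerm {E : Fin 4 → ℝ × ℝ → ℝ} {z : ℝ × ℝ}
    (hE : ∀ i, ∀ᶠ q in 𝓝 z, ContDiffAt ℝ ∞ (E i) q) (i : Fin 3) :
    ricci (germDeriv z (1, 0)) (germDeriv z (0, 1)) (fun i => toGerm (E i) (hE i)) i
      = toGerm (ricciFun E i)
        ((Filter.eventually_all.2 hE).mono fun _ h => contDiffAt_ricciFun h i) := by
  fin_cases i <;> simp only [ricci, germDeriv_toGerm, ofNat_eq_toGerm] <;> rfl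

theorem cotton_toGerm {E : Fin 4 → ℝ × ℝ → ℝ} {z : ℝ × ℝ}
    (hE : ∀ i, ∀ᶠ q in 𝓝 z, ContDiffAt ℝ ∞ (E i) q) :
    germValue z (cotton (germDeriv z (1, 0)) (germDeriv z (0, 1)) (fun i => toGerm (E i) (hE i)) 0)
      = 3 * dy (ricciFun E 0) z - 3 * dx (ricciFun E 1) z - 2 * E 1 z * ricciFun E 1 z
        + 3 * E 0 z * ricciFun E 2 z + E 2 z * ricciFun E 0 z ∧
    germValue z (cotton (germDeriv z (1, 0)) (germDeriv z (0, 1)) (fun i => toGerm (E i) (hE i)) 1)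
      = 3 * dx (ricciFun E 2) z - 3 * dy (ricciFun E 1) z + 2 * E 2 z * ricciFun E 1 z
        - 3 * E 3 z * ricciFun E 0 z - E 1 z * ricciFun E 2 z := by
  simp only [cotton, ricci_toGerm, germDeriv_toGerm, Matrix.cons_val_zero, Matrix.cons_val_one,
    map_add, map_sub, map_mul, map_ofNat, germValue_toGerm]
  exact ⟨rfl, rfl⟩

/-- At a zero of a point symmetry with the first jet of the homothety, the infinitesimal invariance
of `cotton` says that three times its value vanishes. -/
theorem germValue_cotton_eq_zero {E : Fin 4 → ℝ × ℝ → ℝ} {X : ℝ × ℝ → ℝ × ℝ} {z : ℝ × ℝ}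
    (hE : ∀ i, ∀ᶠ q in 𝓝 z, ContDiffAt ℝ ∞ (E i) q)
    (hX : ∀ᶠ q in 𝓝 z, ContDiffAt ℝ ∞ X q ∧ IsProjectiveAt (planeConn (simpleCoeff E)) X q)
    (hX0 : X z = 0) (hX1 : fderiv ℝ X z = ContinuousLinearMap.id ℝ (ℝ × ℝ)) (i : Fin 2) :
    germValue z (cotton (germDeriv z (1, 0)) (germDeriv z (0, 1))
      (fun i => toGerm (E i) (hE i)) i) = 0 := by
  have hξ : ∀ᶠ q in 𝓝 z, ContDiffAt ℝ ∞ (fun q => (X q).1) q := hX.mono fun _ h => h.1.fst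
  have hη : ∀ᶠ q in 𝓝 z, ContDiffAt ℝ ∞ (fun q => (X q).2) q := hX.mono fun _ h => h.1.snd
  have hd : HasFDerivAt X _ z := (hX.self_of_nhds.1.differentiableAt (by simp)).hasFDerivAt
  -- the determining equations of the symmetry, as an identity of germs
  have hD : coeffVariation (germDeriv z (1, 0)) (germDeriv z (0, 1))
      (fun i => toGerm (E i) (hE i)) (toGerm _ hξ) (toGerm _ hη) = 0 := by
    have hc := ((Filter.eventually_all.2 hE).and (hX.and
      (hξ.eventually_nhds.and hη.eventually_nhds))).mono fun q h =>
        IsProjectiveAt.coeff_eq_zero (ξ := fun q => (X q).1) (η := fun q => (X q).2) h.1 h.2.2.1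
          h.2.2.2 h.2.1.2
    funext i
    refine Subtype.ext ?_
    fin_cases i <;> simp only [coeffVariation, germDeriv_toGerm, ofNat_eq_toGerm] <;>
      refine Filter.Germ.coe_eq.2 ?_
    · exact hc.mono fun q h => h.1
    · exact hc.mono fun q h => h.2.1
    · exact hc.mono fun q h => h.2.2.1
    · exact hc.mono fun q h => h.2.2.2
  -- the linearization vanishes in the direction `0`
  have hn : ∀ j, cottonDeriv (germDeriv z (1, 0)) (germDeriv z (0, 1))
      (fun i => toGerm (E i) (hE i)) 0 j = 0 := fun j => by
    have hr : ∀ k, ricciDeriv (germDeriv z (1, 0)) (germDeriv z (0, 1))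
        (fun i => toGerm (E i) (hE i)) 0 k = 0 := fun k => by fin_cases k <;> simp [ricciDeriv]
    fin_cases j <;> simp [cottonDeriv, hr]
  obtain ⟨h0, h1⟩ := cottonDeriv_coeffVariation (germDeriv z (1, 0)) (germDeriv z (0, 1))
    (germDeriv_comm _ _) (fun i => toGerm (E i) (hE i)) (toGerm _ hξ) (toGerm _ hη)
  rw [hD, hn] at h0 h1
  replace h0 := congrArg (germValue z) h0
  replace h1 := congrArg (germValue z) h1
  have e1 : fderiv ℝ (fun q => (X q).1) z = ContinuousLinearMap.fst ℝ ℝ ℝ := by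
    rw [hd.fst.fderiv, hX1, ContinuousLinearMap.comp_id]
  have e2 : fderiv ℝ (fun q => (X q).2) z = ContinuousLinearMap.snd ℝ ℝ ℝ := by
    rw [hd.snd.fderiv, hX1, ContinuousLinearMap.comp_id]
  simp only [germDeriv_toGerm (z := z) _ (fun q => (X q).1),
    germDeriv_toGerm (z := z) _ (fun q => (X q).2), map_add, map_sub, map_mul, map_ofNat, map_zero,
    germValue_toGerm, hX0, e1, e2, ContinuousLinearMap.coe_fst', ContinuousLinearMap.coe_snd',
    Prod.fst_zero, Prod.snd_zero] at h0 h1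
  fin_cases i
  · change germValue z (cotton _ _ _ 0) = 0
    linarith
  · change germValue z (cotton _ _ _ 1) = 0
    linarith

end MaximalSymmetry

/-! ### Solvability of the Lie conditions -/

section LieFromSymmetry

theorem fderiv_div_apply {f g : ℝ × ℝ → ℝ} {q : ℝ × ℝ} (hf : DifferentiableAt ℝ f q)
    (hg : DifferentiableAt ℝ g q) (h0 : g q ≠ 0) (w : ℝ × ℝ) :
    fderiv ℝ (fun q => f q / g q) q w
      = fderiv ℝ f q w / g q - f q / g q * (fderiv ℝ g q w / g q) := by
  have h1 := hf.hasFDerivAt.mul (((hasDerivAt_inv h0).comp_hasFDerivAt q hg.hasFDerivAt))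
  have h2 : HasFDerivAt (fun j => f j / g j) _ q := h1.congr_of_eventuallyEq
    (Filter.Eventually.of_forall fun j => div_eq_mul_inv _ _)
  rw [h2.fderiv]
  simp
  field_simp
  ring

theorem fderiv_const_mul_apply (r : ℝ) {f : ℝ × ℝ → ℝ} {q : ℝ × ℝ} (hf : DifferentiableAt ℝ f q)
    (w : ℝ × ℝ) : fderiv ℝ (fun q => r * f q) q w = r * fderiv ℝ f q w := by
  rw [fderiv_const_mul hf]
  rfl

/-- The coefficients of the linear system to which the substitution `b = E₂/3 + τ_y/τ`,
`e = E₁/3 - τ_x/τ` reduces the Lie conditions. -/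
def lieSystemCoeff (E : Fin 4 → ℝ × ℝ → ℝ) : Fin 9 → ℝ × ℝ → ℝ := ![
  fun q => -(1 / 3) * E 1 q, E 0, fun q => 1 / 9 * ricciFun E 0 q,
  fun q => -(1 / 3) * E 2 q, fun q => 1 / 3 * E 1 q, fun q => 1 / 9 * ricciFun E 1 q,
  fun q => -1 * E 3 q, fun q => 1 / 3 * E 2 q, fun q => 1 / 9 * ricciFun E 2 q]

theorem contDiffAt_lieSystemCoeff {E : Fin 4 → ℝ × ℝ → ℝ} {q : ℝ × ℝ}
    (hE : ∀ i, ContDiffAt ℝ ∞ (E i) q) (i : Fin 9) : ContDiffAt ℝ ∞ (lieSystemCoeff E i) q := by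
  have hr := contDiffAt_ricciFun hE
  fin_cases i
  exacts [contDiffAt_const.mul (hE 1), hE 0, contDiffAt_const.mul (hr 0),
    contDiffAt_const.mul (hE 2), contDiffAt_const.mul (hE 1), contDiffAt_const.mul (hr 1),
    contDiffAt_const.mul (hE 3), contDiffAt_const.mul (hE 2), contDiffAt_const.mul (hr 2)]

/-- The Lie conditions are solvable near `z` if the invariants vanish near `z`: these are the two
integrability conditions of the system for `τ` that do not hold identically. -/
theorem exists_lieConditions_of_cotton_eq_zero {E : Fin 4 → ℝ × ℝ → ℝ} {z : ℝ × ℝ}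
    (hE : ∀ᶠ q in 𝓝 z, ∀ i, ContDiffAt ℝ ∞ (E i) q)
    (h : ∀ᶠ q in 𝓝 z,
      3 * dy (ricciFun E 0) q - 3 * dx (ricciFun E 1) q - 2 * E 1 q * ricciFun E 1 q
        + 3 * E 0 q * ricciFun E 2 q + E 2 q * ricciFun E 0 q = 0 ∧
      3 * dx (ricciFun E 2) q - 3 * dy (ricciFun E 1) q + 2 * E 2 q * ricciFun E 1 q
        - 3 * E 3 q * ricciFun E 0 q - E 1 q * ricciFun E 2 q = 0) :
    ∃ b e : ℝ × ℝ → ℝ, ∀ᶠ q in 𝓝 z,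
      ContDiffAt ℝ ∞ b q ∧ ContDiffAt ℝ ∞ e q ∧ LieConditions E b e q := by
  obtain ⟨t, l, m, ht0, htlm⟩ := exists_hessianSystem_solution (c := lieSystemCoeff E) (z := z)
    (hE.mono fun _ h => contDiffAt_lieSystemCoeff h) (by
      filter_upwards [hE, h] with q hq ⟨h0, h1⟩
      have hd := fun i => (hq i).differentiableAt (n := ∞) (by simp)
      have hr := fun i => (contDiffAt_ricciFun hq i).differentiableAt (n := ∞) (by simp)
      simp only [lieSystemCoeff, dx, dy, Matrix.cons_val, fderiv_const_mul_apply _ (hd _),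
        fderiv_const_mul_apply _ (hr _)] at h0 h1 ⊢
      refine ⟨?_, ?_, ?_, ?_, ?_, ?_⟩
      · simp [ricciFun, dx, dy]; ring
      · simp [ricciFun, dx, dy]; ring
      · linear_combination (1 / 27) * h0
      · simp [ricciFun, dx, dy]; ring
      · simp [ricciFun, dx, dy]; ring
      · linear_combination (-1 / 27) * h1)
  have htc : ContinuousAt t z := htlm.self_of_nhds.1.1.continuousAt
  have htz : ∀ᶠ q in 𝓝 z, t q ≠ 0 := htc.eventually_ne (by rw [ht0]; exact one_ne_zero)
  refine ⟨fun q => 1 / 3 * E 2 q + m q / t q, fun q => 1 / 3 * E 1 q - l q / t q, ?_⟩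
  filter_upwards [hE, htlm, htz] with q hq ⟨⟨ct, cl, cm⟩, ⟨tx, ty⟩, lx, ly, mx, my⟩ ht
  have hd := fun i => (hq i).differentiableAt (n := ∞) (by simp)
  have dt : DifferentiableAt ℝ t q := ct.differentiableAt (by simp)
  have dl : DifferentiableAt ℝ l q := cl.differentiableAt (by simp)
  have dm : DifferentiableAt ℝ m q := cm.differentiableAt (by simp)
  refine ⟨(contDiffAt_const.mul (hq 2)).add (cm.div ct ht),
    (contDiffAt_const.mul (hq 1)).sub (cl.div ct ht), ?_⟩
  have hb : ∀ w, fderiv ℝ (fun q => 1 / 3 * E 2 q + m q / t q) q w = 1 / 3 * fderiv ℝ (E 2) q w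
      + (fderiv ℝ m q w / t q - m q / t q * (fderiv ℝ t q w / t q)) := fun w => by
    rw [fderiv_fun_add ((hd 2).const_mul _) (by fun_prop (disch := exact ht)), add_apply,
      fderiv_const_mul_apply _ (hd 2), fderiv_div_apply dm dt ht]
  have he : ∀ w, fderiv ℝ (fun q => 1 / 3 * E 1 q - l q / t q) q w = 1 / 3 * fderiv ℝ (E 1) q w
      - (fderiv ℝ l q w / t q - l q / t q * (fderiv ℝ t q w / t q)) := fun w => by
    rw [fderiv_fun_sub ((hd 1).const_mul _) (by fun_prop (disch := exact ht)), sub_apply,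
      fderiv_const_mul_apply _ (hd 1), fderiv_div_apply dl dt ht]
  simp only [lieSystemCoeff, Matrix.cons_val, ricciFun] at lx ly mx my
  simp only [LieConditions, dx, dy, hb, he] at tx ty lx ly mx my ⊢
  simp only [tx, ty, lx, ly, mx, my]
  refine ⟨?_, ?_, ?_, ?_⟩ <;> field_simp <;> ring

/-- An isomorphism with `sl(3, ℝ)` provides a homothety at every point near `z`, and the latter
forces the invariants to vanish. -/
theorem exists_lieConditions_of_hasSymmetryAlgebra {E : Fin 4 → ℝ × ℝ → ℝ} {U : Set (ℝ × ℝ)}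
    (hU : IsOpen U) (hE : ∀ i, ContDiffOn ℝ ∞ (E i) U) {z : ℝ × ℝ} (hz : z ∈ U)
    (h : HasSymmetryAlgebra (cubicRHS E) z (slAlg 3)) :
    ∃ V ⊆ U, IsOpen V ∧ z ∈ V ∧ ∃ b e, ContDiffOn ℝ ∞ b V ∧ ContDiffOn ℝ ∞ e V ∧
      ∀ q ∈ V, LieConditions E b e q := by
  have hzU := hU.eventually_mem hz
  have hEz : ∀ᶠ q in 𝓝 z, ∀ i, ContDiffAt ℝ ∞ (E i) q :=
    hzU.mono fun q hq i => (hE i).contDiffAt (hU.mem_nhds hq)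
  have hsymm : ∀ q v w, planeConn (simpleCoeff E) q v w = planeConn (simpleCoeff E) q w v :=
    fun q v w => by rw [planeConn_simpleCoeff_apply, planeConn_simpleCoeff_apply]; ext <;> ring
  have hsm : ∀ᶠ q in 𝓝 z, ContDiffAt ℝ ∞ (planeConn (simpleCoeff E)) q :=
    hEz.mono fun q hq => contDiffAt_planeConn fun i j k => contDiffAt_simpleCoeff hq i j k
  have hproj : ProjectsTo (simpleCoeff E) E Set.univ :=
    (projectsTo_iff fun i j k q _ => simpleCoeff_symm E i j k q).2 fun q _ => by
      simp [simpleCoeff]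
  have h' : HasSymmetryAlgebra (projRHS (planeConn (simpleCoeff E))) z
      (slAlg (Module.finrank ℝ ℝ + 2)) := by
    rw [Module.finrank_self]
    exact (hasSymmetryAlgebra_congr (Filter.Eventually.of_forall fun q p =>
      hproj.cubicRHS_eq (fun i j k q _ => simpleCoeff_symm E i j k q) (Set.mem_univ q) p) _).1 h
  have hc : ∃ b e : ℝ × ℝ → ℝ, ∀ᶠ q in 𝓝 z,
      ContDiffAt ℝ ∞ b q ∧ ContDiffAt ℝ ∞ e q ∧ LieConditions E b e q := by
    refine exists_lieConditions_of_cotton_eq_zero hEz ?_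
    filter_upwards [eventually_exists_projective hsm (Filter.Eventually.of_forall hsymm) h',
      hEz.eventually_nhds] with q hq hEq
    obtain ⟨X, hX, hj⟩ := hq (0, ContinuousLinearMap.id ℝ _, 0)
    have hEq' := Filter.eventually_all.1 hEq
    have key := germValue_cotton_eq_zero hEq' hX (congrArg Prod.fst hj)
      (congrArg (fun j => j.2.1) hj)
    obtain ⟨e0, e1⟩ := cotton_toGerm hEq'
    exact ⟨e0.symm.trans (key 0), e1.symm.trans (key 1)⟩
  obtain ⟨b, e, hbe⟩ := hc
  obtain ⟨V, hV, hVo, hzV⟩ := eventually_nhds_iff.1 (hbe.and hzU)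
  exact ⟨V, fun q hq => (hV q hq).2, hVo, hzV, b, e,
    fun q hq => (hV q hq).1.1.contDiffWithinAt, fun q hq => (hV q hq).1.2.1.contDiffWithinAt,
    fun q hq => (hV q hq).1.2.2⟩

end LieFromSymmetry

end

theorem theorem1 (U : Set (ℝ × ℝ)) (hU : IsOpen U) (E : Fin 4 → ℝ × ℝ → ℝ)
    (hE : ∀ i, ContDiffOn ℝ ∞ (E i) U) :
    -- the equivalences, near every point of `U`
    (∀ z ∈ U, List.TFAE [
      -- the scalar equation has symmetry algebra sl(3, ℝ)
      HasSymmetryAlgebra (cubicRHS E) z (slAlg 3),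
      -- it is linearizable by a point transformation
      ∃ W ⊆ U, IsOpen W ∧ z ∈ W ∧ ∃ u v α β γ, Set.InjOn (fun q => (u q, v q)) W ∧
        Linearizes E W u v α β γ,
      -- it is reducible by a point transformation to `v'' = 0`
      ∃ W ⊆ U, IsOpen W ∧ z ∈ W ∧ ∃ u v, Set.InjOn (fun q => (u q, v q)) W ∧
        Linearizes E W u v 0 0 0,
      -- it is the projection of a system of two geodesic equations admitting sl(4, ℝ)
      ∃ V ⊆ U, IsOpen V ∧ z ∈ V ∧ ∃ Γ, IsConnectionOn Γ V ∧ ProjectsTo Γ E V ∧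
        ∀ s : ℝ, HasSymmetryAlgebra (geodesicRHS Γ) (s, z) (slAlg 4),
      -- it is the projection of a system of two geodesic equations with vanishing curvature
      ∃ V ⊆ U, IsOpen V ∧ z ∈ V ∧ ∃ Γ, IsConnectionOn Γ V ∧ ProjectsTo Γ E V ∧
        ∀ q ∈ V, RiemannZero Γ q,
      -- the same two, for the geodesic equations of a metric
      ∃ V ⊆ U, IsOpen V ∧ z ∈ V ∧ ∃ g, IsMetricOn g V ∧ ProjectsTo (christoffel g) E V ∧
        ∀ s : ℝ, HasSymmetryAlgebra (geodesicRHS (christoffel g)) (s, z) (slAlg 4),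
      ∃ V ⊆ U, IsOpen V ∧ z ∈ V ∧ ∃ g, IsMetricOn g V ∧ ProjectsTo (christoffel g) E V ∧
        ∀ q ∈ V, RiemannZero (christoffel g) q,
      -- the Lie conditions have a solution
      ∃ V ⊆ U, IsOpen V ∧ z ∈ V ∧ ∃ b e, ContDiffOn ℝ ∞ b V ∧ ContDiffOn ℝ ∞ e V ∧
        ∀ q ∈ V, LieConditions E b e q]) ∧
    -- a system of two geodesic equations admits sl(4, ℝ) iff its Riemann tensor vanishes
    (∀ (V : Set (ℝ × ℝ)) (Γ : Fin 2 → Fin 2 → Fin 2 → ℝ × ℝ → ℝ), IsOpen V → IsConnectionOn Γ V →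
      ∀ z ∈ V, ∀ s : ℝ, HasSymmetryAlgebra (geodesicRHS Γ) (s, z) (slAlg 4) ↔
        ∀ᶠ q in 𝓝 z, RiemannZero Γ q) ∧
    -- for a projecting system, vanishing curvature amounts to the flatness conditions on
    -- `a, …, f`, and these amount to the Lie conditions with `b` and with `-e` in place of `e`
    (∀ (V : Set (ℝ × ℝ)) (Γ : Fin 2 → Fin 2 → Fin 2 → ℝ × ℝ → ℝ), V ⊆ U → IsOpen V →
      IsConnectionOn Γ V → ProjectsTo Γ E V →
      ∀ q ∈ V,
        (RiemannZero Γ q ↔ FlatnessConditions (-Γ 0 0 0) (-Γ 0 0 1) (-Γ 0 1 1)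
          (-Γ 1 0 0) (-Γ 1 0 1) (-Γ 1 1 1) q) ∧
        (FlatnessConditions (-Γ 0 0 0) (-Γ 0 0 1) (-Γ 0 1 1)
          (-Γ 1 0 0) (-Γ 1 0 1) (-Γ 1 1 1) q ↔ LieConditions E (-Γ 0 0 1) (Γ 1 0 1) q)) ∧
    -- conversely every pair `b`, `e` determines a projecting system
    (∀ (V : Set (ℝ × ℝ)) (b e : ℝ × ℝ → ℝ), V ⊆ U → IsOpen V →
      ContDiffOn ℝ ∞ b V → ContDiffOn ℝ ∞ e V →
      ∃ Γ, IsConnectionOn Γ V ∧ ProjectsTo Γ E V ∧ ∀ q ∈ V,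
        -Γ 0 0 0 q = E 1 q + 2 * e q ∧ -Γ 0 0 1 q = b q ∧ -Γ 0 1 1 q = E 3 q ∧
        -Γ 1 0 0 q = -E 0 q ∧ -Γ 1 0 1 q = e q ∧ -Γ 1 1 1 q = 2 * b q - E 2 q) ∧
    -- construction of linearizing transformations from a flat projecting system
    (∀ (V : Set (ℝ × ℝ)) (Γ : Fin 2 → Fin 2 → Fin 2 → ℝ × ℝ → ℝ), V ⊆ U → IsOpen V →
      IsConnectionOn Γ V → ProjectsTo Γ E V → (∀ q ∈ V, RiemannZero Γ q) →
      -- a metric with these Christoffel symbols exists near every point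
      (∀ z ∈ V, ∃ W ⊆ V, IsOpen W ∧ z ∈ W ∧ ∃ g, IsMetricOn g W ∧
        ∀ q ∈ W, MetricEquations (-Γ 0 0 0) (-Γ 0 0 1) (-Γ 0 1 1)
          (-Γ 1 0 0) (-Γ 1 0 1) (-Γ 1 1 1) (g 0 0) (g 0 1) (g 1 1) q) ∧
      -- for each such metric the equations for `u`, `v` are solvable near every point,
      -- and each solution is a transformation to `v'' = 0`
      ∀ W ⊆ V, IsOpen W → ∀ g, IsMetricOn g W →
        (∀ q ∈ W, MetricEquations (-Γ 0 0 0) (-Γ 0 0 1) (-Γ 0 1 1)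
          (-Γ 1 0 0) (-Γ 1 0 1) (-Γ 1 1 1) (g 0 0) (g 0 1) (g 1 1) q) →
        (∀ z ∈ W, ∃ W' ⊆ W, IsOpen W' ∧ z ∈ W' ∧ ∃ u v, ContDiffOn ℝ ∞ u W' ∧
          ContDiffOn ℝ ∞ v W' ∧
          ∀ q ∈ W', IsometryEquations u v (g 0 0) (g 0 1) (g 1 1) q) ∧
        ∀ W' ⊆ W, IsOpen W' → ∀ u v, ContDiffOn ℝ ∞ u W' → ContDiffOn ℝ ∞ v W' →
          (∀ q ∈ W', IsometryEquations u v (g 0 0) (g 0 1) (g 1 1) q) →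
          Linearizes E W' u v 0 0 0) := by
  have shrink : ∀ {z : ℝ × ℝ} {V : Set (ℝ × ℝ)} {P : Set (ℝ × ℝ) → Prop}, V ⊆ U →
      (∃ W ⊆ V, IsOpen W ∧ z ∈ W ∧ P W) → ∃ W ⊆ U, IsOpen W ∧ z ∈ W ∧ P W :=
    fun hV ⟨W, hW, h⟩ => ⟨W, hW.trans hV, h⟩
  refine ⟨fun z hz => ?_, fun V Γ hV hΓ z hz s => hasSymmetryAlgebra_geodesicRHS_iff hV hΓ hz s,
    fun V Γ _ hV hΓ hP q hq => ⟨riemannZero_iff_flatness hV hΓ hq,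
      flatness_iff_lieConditions hV hΓ hP hq⟩,
    fun V b e hVU _ hb he => exists_projecting (fun i => (hE i).mono hVU) hb he,
    fun V Γ _ hV hΓ hP h0 => ⟨fun z hz => hΓ.exists_metric hV h0 hz, fun W hWV hW g hg hM =>
      ⟨fun z hz => hΓ.exists_isometry hV h0 hWV hW hg hM hz, fun W' hW' hWo u v hu hv huv =>
        linearizes_of_isometry hΓ hP (hW'.trans hWV) hWo
          (fun q hq => ((isMetricOn_iff.1 hg).2 q (hW' hq)).2.2) (fun q hq => hM q (hW' hq))
          hu hv huv⟩⟩⟩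
  tfae_have 1 → 8 := exists_lieConditions_of_hasSymmetryAlgebra hU hE hz
  tfae_have 8 → 5 := by
    rintro ⟨V, hVU, hV, hzV, b, e, hb, he, hL⟩
    -- the `e` of the Lie conditions is `Γ²₁₂`, so the system is the one prescribed by `b` and `-e`
    obtain ⟨Γ, hΓ, hP, h⟩ := exists_projecting (fun i => (hE i).mono hVU) hb he.neg
    refine ⟨V, hVU, hV, hzV, Γ, hΓ, hP, fun q hq => (riemannZero_iff_flatness hV hΓ hq).2
      ((flatness_iff_lieConditions hV hΓ hP hq).2 ((hL q hq).congr ?_ ?_))⟩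
    · exact Filter.eventually_of_mem (hV.mem_nhds hq) fun q hq => (h q hq).2.1.symm
    · exact Filter.eventually_of_mem (hV.mem_nhds hq) fun q hq =>
        (neg_inj.1 (h q hq).2.2.2.2.1).symm
  tfae_have 5 → 7 := fun ⟨V, hVU, hV, hzV, Γ, hΓ, hP, h0⟩ =>
    shrink hVU (exists_flat_metric hV hΓ hP h0 hzV)
  tfae_have 7 → 6 := fun ⟨V, hVU, hV, hzV, g, hg, hP, h0⟩ => ⟨V, hVU, hV, hzV, g, hg, hP,
    fun s => (hasSymmetryAlgebra_geodesicRHS_iff hV (hg.isConnectionOn hV) hzV s).2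
      (Filter.eventually_of_mem (hV.mem_nhds hzV) h0)⟩
  tfae_have 6 → 4 := fun ⟨V, hVU, hV, hzV, g, hg, h⟩ =>
    ⟨V, hVU, hV, hzV, christoffel g, hg.isConnectionOn hV, h⟩
  tfae_have 4 → 5 := by
    rintro ⟨V, hVU, hV, hzV, Γ, hΓ, hP, h⟩
    obtain ⟨W, hW, hWo, hzW⟩ := eventually_nhds_iff.1
      (((hasSymmetryAlgebra_geodesicRHS_iff hV hΓ hzV 0).1 (h 0)).and (hV.eventually_mem hzV))
    have hWV : W ⊆ V := fun q hq => (hW q hq).2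
    exact ⟨W, hWV.trans hVU, hWo, hzW, Γ, ⟨fun i j k => (hΓ.1 i j k).mono hWV,
      fun i j k q hq => hΓ.2 i j k q (hWV hq)⟩, fun q hq => hP q (hWV hq), fun q hq => (hW q hq).1⟩
  tfae_have 5 → 3 := fun ⟨V, hVU, hV, hzV, Γ, hΓ, hP, h0⟩ =>
    shrink hVU (exists_linearizes_of_flat hV hΓ hP h0 hzV)
  tfae_have 3 → 2 := fun ⟨W, hWU, hW, hzW, u, v, h⟩ => ⟨W, hWU, hW, hzW, u, v, 0, 0, 0, h⟩
  tfae_have 2 → 3 := fun ⟨W, hWU, hW, hzW, u, v, α, β, γ, _, hL⟩ =>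
    shrink hWU (hL.exists_linearizes_zero hW hzW)
  tfae_have 3 → 1 := fun ⟨W, _, hW, hzW, u, v, _, hL⟩ => hL.hasSymmetryAlgebra hW hzW
  tfae_finish
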